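/- Let $n\ge 3$. Let $\Gamma\subset\mathbb{R}^n$ be an open, convex, connected, symmetric cone with vertex at $0$ such that $\{\lambda:\lambda_i>0\ \forall i\}\subseteq\Gamma\subseteq\{\lambda:\lambda_1+\dots+\lambda_n>0\}$, and let $f\in C^\infty(\Gamma)\cap C^0(\overline\Gamma)$ be concave, 1-homogeneous and symmetric, with $f>0$ in $\Gamma$, $f=0$ on $\partial\Gamma$ and $\partial f/\partial\lambda_i>0$ in $\Gamma$ for all $i$. Let $\mu_\Gamma^+$ be the (unique) number with $(-\mu_\Gamma^+,1,\dots,1)\in\partial\Gamma$, assume $\mu_\Gamma^+>1$, and put $\beta=\frac{2}{\mu_\Gamma^+-1}$. Let $g_0$ be a smooth Riemannian metric on an open neighbourhood $\Omega$ of the origin in $\mathbb{R}^n$, let $d$ be its Riemannian distance (the infimum of the lengths of $C^1$ paths in $\Omega$), $r(x)=d(0,x)$, $\mathbb{S}_\rho=\{x\in\Omega: r(x)=\rho\}$ and $A_{r_-,r_+}=\{x\in\Omega: r_-<r(x)<r_+\}$. For a function $w$ write $g_w=e^{2w}g_0$, let $A_g=\frac{1}{n-2}\big(\mathrm{Ric}_g-\frac{R_g}{2(n-1)}g\big)$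 be the Schouten tensor, and let $\lambda(T)$ be the vector of eigenvalues of a $(1,1)$-tensor $T$. Then there is a constant $C>1$ depending only on $g_0$, $f$ and $\Gamma$, and for each $\varepsilon>0$ a constant $0<R<1$ depending only on $g_0$, $f$, $\Gamma$ and $\varepsilon$, such that for all $m\in\mathbb{R}$ and all $r_\pm>0$ with $$1<\frac{r_+}{r_-}<1+\frac{\varepsilon}{2(\beta+2)}\quad\text{and}\quad r_+<R,$$ the function $$w=(\beta+\varepsilon)\ln\Big(\frac{r_+-r}{r_+-r_-}\Big)+m$$ is $C^2$ on $A_{r_-,r_+}$ and satisfies $$\begin{cases} f(\lambda(-g_w^{-1}A_{g_w}))\ \ge\ \dfrac{f(-\mu_\Gamma^++C^{-1}\varepsilon,\,1,\dots,1)}{C\,e^{2m}(r_+-r_-)^2}\ >\ 0,\qquad \lambda(-g_w^{-1}A_{g_w})\in\Gamma & \text{on }A_{r_-,r_+},\\[1ex] w(x)=m & \text{for }x\in\mathbb{S}_{r_-},\\ w(x)\to-\infty & \text{as } d(x,\mathbb{S}_{r_+})\to 0,\ x\in A_{r_-,r_+}.\end{cases}$$ -/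

import Mathlib

open Set Filter Topology MeasureTheory
open scoped ContDiff

noncomputable section

/-- `Γ ⊂ ℝⁿ` is an open, convex, connected, symmetric cone with vertex at `0`, and
`Γ_n⁺ ⊆ Γ ⊆ Γ_1⁺`. -/
structure IsAdmissibleCone {n : ℕ} (Γ : Set (Fin n → ℝ)) : Prop where
  isOpen : IsOpen Γ
  convex : Convex ℝ Γ
  isConnected : IsConnected Γ
  symmetric : ∀ (σ : Equiv.Perm (Fin n)), ∀ l ∈ Γ, l ∘ σ ∈ Γ
  cone : ∀ t : ℝ, 0 < t → ∀ l ∈ Γ, t • l ∈ Γ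
  positive_subset : {l : Fin n → ℝ | ∀ i, 0 < l i} ⊆ Γ
  subset_trace : Γ ⊆ {l : Fin n → ℝ | 0 < ∑ i, l i}

/-- `f ∈ C^∞(Γ) ∩ C⁰(closure Γ)` is concave, 1-homogeneous and symmetric, positive in `Γ`, zero on
`∂Γ`, with positive partial derivatives in `Γ`. -/
structure IsAdmissibleFunction {n : ℕ} (Γ : Set (Fin n → ℝ)) (f : (Fin n → ℝ) → ℝ) : Prop where
  smooth : ContDiffOn ℝ ∞ f Γ
  continuousOn : ContinuousOn f (closure Γ)
  concave : ConcaveOn ℝ Γ f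
  homogeneous : ∀ t : ℝ, 0 < t → ∀ l ∈ Γ, f (t • l) = t * f l
  symmetric : ∀ (σ : Equiv.Perm (Fin n)), ∀ l ∈ Γ, f (l ∘ σ) = f l
  pos : ∀ l ∈ Γ, 0 < f l
  zero : ∀ l ∈ frontier Γ, f l = 0
  deriv_pos : ∀ l ∈ Γ, ∀ i, 0 < fderiv ℝ f l (Pi.single i 1)

/-- The vector `(t, 1, …, 1) ∈ ℝⁿ`. -/
def firstThenOnes (n : ℕ) (t : ℝ) : Fin n → ℝ := fun i => if (i : ℕ) = 0 then t else 1

/-- `μ` is the number `μ_Γ⁺`, that is, `(-μ, 1, …, 1) ∈ ∂Γ`. For an admissible cone with `n ≥ 2`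
there is exactly one such number. -/
def IsMuPlus {n : ℕ} (Γ : Set (Fin n → ℝ)) (μ : ℝ) : Prop :=
  firstThenOnes n (-μ) ∈ frontier Γ

/-- `g` (the matrix of components `g_{ij}(x)` in the standard coordinates) is a smooth Riemannian
metric on the set `Ω ⊆ ℝⁿ`. -/
structure IsRiemannianMetricOn {n : ℕ} (Ω : Set (Fin n → ℝ))
    (g : (Fin n → ℝ) → Matrix (Fin n) (Fin n) ℝ) : Prop where
  smooth : ∀ i j, ContDiffOn ℝ ∞ (fun x => g x i j) Ω
  posDef : ∀ x ∈ Ω, (g x).PosDef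

/-! ### Curvature in coordinates -/

/-- The partial derivative `∂F/∂xⁱ`. -/
def partialDeriv {n : ℕ} (i : Fin n) (F : (Fin n → ℝ) → ℝ) (x : Fin n → ℝ) : ℝ :=
  fderiv ℝ F x (Pi.single i 1)

/-- The Christoffel symbol `Γ^k_{ij}` of the Levi-Civita connection of `g`. -/
def christoffel {n : ℕ} (g : (Fin n → ℝ) → Matrix (Fin n) (Fin n) ℝ) (k i j : Fin n)
    (x : Fin n → ℝ) : ℝ :=
  (1 / 2) * ∑ l, (g x)⁻¹ k l *
    (partialDeriv i (fun y => g y j l) x + partialDeriv j (fun y => g y i l) x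
      - partialDeriv l (fun y => g y i j) x)

/-- The Ricci tensor
`R_{ij} = ∂_k Γ^k_{ij} - ∂_j Γ^k_{ik} + Γ^k_{kl} Γ^l_{ij} - Γ^k_{jl} Γ^l_{ik}`. -/
def ricci {n : ℕ} (g : (Fin n → ℝ) → Matrix (Fin n) (Fin n) ℝ) (x : Fin n → ℝ) :
    Matrix (Fin n) (Fin n) ℝ :=
  Matrix.of fun i j =>
    (∑ k, (partialDeriv k (christoffel g k i j) x - partialDeriv j (christoffel g k i k) x)) +
    ∑ k, ∑ l, (christoffel g k k l x * christoffel g l i j x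
      - christoffel g k j l x * christoffel g l i k x)

/-- The scalar curvature `g^{ij} R_{ij}`. -/
def scalarCurvature {n : ℕ} (g : (Fin n → ℝ) → Matrix (Fin n) (Fin n) ℝ) (x : Fin n → ℝ) : ℝ :=
  ∑ i, ∑ j, (g x)⁻¹ i j * ricci g x i j

/-- The `(0,2)`-Schouten tensor `A_g = (Ric_g - R_g / (2 (n - 1)) g) / (n - 2)`. -/
def schouten {n : ℕ} (g : (Fin n → ℝ) → Matrix (Fin n) (Fin n) ℝ) (x : Fin n → ℝ) :
    Matrix (Fin n) (Fin n) ℝ :=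
  (1 / ((n : ℝ) - 2)) • (ricci g x - (scalarCurvature g x / (2 * ((n : ℝ) - 1))) • g x)

/-- The conformal metric `g_w = e^{2w} g`. -/
def conformalMetric {n : ℕ} (w : (Fin n → ℝ) → ℝ) (g : (Fin n → ℝ) → Matrix (Fin n) (Fin n) ℝ) :
    (Fin n → ℝ) → Matrix (Fin n) (Fin n) ℝ :=
  fun x => Real.exp (2 * w x) • g x

/-- The matrix of the `(1,1)`-tensor `-g⁻¹ A_g` at `x`. -/
def negSchoutenEndo {n : ℕ} (g : (Fin n → ℝ) → Matrix (Fin n) (Fin n) ℝ) (x : Fin n → ℝ) :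
    Matrix (Fin n) (Fin n) ℝ :=
  -((g x)⁻¹ * schouten g x)

/-- `l` lists the eigenvalues of `T` with algebraic multiplicity; such an `l` is unique up to a
permutation of its entries. -/
def IsEigenvalueVector {n : ℕ} (T : Matrix (Fin n) (Fin n) ℝ) (l : Fin n → ℝ) : Prop :=
  T.charpoly = ∏ i, (Polynomial.X - Polynomial.C (l i))

/-! ### Riemannian distance -/

/-- `γ` restricts to a `C¹` path `[0,1] → Ω` from `x` to `y`. -/
structure IsPathIn {n : ℕ} (Ω : Set (Fin n → ℝ)) (x y : Fin n → ℝ) (γ : ℝ → Fin n → ℝ) : Prop where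
  contDiffOn : ContDiffOn ℝ 1 γ (Icc 0 1)
  mapsTo : MapsTo γ (Icc 0 1) Ω
  source : γ 0 = x
  target : γ 1 = y

/-- The length `∫₀¹ √(g_{ij}(γ) γ'ⁱ γ'ʲ) dt` of a path. -/
def pathLength {n : ℕ} (g : (Fin n → ℝ) → Matrix (Fin n) (Fin n) ℝ) (γ : ℝ → Fin n → ℝ) :
    ENNReal :=
  ∫⁻ t in Icc (0 : ℝ) 1, ENNReal.ofReal (Real.sqrt (∑ i, ∑ j,
    g (γ t) i j * derivWithin γ (Icc 0 1) t i * derivWithin γ (Icc 0 1) t j))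

/-- The Riemannian distance of `(Ω, g)`: the infimum of the lengths of the paths in `Ω` from `x`
to `y`, equal to `⊤` if there is no such path. -/
def riemDist {n : ℕ} (Ω : Set (Fin n → ℝ)) (g : (Fin n → ℝ) → Matrix (Fin n) (Fin n) ℝ)
    (x y : Fin n → ℝ) : ENNReal :=
  ⨅ γ ∈ {γ : ℝ → Fin n → ℝ | IsPathIn Ω x y γ}, pathLength g γ

/-- The distance `d(x, S)` of a point to a set. -/
def riemDistToSet {n : ℕ} (Ω : Set (Fin n → ℝ)) (g : (Fin n → ℝ) → Matrix (Fin n) (Fin n) ℝ)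
    (x : Fin n → ℝ) (S : Set (Fin n → ℝ)) : ENNReal :=
  ⨅ y ∈ S, riemDist Ω g x y

/-- The geodesic sphere of radius `ρ` centred at the origin. -/
def geodesicSphere {n : ℕ} (Ω : Set (Fin n → ℝ)) (g : (Fin n → ℝ) → Matrix (Fin n) (Fin n) ℝ)
    (ρ : ℝ) : Set (Fin n → ℝ) :=
  {x ∈ Ω | riemDist Ω g 0 x = ENNReal.ofReal ρ}

/-- The open geodesic annulus with radii `ρ₁ < ρ₂` centred at the origin. -/
def geodesicAnnulus {n : ℕ} (Ω : Set (Fin n → ℝ)) (g : (Fin n → ℝ) → Matrix (Fin n) (Fin n) ℝ)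
    (ρ₁ ρ₂ : ℝ) : Set (Fin n → ℝ) :=
  {x ∈ Ω | ENNReal.ofReal ρ₁ < riemDist Ω g 0 x ∧ riemDist Ω g 0 x < ENNReal.ofReal ρ₂}

/-- The radial function `w(r) = κ ln ((r₊ - r) / (r₊ - r₋)) + m`, with `r(x) = d_g(0, x)`. -/
def radialLog {n : ℕ} (Ω : Set (Fin n → ℝ)) (g : (Fin n → ℝ) → Matrix (Fin n) (Fin n) ℝ)
    (κ m rminus rplus : ℝ) : (Fin n → ℝ) → ℝ :=
  fun x => κ * Real.log ((rplus - (riemDist Ω g 0 x).toReal) / (rplus - rminus)) + m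

end

/-! ### Admissible cones and functions -/

/-! Put g = g₀, r = d(0,·), s = r₊ - r, θ = s/r and κ = β + ε. The conformal law reads -g_w⁻¹A_{g_w}
= e^{-2w} g⁻¹(∇²w - dw⊗dw + ½|dw|²g - A_g). Near the origin |dr| = 1 and ∇²r is close to (g -
dr⊗dr)/r, while w' = -κ/s and w'' = -κ/s². Up to small errors the bracket is therefore s⁻²(T g - (κ
+ κ² - κθ) dr⊗dr) with T = κ²/2 - κθ: the tangential eigenvalues are T and the radial one is T - κ -
κ² + κθ, all times e^{-2w}s⁻². As θ → 0 the quotient radial/tangential tends to -(1 + 2/κ), and μ =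
1 + 2/β. So the exponent β lands exactly on the boundary ray through (-μ,1,…,1), and the extra ε
moves the quotient inward by 2ε/(βκ). The bound on r₊/r₋ makes κθ cost at most half of this gain,
small R makes the curvature errors cost at most a quarter, and the last quarter is kept as δ =
ε/(2βκ) (`radial_coefficient_bounds`). A min-max argument (`exists_eigenvalueVector_ge`) and
monotonicity of f along closure Γ turn this into membership in Γ and a lower bound for f;
`firstThenOnes_quotient_le` makes C independent of ε.

The conformal law is a coordinate computation, with all calculus separated from the index algebra in
`ricci_conformal_algebra`.

The analytic core is that φ = r² is C² near 0 with Hessian 2g(0) there. Consider the Hamiltonian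
flow of ½g^{ij}p_ip_j. The two point problem x(0) = 0, x(1) = y is solved for small y by the inverse
function theorem in C([0,1]). With p(y) the final momentum and φ(y) twice the energy, the first
variation formula gives dφ = 2p. Hence φ is C² and |dφ|² = 4φ, and dp(0) = g(0) gives the Hessian.
Trajectories have constant speed √φ(y), so d(0,y) ≤ √φ(y); truncations of √φ are 1-Lipschitz and
calibrate the reverse inequality. `exists_sq_riemDist` collects what is used. -/

theorem IsAdmissibleCone.add_mem {n : ℕ} {Γ : Set (Fin n → ℝ)} (hΓ : IsAdmissibleCone Γ)
    {a b : Fin n → ℝ} (ha : a ∈ Γ) (hb : b ∈ Γ) : a + b ∈ Γ := by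
  have h := hΓ.convex ha hb (a := 1 / 2) (b := 1 / 2) (by norm_num) (by norm_num) (by norm_num)
  have h2 := hΓ.cone 2 (by norm_num) _ h
  simpa [smul_add, smul_smul] using h2

open scoped Pointwise in
-- For open Γ one has Γ + closure Γ = Γ + Γ. This lets boundary vectors such as (-μ,1,…,1) enter as
-- summands.
theorem IsAdmissibleCone.add_closure_mem {n : ℕ} {Γ : Set (Fin n → ℝ)}
    (hΓ : IsAdmissibleCone Γ) {a b : Fin n → ℝ} (ha : a ∈ Γ) (hb : b ∈ closure Γ) :
    a + b ∈ Γ := by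
  have h := Set.add_mem_add ha hb
  rw [hΓ.isOpen.add_closure] at h
  obtain ⟨c, hc, d, hd, hcd⟩ := h
  rw [← hcd]
  exact hΓ.add_mem hc hd

theorem IsAdmissibleCone.nonneg_mem_closure {n : ℕ} {Γ : Set (Fin n → ℝ)}
    (hΓ : IsAdmissibleCone Γ) {b : Fin n → ℝ} (hb : ∀ i, 0 ≤ b i) : b ∈ closure Γ := by
  have ht : Tendsto (fun t : ℝ => b + t • (1 : Fin n → ℝ)) (𝓝[>] 0) (𝓝 b) := by
    have : Tendsto (fun t : ℝ => b + t • (1 : Fin n → ℝ)) (𝓝 0) (𝓝 (b + (0 : ℝ) • 1)) := by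
      apply Continuous.tendsto
      fun_prop
    rw [zero_smul, add_zero] at this
    exact this.mono_left nhdsWithin_le_nhds
  refine mem_closure_of_tendsto ht ?_
  filter_upwards [self_mem_nhdsWithin] with t ht
  apply hΓ.positive_subset
  intro i
  have h1 := hb i
  have h2 : (0 : ℝ) < t := ht
  simp only [Pi.add_apply, Pi.smul_apply, Pi.one_apply, smul_eq_mul, mul_one]
  linarith

theorem IsAdmissibleCone.smul_closure_mem {n : ℕ} {Γ : Set (Fin n → ℝ)}
    (hΓ : IsAdmissibleCone Γ) {t : ℝ} (ht : 0 ≤ t) {b : Fin n → ℝ} (hb : b ∈ closure Γ) :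
    t • b ∈ closure Γ := by
  rcases ht.eq_or_lt with rfl | ht
  · exact hΓ.nonneg_mem_closure (by simp)
  · exact map_mem_closure (continuous_const_smul t) hb (fun l hl => hΓ.cone t ht l hl)

theorem IsAdmissibleFunction.add_le {n : ℕ} {Γ : Set (Fin n → ℝ)} {f : (Fin n → ℝ) → ℝ}
    (hΓ : IsAdmissibleCone Γ) (hf : IsAdmissibleFunction Γ f) {a b : Fin n → ℝ}
    (ha : a ∈ Γ) (hb : b ∈ Γ) : f a + f b ≤ f (a + b) := by
  have h := hf.concave.2 ha hb (by norm_num : (0 : ℝ) ≤ 1 / 2) (by norm_num : (0 : ℝ) ≤ 1 / 2)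
    (by norm_num)
  have hm := hΓ.convex ha hb (a := 1 / 2) (b := 1 / 2) (by norm_num) (by norm_num) (by norm_num)
  have h2 := hf.homogeneous 2 (by norm_num) _ hm
  have e : (2 : ℝ) • ((1 / 2 : ℝ) • a + (1 / 2 : ℝ) • b) = a + b := by
    simp [smul_add, smul_smul]
  rw [e] at h2
  rw [h2]
  simp only [smul_eq_mul] at h
  linarith

/-- Superadditivity (from concavity and homogeneity) and f > 0 make f nondecreasing in the
directions of Γ; continuity extends this to closure Γ. Since nonnegative vectors lie in closure Γ,
entrywise larger eigenvalues give larger f. -/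
theorem IsAdmissibleFunction.le_add_closure {n : ℕ} {Γ : Set (Fin n → ℝ)}
    {f : (Fin n → ℝ) → ℝ} (hΓ : IsAdmissibleCone Γ) (hf : IsAdmissibleFunction Γ f)
    {a b : Fin n → ℝ} (ha : a ∈ Γ) (hb : b ∈ closure Γ) : f a ≤ f (a + b) := by
  obtain ⟨u, hu, hub⟩ := mem_closure_iff_seq_limit.1 hb
  have hab := hΓ.add_closure_mem ha hb
  have hc : ContinuousAt f (a + b) :=
    hf.continuousOn.continuousAt (mem_of_superset (hΓ.isOpen.mem_nhds hab) subset_closure)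
  have ht : Tendsto (fun k => f (a + u k)) atTop (𝓝 (f (a + b))) :=
    hc.tendsto.comp (tendsto_const_nhds.add hub)
  refine ge_of_tendsto' ht fun k => ?_
  have h1 := hf.add_le hΓ ha (hu k)
  have h2 := hf.pos _ (hu k)
  linarith

/-- The convex combination θ(1,…,1) + (1-θ)(-μ,1,…,1) has first entry -μ + θ(1+μ), so θ = s/(1+μ)
realises the shift s. Capping s at 1 keeps θ < 1; the remaining t - s is a nonnegative vector. -/
theorem firstThenOnes_mem {n : ℕ} {Γ : Set (Fin n → ℝ)} (hΓ : IsAdmissibleCone Γ)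
    {μ : ℝ} (hμ : IsMuPlus Γ μ) (hμ1 : 1 < μ) {t : ℝ} (ht : 0 < t) :
    firstThenOnes n (-μ + t) ∈ Γ := by
  have hcl : firstThenOnes n (-μ) ∈ closure Γ := frontier_subset_closure hμ
  set s := min t 1 with hs
  have hs0 : 0 < s := lt_min ht one_pos
  have hs1 : s ≤ 1 := min_le_right _ _
  have hst : s ≤ t := min_le_left _ _
  set θ := s / (1 + μ) with hθ
  have hμ0 : 0 < 1 + μ := by linarith
  have hθ0 : 0 < θ := div_pos hs0 hμ0
  have hθ1 : θ < 1 := by rw [hθ, div_lt_one hμ0]; linarith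
  have h1 : (θ • (1 : Fin n → ℝ)) ∈ Γ := hΓ.positive_subset (fun i => by simpa using hθ0)
  have h2 := hΓ.add_closure_mem h1 (hΓ.smul_closure_mem (t := 1 - θ) (by linarith) hcl)
  have h3 : (fun i : Fin n => if (i : ℕ) = 0 then t - s else 0) ∈ closure Γ := by
    apply hΓ.nonneg_mem_closure
    intro i
    split_ifs
    · linarith
    · exact le_rfl
  have h4 := hΓ.add_closure_mem h2 h3
  convert h4 using 1
  funext i
  have hθs : θ * (1 + μ) = s := div_mul_cancel₀ _ hμ0.ne'
  simp only [firstThenOnes, Pi.add_apply, Pi.smul_apply, Pi.one_apply, smul_eq_mul]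
  split_ifs
  · linarith
  · ring

/-- Linear lower bound for a concave function of t along a segment starting on ∂Γ: (-μ+s,1,…,1) is
s/t times (-μ+t,1,…,1) plus a nonnegative multiple of the boundary vector, and adding the latter
does not decrease f. -/
theorem firstThenOnes_div_mul_le {n : ℕ} {Γ : Set (Fin n → ℝ)}
    (hΓ : IsAdmissibleCone Γ) {f : (Fin n → ℝ) → ℝ} (hf : IsAdmissibleFunction Γ f)
    {μ : ℝ} (hμ : IsMuPlus Γ μ) (hμ1 : 1 < μ) {s t : ℝ} (hs : 0 < s) (hst : s ≤ t) :
    s / t * f (firstThenOnes n (-μ + t)) ≤ f (firstThenOnes n (-μ + s)) := by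
  have ht : 0 < t := hs.trans_le hst
  have hm := firstThenOnes_mem hΓ hμ hμ1 ht
  have hθ : 0 < s / t := div_pos hs ht
  have hθ1 : s / t ≤ 1 := (div_le_one ht).2 hst
  rw [← hf.homogeneous _ hθ _ hm]
  have h := hf.le_add_closure hΓ (hΓ.cone _ hθ _ hm)
    (hΓ.smul_closure_mem (t := 1 - s / t) (by linarith) (frontier_subset_closure hμ))
  refine h.trans_eq (congrArg f ?_)
  funext i
  have : s / t * t = s := div_mul_cancel₀ _ ht.ne'
  simp only [firstThenOnes, Pi.add_apply, Pi.smul_apply, smul_eq_mul]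
  split_ifs
  · linear_combination this
  · ring

theorem firstThenOnes_mono {n : ℕ} {Γ : Set (Fin n → ℝ)}
    (hΓ : IsAdmissibleCone Γ) {f : (Fin n → ℝ) → ℝ} (hf : IsAdmissibleFunction Γ f)
    {μ : ℝ} (hμ : IsMuPlus Γ μ) (hμ1 : 1 < μ) {s t : ℝ} (hs : 0 < s) (hst : s ≤ t) :
    f (firstThenOnes n (-μ + s)) ≤ f (firstThenOnes n (-μ + t)) := by
  have hm := firstThenOnes_mem hΓ hμ hμ1 hs
  have h3 : (fun i : Fin n => if (i : ℕ) = 0 then t - s else 0) ∈ closure Γ := by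
    apply hΓ.nonneg_mem_closure
    intro i
    split_ifs
    · linarith
    · exact le_rfl
  refine (hf.le_add_closure hΓ hm h3).trans_eq (congrArg f ?_)
  funext i
  simp only [firstThenOnes, Pi.add_apply]
  split_ifs
  · ring
  · ring

/-! ### Eigenvalue vectors -/

open Matrix in
open scoped MatrixOrder Matrix.Norms.L2Operator in
/-- A positive definite form has an orthonormal frame. -/
theorem Matrix.PosDef.exists_congr_one {n : ℕ} {g : Matrix (Fin n) (Fin n) ℝ} (hg : g.PosDef) :
    ∃ P : Matrix (Fin n) (Fin n) ℝ, IsUnit P.det ∧ Pᵀ * g * P = 1 ∧ g⁻¹ = P * Pᵀ := by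
  obtain ⟨B, hgB⟩ := CStarAlgebra.nonneg_iff_eq_star_mul_self.mp hg.posSemidef.nonneg
  rw [Matrix.star_eq_conjTranspose, Matrix.conjTranspose_eq_transpose_of_trivial] at hgB
  have hd : IsUnit B.det := by
    have h := hg.det_pos
    rw [hgB, Matrix.det_mul, Matrix.det_transpose] at h
    exact isUnit_iff_ne_zero.2 (fun h0 => by simp [h0] at h)
  refine ⟨B⁻¹, by rw [Matrix.det_nonsing_inv]; exact hd.ringInverse, ?_, ?_⟩
  · rw [hgB]
    calc (B⁻¹)ᵀ * (Bᵀ * B) * B⁻¹ = (B * B⁻¹)ᵀ * (B * B⁻¹) := by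
          rw [Matrix.transpose_mul]; simp only [Matrix.mul_assoc]
      _ = 1 := by rw [Matrix.mul_nonsing_inv _ hd]; simp
  · rw [hgB, Matrix.mul_inv_rev, Matrix.transpose_nonsing_inv]

open Matrix in
/-- The Cauchy-Schwarz inequality for a form and its inverse. -/
theorem Matrix.PosDef.dotProduct_sq_le {n : ℕ} {g : Matrix (Fin n) (Fin n) ℝ} (hg : g.PosDef)
    (a v : Fin n → ℝ) : (a ⬝ᵥ v) ^ 2 ≤ (a ⬝ᵥ g⁻¹ *ᵥ a) * (v ⬝ᵥ g *ᵥ v) := by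
  obtain ⟨P, hP, hPg, hginv⟩ := hg.exists_congr_one
  obtain ⟨u, rfl⟩ : ∃ u, v = P *ᵥ u :=
    ⟨P⁻¹ *ᵥ v, by rw [Matrix.mulVec_mulVec, Matrix.mul_nonsing_inv _ hP, Matrix.one_mulVec]⟩
  have h1 : a ⬝ᵥ P *ᵥ u = (Pᵀ *ᵥ a) ⬝ᵥ u := by
    rw [Matrix.dotProduct_mulVec, Matrix.mulVec_transpose]
  have h2 : a ⬝ᵥ g⁻¹ *ᵥ a = (Pᵀ *ᵥ a) ⬝ᵥ (Pᵀ *ᵥ a) := by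
    rw [hginv, ← Matrix.mulVec_mulVec, Matrix.dotProduct_mulVec, ← Matrix.mulVec_transpose]
  have h3 : (P *ᵥ u) ⬝ᵥ g *ᵥ (P *ᵥ u) = u ⬝ᵥ u := by
    have : ∀ b, (P *ᵥ u) ⬝ᵥ g *ᵥ (P *ᵥ b) = u ⬝ᵥ (Pᵀ * g * P) *ᵥ b := fun b => by
      rw [← Matrix.vecMul_transpose, ← Matrix.dotProduct_mulVec]
      simp only [Matrix.mulVec_mulVec, Matrix.mul_assoc]
    rw [this, hPg, Matrix.one_mulVec]
  rw [h1, h2, h3]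
  simpa only [dotProduct, pow_two] using
    Finset.sum_mul_sq_le_sq_mul_sq Finset.univ (Pᵀ *ᵥ a) u

open Matrix in
/-- If `S ≥ T (g - ℓ ⊗ ℓ) - ρ T ℓ ⊗ ℓ` with `|ℓ|_g ≤ 1` then the eigenvalues of `g⁻¹ S` dominate
those of the right hand side. -/
theorem exists_eigenvalueVector_ge {n : ℕ} (hn : 3 ≤ n) {g S : Matrix (Fin n) (Fin n) ℝ}
    (hg : g.PosDef) (hS : S.IsSymm) {ℓ : Fin n → ℝ} {T ρ : ℝ} (hT : 0 < T) (hρ : -1 ≤ ρ)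
    (hℓ : ∀ v : Fin n → ℝ, (ℓ ⬝ᵥ v) ^ 2 ≤ v ⬝ᵥ g *ᵥ v)
    (hST : ∀ v : Fin n → ℝ,
      T * (v ⬝ᵥ g *ᵥ v - (ℓ ⬝ᵥ v) ^ 2) - ρ * T * (ℓ ⬝ᵥ v) ^ 2 ≤ v ⬝ᵥ S *ᵥ v) :
    ∃ l : Fin n → ℝ, IsEigenvalueVector (g⁻¹ * S) l ∧
      ∀ i, T * firstThenOnes n (-ρ) i ≤ l i := by
  obtain ⟨P, hP, hPg, hginv⟩ := hg.exists_congr_one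
  have hH : (Pᵀ * S * P).IsHermitian := by
    unfold Matrix.IsHermitian
    rw [Matrix.conjTranspose_eq_transpose_of_trivial]
    simp only [Matrix.transpose_mul, Matrix.transpose_transpose, hS.eq, Matrix.mul_assoc]
  set lam := hH.eigenvalues with hlam
  have hchar : (g⁻¹ * S).charpoly = ∏ i, (Polynomial.X - Polynomial.C (lam i)) := by
    have h1 : (g⁻¹ * S).charpoly = (Pᵀ * S * P).charpoly := by
      rw [hginv, Matrix.mul_assoc, Matrix.charpoly_mul_comm]
    rw [h1, hH.charpoly_eq]
    simp [hlam]
  set e : Fin n → Fin n → ℝ := fun i => ⇑(hH.eigenvectorBasis i) with he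
  have heig : ∀ i, (Pᵀ * S * P) *ᵥ e i = lam i • e i := fun i => hH.mulVec_eigenvectorBasis i
  have horth : ∀ i j, e i ⬝ᵥ e j = if i = j then 1 else 0 := by
    intro i j
    have := orthonormal_iff_ite.1 hH.eigenvectorBasis.orthonormal j i
    rw [EuclideanSpace.inner_eq_star_dotProduct] at this
    simp only [star_trivial] at this
    rw [he]
    simp only
    rw [this]
    by_cases hij : i = j
    · simp [hij]
    · simp [hij, Ne.symm hij]
  set v : Fin n → Fin n → ℝ := fun i => P *ᵥ e i with hv
  have hgv : ∀ a b : Fin n → ℝ, (P *ᵥ a) ⬝ᵥ g *ᵥ (P *ᵥ b) = a ⬝ᵥ b := by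
    intro a b
    have : (P *ᵥ a) ⬝ᵥ g *ᵥ (P *ᵥ b) = a ⬝ᵥ (Pᵀ * g * P) *ᵥ b := by
      rw [← Matrix.vecMul_transpose, ← Matrix.dotProduct_mulVec]
      simp only [Matrix.mulVec_mulVec, Matrix.mul_assoc]
    rw [this, hPg, Matrix.one_mulVec]
  have hSv : ∀ a b : Fin n → ℝ, (P *ᵥ a) ⬝ᵥ S *ᵥ (P *ᵥ b) = a ⬝ᵥ (Pᵀ * S * P) *ᵥ b := by
    intro a b
    rw [← Matrix.vecMul_transpose, ← Matrix.dotProduct_mulVec]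
    simp only [Matrix.mulVec_mulVec, Matrix.mul_assoc]
  -- For g(v,v) = 1 the lower bound on S equals T - (1+ρ)T ℓ(v)², and here ℓ(v)² ≤ 1 and 1 + ρ ≥ 0.
  have hlow : ∀ i, -ρ * T ≤ lam i := by
    intro i
    have h1 := hST (v i)
    have h2 := hℓ (v i)
    rw [hv] at h1 h2
    simp only at h1 h2
    rw [hgv, horth, if_pos rfl] at h2
    rw [hgv, hSv, heig, dotProduct_smul, horth, if_pos rfl, smul_eq_mul, mul_one] at h1
    nlinarith [mul_nonneg (mul_nonneg hT.le (by linarith : 0 ≤ 1 + ρ)) (sub_nonneg.2 h2)]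
  -- S ≥ T g on the hyperplane ker ℓ. Two eigenvectors with eigenvalues below T would span a plane
  -- meeting ker ℓ in a nonzero vector, namely `b • e i - a • e j`, or `e i` itself if ℓ vanishes on
  -- it.
  have huniq : ∀ i j, i ≠ j → lam i < T → T ≤ lam j := by
    intro i j hij hi
    by_contra! hj
    by_cases hz : ℓ ⬝ᵥ v i = 0
    · have h1 := hST (v i)
      rw [hz] at h1
      rw [hv] at h1
      simp only at h1
      rw [hgv, hSv, heig, dotProduct_smul, horth, if_pos rfl, smul_eq_mul, mul_one] at h1
      nlinarith
    · set a := ℓ ⬝ᵥ v i with ha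
      set b := ℓ ⬝ᵥ v j with hb
      have h1 := hST (P *ᵥ (b • e i - a • e j))
      have hzero : ℓ ⬝ᵥ (P *ᵥ (b • e i - a • e j)) = 0 := by
        rw [Matrix.mulVec_sub, Matrix.mulVec_smul, Matrix.mulVec_smul, dotProduct_sub,
          dotProduct_smul, dotProduct_smul]
        change b • a - a • b = 0
        simp [mul_comm]
      rw [hzero, hgv, hSv] at h1
      simp only [Matrix.mulVec_sub, Matrix.mulVec_smul, heig, dotProduct_sub, sub_dotProduct,
        dotProduct_smul, smul_dotProduct, horth, if_neg hij, if_neg (Ne.symm hij), if_true,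
        smul_eq_mul] at h1
      have ha2 : 0 < a ^ 2 := by positivity
      have hb2 : 0 ≤ b ^ 2 := by positivity
      nlinarith
  have hpos : 0 < n := by omega
  obtain ⟨i₀, hi₀⟩ : ∃ i₀, ∀ j, j ≠ i₀ → T ≤ lam j := by
    by_cases hex : ∃ i, lam i < T
    · obtain ⟨i, hi⟩ := hex
      exact ⟨i, fun j hj => huniq i j (Ne.symm hj) hi⟩
    · push Not at hex
      exact ⟨⟨0, hpos⟩, fun j _ => hex j⟩
  -- The only index whose eigenvalue may lie below T goes to slot 0, where `firstThenOnes` has its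
  -- special entry.
  set σ : Equiv.Perm (Fin n) := Equiv.swap ⟨0, hpos⟩ i₀ with hσ
  refine ⟨lam ∘ σ, ?_, fun i => ?_⟩
  · unfold IsEigenvalueVector
    rw [hchar]
    exact (Equiv.prod_comp σ (fun i => Polynomial.X - Polynomial.C (lam i))).symm
  · simp only [firstThenOnes, Function.comp_apply]
    split_ifs with h
    · have := hlow (σ i)
      linarith
    · have : σ i ≠ i₀ := by
        intro hh
        apply h
        have h5 : i = σ.symm i₀ := by rw [← hh]; simp
        rw [h5, hσ, Equiv.symm_swap, Equiv.swap_apply_right]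
      have := hi₀ _ this
      linarith

/-- The final eigenvalue estimate: membership in `Γ` and the lower bound for `f`. -/
theorem exists_eigenvalueVector_mem_and_le {n : ℕ} (hn : 3 ≤ n) {Γ : Set (Fin n → ℝ)}
    (hΓ : IsAdmissibleCone Γ) {f : (Fin n → ℝ) → ℝ} (hf : IsAdmissibleFunction Γ f)
    {μ : ℝ} (hμ : IsMuPlus Γ μ) (hμ1 : 1 < μ) {g S : Matrix (Fin n) (Fin n) ℝ}
    (hg : g.PosDef) (hS : S.IsSymm) {ℓ : Fin n → ℝ} {T δ : ℝ} (hT : 0 < T) (hδ : 0 < δ)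
    (hδμ : δ ≤ μ + 1)
    (hℓ : ∀ v : Fin n → ℝ, (ℓ ⬝ᵥ v) ^ 2 ≤ v ⬝ᵥ g.mulVec v)
    (hST : ∀ v : Fin n → ℝ,
      T * (v ⬝ᵥ g.mulVec v - (ℓ ⬝ᵥ v) ^ 2) - (μ - δ) * T * (ℓ ⬝ᵥ v) ^ 2 ≤ v ⬝ᵥ S.mulVec v) :
    ∃ l : Fin n → ℝ, IsEigenvalueVector (g⁻¹ * S) l ∧ l ∈ Γ ∧
      T * f (firstThenOnes n (-μ + δ)) ≤ f l := by
  obtain ⟨l, hl, hle⟩ := exists_eigenvalueVector_ge hn hg hS hT (by linarith) hℓ hST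
  have hm := hΓ.cone T hT _ (firstThenOnes_mem hΓ hμ hμ1 hδ)
  have hcl : l - T • firstThenOnes n (-μ + δ) ∈ closure Γ := by
    apply hΓ.nonneg_mem_closure
    intro i
    have := hle i
    rw [show -(μ - δ) = -μ + δ by ring] at this
    simpa using this
  refine ⟨l, hl, ?_, ?_⟩
  · have := hΓ.add_closure_mem hm hcl
    simpa using this
  · have := hf.le_add_closure hΓ hm hcl
    rw [hf.homogeneous T hT _ (firstThenOnes_mem hΓ hμ hμ1 hδ)] at this
    simpa using this

/-! ### Conformal change of the Schouten tensor: algebra -/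

section ConformalAlgebra

variable {n : ℕ}

theorem sum_sum_ite_eq_left (j : Fin n) (F : Fin n → Fin n → ℝ) :
    ∑ k, ∑ l, (if k = j then F k l else 0) = ∑ l, F j l := by
  rw [Finset.sum_comm]; simp

/-- The difference `δ^k_i w_j + δ^k_j w_i - g_{ij} w^k` of the Levi-Civita connections of two
conformal metrics. -/
def conformalDiff (g : Fin n → Fin n → ℝ) (w W : Fin n → ℝ) (k i j : Fin n) : ℝ :=
  (if k = i then w j else 0) + (if k = j then w i else 0) - g i j * W k

/-- The partial derivative `∂_a` of `conformalDiff`. -/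
def conformalDiffDeriv (g : Fin n → Fin n → ℝ) (W : Fin n → ℝ) (H : Fin n → Fin n → ℝ)
    (dg : Fin n → Fin n → Fin n → ℝ) (dW : Fin n → Fin n → ℝ) (a k i j : Fin n) : ℝ :=
  (if k = i then H a j else 0) + (if k = j then H a i else 0) - (dg a i j * W k + g i j * dW a k)

variable {g : Fin n → Fin n → ℝ} {w W : Fin n → ℝ} {H : Fin n → Fin n → ℝ}
  {dg : Fin n → Fin n → Fin n → ℝ} {dW : Fin n → Fin n → ℝ} {G : Fin n → Fin n → Fin n → ℝ}

theorem conformalDiff_trace (hW : ∀ i, ∑ l, g i l * W l = w i) (gs : ∀ i j, g i j = g j i)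
    (l : Fin n) : ∑ k, conformalDiff g w W k k l = n * w l := by
  have h : ∑ k, g k l * W k = w l := by rw [← hW l]; simp_rw [gs l]
  simp only [conformalDiff, if_true, Finset.sum_sub_distrib, Finset.sum_add_distrib,
    Finset.sum_ite_eq', Finset.mem_univ, h]
  simp

theorem conformalDiffDeriv_trace
    (hdW : ∀ j i, ∑ k, (dg j i k * W k + g i k * dW j k) = H j i) (j i : Fin n) :
    ∑ k, conformalDiffDeriv g W H dg dW j k i k = n * H j i := by
  simp only [conformalDiffDeriv, if_true, Finset.sum_sub_distrib, Finset.sum_add_distrib,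
    Finset.sum_ite_eq', Finset.mem_univ]
  rw [← Finset.sum_add_distrib, hdW]
  simp

theorem conformalDiffDeriv_div (Hs : ∀ i j, H i j = H j i) (i j : Fin n) :
    ∑ k, conformalDiffDeriv g W H dg dW k k i j
      = 2 * H i j - ∑ k, dg k i j * W k - g i j * ∑ k, dW k k := by
  simp only [conformalDiffDeriv, Finset.sum_sub_distrib, Finset.sum_add_distrib,
    Finset.sum_ite_eq', Finset.mem_univ, if_true, Finset.mul_sum, Hs j i]
  ring

theorem sum_christoffel_mul_conformalDiff_left (i j : Fin n) :
    ∑ k, ∑ l, G k k l * conformalDiff g w W l i j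
      = (∑ k, G k k i) * w j + (∑ k, G k k j) * w i - g i j * ∑ k, ∑ l, G k k l * W l := by
  simp only [conformalDiff, mul_sub, mul_add, mul_ite, mul_zero, Finset.sum_sub_distrib,
    Finset.sum_add_distrib, Finset.sum_ite_eq', Finset.mem_univ, if_true, Finset.mul_sum,
    Finset.sum_mul]
  congr 1
  exact Finset.sum_congr rfl fun k _ => Finset.sum_congr rfl fun l _ => by ring

theorem sum_christoffel_mul_conformalDiff_right (i j : Fin n) :
    ∑ k, ∑ l, G k j l * conformalDiff g w W l i k
      = ∑ k, G k j i * w k + (∑ k, G k j k) * w i - ∑ k, ∑ l, G k j l * g i k * W l := by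
  simp only [conformalDiff, mul_sub, mul_add, mul_ite, mul_zero, Finset.sum_sub_distrib,
    Finset.sum_add_distrib, Finset.sum_ite_eq', Finset.mem_univ, if_true,
    Finset.sum_mul]
  congr 1
  exact Finset.sum_congr rfl fun k _ => Finset.sum_congr rfl fun l _ => by ring

theorem sum_conformalDiff_mul_christoffel (i j : Fin n) :
    ∑ k, ∑ l, conformalDiff g w W k j l * G l i k
      = ∑ l, G l i j * w l + (∑ k, G k i k) * w j - ∑ k, ∑ l, g j l * W k * G l i k := by
  simp only [conformalDiff, sub_mul, add_mul, ite_mul, zero_mul, Finset.sum_sub_distrib,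
    Finset.sum_add_distrib, Finset.sum_ite_eq, Finset.mem_univ, if_true,
    Finset.sum_mul]
  rw [sum_sum_ite_eq_left]
  congr 2
  · exact Finset.sum_congr rfl fun k _ => by ring
  · exact Finset.sum_congr rfl fun k _ => by ring

theorem sum_mul_conformalDiff (i j : Fin n) :
    ∑ l, w l * conformalDiff g w W l i j = 2 * w i * w j - g i j * ∑ l, w l * W l := by
  simp only [conformalDiff, mul_sub, mul_add, mul_ite, mul_zero, Finset.sum_sub_distrib,
    Finset.sum_add_distrib, Finset.sum_ite_eq', Finset.mem_univ, if_true, Finset.mul_sum]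
  congr 1
  · ring
  · exact Finset.sum_congr rfl fun k _ => by ring

theorem sum_conformalDiff_mul_conformalDiff (hW : ∀ i, ∑ l, g i l * W l = w i)
    (gs : ∀ i j, g i j = g j i) (i j : Fin n) :
    ∑ k, ∑ l, conformalDiff g w W k j l * conformalDiff g w W l i k
      = (n + 2) * w i * w j - 2 * g i j * ∑ l, w l * W l := by
  rw [sum_christoffel_mul_conformalDiff_right (G := conformalDiff g w W)]
  have h1 : ∑ k, conformalDiff g w W k j i * w k = 2 * w i * w j - g i j * ∑ l, w l * W l := by
    rw [← sum_mul_conformalDiff]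
    refine Finset.sum_congr rfl fun k _ => ?_
    rw [mul_comm]
    congr 1
    simp only [conformalDiff, gs i j]
    ring
  have h2 : ∑ k, conformalDiff g w W k j k = n * w j := by
    rw [← conformalDiff_trace hW gs j]
    refine Finset.sum_congr rfl fun k _ => ?_
    simp only [conformalDiff, gs k j]
    ring
  have h3 : ∑ k, ∑ l, conformalDiff g w W k j l * g i k * W l
      = g i j * ∑ l, w l * W l := by
    simp only [conformalDiff, sub_mul, add_mul, ite_mul, zero_mul, Finset.sum_sub_distrib,
      Finset.sum_add_distrib, Finset.sum_ite_eq, Finset.mem_univ, if_true]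
    rw [sum_sum_ite_eq_left]
    have e1 : ∑ k, w j * g i k * W k = w j * w i := by
      rw [← hW i, Finset.mul_sum]; exact Finset.sum_congr rfl fun k _ => by ring
    have e2 : ∑ k, ∑ l, g j l * W k * g i k * W l = w j * w i := by
      rw [← hW i, ← hW j, Finset.sum_mul_sum, Finset.sum_comm]
      exact Finset.sum_congr rfl fun k _ => Finset.sum_congr rfl fun l _ => by ring
    rw [e1, e2, Finset.mul_sum]
    have e3 : ∑ l, w l * g i j * W l = ∑ l, g i j * (w l * W l) :=
      Finset.sum_congr rfl fun k _ => by ring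
    rw [e3]; ring
  rw [h1, h2, h3]; ring

/-- Here G, dg, dW, H and dG are free symbols for the Christoffel symbols, the derivatives of metric
and gradient, the Hessian and the derivatives of G. Only three relations enter besides symmetries: W
is w with raised index, ∇g = 0 (`hdg`), and the derivative of g_{ik}W^k = w_i (`hdW`). The result is
Ric - (n-2)(∇²w - dw⊗dw) - (div W + (n-2)|dw|²)g. -/
theorem ricci_conformal_algebra (hW : ∀ i, ∑ l, g i l * W l = w i)
    (gs : ∀ i j, g i j = g j i) (Hs : ∀ i j, H i j = H j i)
    (Gs : ∀ k i j, G k i j = G k j i)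
    (hdg : ∀ a i j, dg a i j = ∑ l, (G l a i * g l j + G l a j * g i l))
    (hdW : ∀ j i, ∑ k, (dg j i k * W k + g i k * dW j k) = H j i)
    (dG : Fin n → Fin n → Fin n → Fin n → ℝ) (i j : Fin n) :
    (∑ k, ((dG k k i j + conformalDiffDeriv g W H dg dW k k i j)
        - (dG j k i k + conformalDiffDeriv g W H dg dW j k i k))) +
      ∑ k, ∑ l, ((G k k l + conformalDiff g w W k k l) * (G l i j + conformalDiff g w W l i j)
        - (G k j l + conformalDiff g w W k j l) * (G l i k + conformalDiff g w W l i k))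
    = ((∑ k, (dG k k i j - dG j k i k)) +
      ∑ k, ∑ l, (G k k l * G l i j - G k j l * G l i k))
      - ((n : ℝ) - 2) * (H i j - ∑ l, G l i j * w l - w i * w j)
      - (∑ k, dW k k + ∑ k, ∑ l, G k k l * W l + ((n : ℝ) - 2) * ∑ l, w l * W l) * g i j := by
  have A1 := conformalDiffDeriv_trace hdW j i
  have A2 := conformalDiffDeriv_div (g := g) (W := W) (dg := dg) (dW := dW) Hs i j
  have A3 := sum_christoffel_mul_conformalDiff_left (g := g) (w := w) (W := W) (G := G) i j
  have A4 := sum_christoffel_mul_conformalDiff_right (g := g) (w := w) (W := W) (G := G) i j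
  have A5 := sum_conformalDiff_mul_christoffel (g := g) (w := w) (W := W) (G := G) i j
  have A6 := sum_conformalDiff_mul_conformalDiff hW gs i j
  have A7 : ∑ k, ∑ l, conformalDiff g w W k k l * conformalDiff g w W l i j
      = n * (2 * w i * w j - g i j * ∑ l, w l * W l) := by
    rw [Finset.sum_comm, ← sum_mul_conformalDiff, Finset.mul_sum]
    refine Finset.sum_congr rfl fun l _ => ?_
    rw [← Finset.sum_mul, conformalDiff_trace hW gs]; ring
  have A8 : ∑ k, ∑ l, conformalDiff g w W k k l * G l i j = n * ∑ l, G l i j * w l := by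
    rw [Finset.sum_comm, Finset.mul_sum]
    refine Finset.sum_congr rfl fun l _ => ?_
    rw [← Finset.sum_mul, conformalDiff_trace hW gs]; ring
  -- Expanding W^k ∂_k g_{ij} by ∇g = 0 produces exactly the two double sums left over in `A4` and
  -- `A5`, which then cancel.
  have A9 : ∑ k, dg k i j * W k
      = ∑ k, ∑ l, G k j l * g i k * W l + ∑ k, ∑ l, g j l * W k * G l i k := by
    have : ∑ k, ∑ l, G k j l * g i k * W l = ∑ k, ∑ l, G l j k * g i l * W k :=
      Finset.sum_comm
    rw [this, ← Finset.sum_add_distrib]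
    refine Finset.sum_congr rfl fun k _ => ?_
    rw [hdg, Finset.sum_mul, ← Finset.sum_add_distrib]
    refine Finset.sum_congr rfl fun l _ => ?_
    rw [gs l j, Gs l k i, Gs l k j]; ring
  have A10 : ∑ k, G k j i * w k = ∑ l, G l i j * w l :=
    Finset.sum_congr rfl fun k _ => by rw [Gs]
  have A11 : ∑ k, G k j k = ∑ k, G k k j := Finset.sum_congr rfl fun k _ => by rw [Gs]
  have A12 : ∑ k, G k i k = ∑ k, G k k i := Finset.sum_congr rfl fun k _ => by rw [Gs]
  have e1 : ∑ k, ((dG k k i j + conformalDiffDeriv g W H dg dW k k i j)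
        - (dG j k i k + conformalDiffDeriv g W H dg dW j k i k))
      = ∑ k, (dG k k i j - dG j k i k) + ∑ k, conformalDiffDeriv g W H dg dW k k i j
        - ∑ k, conformalDiffDeriv g W H dg dW j k i k := by
    rw [← Finset.sum_add_distrib, ← Finset.sum_sub_distrib]
    exact Finset.sum_congr rfl fun k _ => by ring
  have e2 : ∑ k, ∑ l, ((G k k l + conformalDiff g w W k k l) *
        (G l i j + conformalDiff g w W l i j)
        - (G k j l + conformalDiff g w W k j l) * (G l i k + conformalDiff g w W l i k))
      = ∑ k, ∑ l, (G k k l * G l i j - G k j l * G l i k)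
        + ∑ k, ∑ l, G k k l * conformalDiff g w W l i j
        + ∑ k, ∑ l, conformalDiff g w W k k l * G l i j
        + ∑ k, ∑ l, conformalDiff g w W k k l * conformalDiff g w W l i j
        - ∑ k, ∑ l, G k j l * conformalDiff g w W l i k
        - ∑ k, ∑ l, conformalDiff g w W k j l * G l i k
        - ∑ k, ∑ l, conformalDiff g w W k j l * conformalDiff g w W l i k := by
    simp only [← Finset.sum_add_distrib, ← Finset.sum_sub_distrib]
    exact Finset.sum_congr rfl fun k _ => Finset.sum_congr rfl fun l _ => by ring
  rw [e1, e2, A1, A2, A3, A4, A5, A6, A7, A8, A9, A10, A11, A12, Hs j i]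
  ring

/-- The `g`-trace of the covariant Hessian is the divergence of the gradient. -/
theorem trace_hessian_eq_div {ginv : Fin n → Fin n → ℝ} (hW : ∀ i, ∑ l, g i l * W l = w i)
    (hinv : ∀ i j, ∑ k, ginv i k * g k j = if i = j then 1 else 0)
    (hdg : ∀ a i j, dg a i j = ∑ l, (G l a i * g l j + G l a j * g i l))
    (hdW : ∀ j i, ∑ k, (dg j i k * W k + g i k * dW j k) = H j i) :
    ∑ i, ∑ j, ginv i j * (H i j - ∑ l, G l i j * w l)
      = ∑ k, dW k k + ∑ k, ∑ l, G k k l * W l := by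
  have key : ∀ i j, H i j - ∑ l, G l i j * w l
      = ∑ k, g j k * dW i k + ∑ k, ∑ l, G l i k * g j l * W k := by
    intro i j
    have h1 : ∑ l, G l i j * w l = ∑ k, ∑ l, G l i j * g l k * W k := by
      rw [Finset.sum_comm]
      refine Finset.sum_congr rfl fun l _ => ?_
      rw [← hW l, Finset.mul_sum]
      exact Finset.sum_congr rfl fun k _ => by ring
    rw [h1, ← hdW i j, Finset.sum_add_distrib]
    have h2 : ∑ k, dg i j k * W k
        = ∑ k, ∑ l, G l i j * g l k * W k + ∑ k, ∑ l, G l i k * g j l * W k := by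
      rw [← Finset.sum_add_distrib]
      refine Finset.sum_congr rfl fun k _ => ?_
      rw [hdg, Finset.sum_mul, ← Finset.sum_add_distrib]
      exact Finset.sum_congr rfl fun l _ => by ring
    rw [h2]; ring
  have contr : ∀ (i : Fin n) (F : Fin n → ℝ), ∑ j, ginv i j * ∑ k, g j k * F k = F i := by
    intro i F
    simp_rw [Finset.mul_sum]
    rw [Finset.sum_comm]
    simp_rw [← mul_assoc, ← Finset.sum_mul, hinv]
    simp
  rw [← Finset.sum_add_distrib]
  refine Finset.sum_congr rfl fun i _ => ?_
  simp_rw [key, mul_add, Finset.sum_add_distrib]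
  rw [contr]
  congr 1
  have : ∀ j, ∑ k, ∑ l, G l i k * g j l * W k = ∑ l, g j l * ∑ k, G l i k * W k := by
    intro j
    rw [Finset.sum_comm]
    refine Finset.sum_congr rfl fun l _ => ?_
    rw [Finset.mul_sum]
    exact Finset.sum_congr rfl fun k _ => by ring
  simp_rw [this]
  rw [contr i (fun l => ∑ k, G l i k * W k)]

end ConformalAlgebra

/-! ### Partial derivatives -/

section PartialDeriv

variable {n : ℕ} {F G : (Fin n → ℝ) → ℝ} {x : Fin n → ℝ} {V : Set (Fin n → ℝ)}

theorem partialDeriv_add (hF : DifferentiableAt ℝ F x) (hG : DifferentiableAt ℝ G x) (i : Fin n) :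
    partialDeriv i (fun y => F y + G y) x = partialDeriv i F x + partialDeriv i G x := by
  simp [partialDeriv, fderiv_fun_add hF hG]

theorem partialDeriv_sub (hF : DifferentiableAt ℝ F x) (hG : DifferentiableAt ℝ G x) (i : Fin n) :
    partialDeriv i (fun y => F y - G y) x = partialDeriv i F x - partialDeriv i G x := by
  simp [partialDeriv, fderiv_fun_sub hF hG]

theorem partialDeriv_mul (hF : DifferentiableAt ℝ F x) (hG : DifferentiableAt ℝ G x) (i : Fin n) :
    partialDeriv i (fun y => F y * G y) x = partialDeriv i F x * G x + F x * partialDeriv i G x := by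
  simp [partialDeriv, fderiv_fun_mul hF hG]; ring

theorem partialDeriv_sum {ι : Type*} {s : Finset ι} {F : ι → (Fin n → ℝ) → ℝ}
    (hF : ∀ k ∈ s, DifferentiableAt ℝ (F k) x) (i : Fin n) :
    partialDeriv i (fun y => ∑ k ∈ s, F k y) x = ∑ k ∈ s, partialDeriv i (F k) x := by
  simp [partialDeriv, fderiv_fun_sum hF]

theorem partialDeriv_congr (h : F =ᶠ[𝓝 x] G) (i : Fin n) :
    partialDeriv i F x = partialDeriv i G x := by
  simp [partialDeriv, h.fderiv_eq]

theorem partialDeriv_ite (p : Prop) [Decidable p] (i : Fin n) :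
    partialDeriv i (fun y => if p then F y else 0) x = if p then partialDeriv i F x else 0 := by
  split_ifs <;> simp [partialDeriv]

theorem partialDeriv_comp {ψ : ℝ → ℝ} {ψ' : ℝ} (hψ : HasDerivAt ψ ψ' (F x))
    (hF : DifferentiableAt ℝ F x) (i : Fin n) :
    partialDeriv i (fun y => ψ (F y)) x = ψ' * partialDeriv i F x := by
  have := (hψ.comp_hasFDerivAt x hF.hasFDerivAt).fderiv
  unfold partialDeriv
  change fderiv ℝ (ψ ∘ F) x _ = _
  rw [this]; simp

theorem ContDiffOn.partialDeriv {m k : WithTop ℕ∞} (hV : IsOpen V) (hF : ContDiffOn ℝ m F V)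
    (hk : k + 1 ≤ m) (i : Fin n) : ContDiffOn ℝ k (partialDeriv i F) V :=
  (hF.fderiv_of_isOpen hV hk).clm_apply contDiffOn_const

theorem partialDeriv_comm (hF : ContDiffAt ℝ 2 F x) (i j : Fin n) :
    partialDeriv i (partialDeriv j F) x = partialDeriv j (partialDeriv i F) x := by
  have hs : IsSymmSndFDerivAt ℝ F x := hF.isSymmSndFDerivAt (by simp)
  have hd : DifferentiableAt ℝ (fderiv ℝ F) x :=
    (hF.fderiv_right (m := 1) (by norm_num)).differentiableAt (by norm_num)
  have e : ∀ a b : Fin n, partialDeriv a (partialDeriv b F) x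
      = fderiv ℝ (fderiv ℝ F) x (Pi.single a 1) (Pi.single b 1) := by
    intro a b
    unfold partialDeriv
    rw [fderiv_clm_apply hd (differentiableAt_const _)]
    simp
  rw [e, e, hs.eq]

theorem fderiv_apply_eq_sum_partialDeriv (v : Fin n → ℝ) :
    fderiv ℝ F x v = ∑ i, v i * partialDeriv i F x := by
  conv_lhs => rw [← Finset.univ_sum_single v]
  rw [map_sum]
  refine Finset.sum_congr rfl fun i _ => ?_
  have : Pi.single i (v i) = v i • (Pi.single i 1 : Fin n → ℝ) := by
    rw [← Pi.single_smul, smul_eq_mul, mul_one]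
  rw [this, map_smul, smul_eq_mul, partialDeriv]

end PartialDeriv

/-! ### Smoothness of the geometric quantities -/

section Smooth

variable {n : ℕ} {V : Set (Fin n → ℝ)} {g : (Fin n → ℝ) → Matrix (Fin n) (Fin n) ℝ}

theorem contDiffOn_matrix_det {m : WithTop ℕ∞} (hg : ∀ i j, ContDiffOn ℝ m (fun x => g x i j) V) :
    ContDiffOn ℝ m (fun x => (g x).det) V := by
  simp only [Matrix.det_apply']
  exact ContDiffOn.sum fun σ _ => contDiffOn_const.mul (contDiffOn_prod fun i _ => hg _ _)

theorem contDiffOn_matrix_inv {m : WithTop ℕ∞} (hg : ∀ i j, ContDiffOn ℝ m (fun x => g x i j) V)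
    (hd : ∀ x ∈ V, (g x).det ≠ 0) (i j : Fin n) : ContDiffOn ℝ m (fun x => (g x)⁻¹ i j) V := by
  have h1 : ContDiffOn ℝ m (fun x => (g x).adjugate i j) V := by
    simp only [Matrix.adjugate_apply]
    apply contDiffOn_matrix_det
    intro a b
    by_cases hab : a = j
    · subst hab; simp only [Matrix.updateRow_self]; exact contDiffOn_const
    · simp only [Matrix.updateRow_ne hab]; exact hg a b
  have h2 := ((contDiffOn_matrix_det hg).inv hd).mul h1
  refine h2.congr fun x hx => ?_
  simp [Matrix.inv_def]

theorem IsRiemannianMetricOn.det_ne_zero (hg : IsRiemannianMetricOn V g) {x : Fin n → ℝ}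
    (hx : x ∈ V) : (g x).det ≠ 0 := (hg.posDef x hx).det_pos.ne'

theorem IsRiemannianMetricOn.symm (hg : IsRiemannianMetricOn V g) {x : Fin n → ℝ}
    (hx : x ∈ V) (i j : Fin n) : g x i j = g x j i := by
  simpa using ((hg.posDef x hx).isHermitian.apply j i)

theorem IsRiemannianMetricOn.contDiffOn_inv (hg : IsRiemannianMetricOn V g) (i j : Fin n) :
    ContDiffOn ℝ ∞ (fun x => (g x)⁻¹ i j) V :=
  contDiffOn_matrix_inv hg.smooth (fun _ hx => hg.det_ne_zero hx) i j

theorem IsRiemannianMetricOn.contDiffOn_christoffel (hV : IsOpen V)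
    (hg : IsRiemannianMetricOn V g) (k i j : Fin n) : ContDiffOn ℝ ∞ (christoffel g k i j) V := by
  unfold christoffel
  refine contDiffOn_const.mul (ContDiffOn.sum fun l _ => (hg.contDiffOn_inv k l).mul ?_)
  exact (((hg.smooth j l).partialDeriv hV (by simp) i).add
    ((hg.smooth i l).partialDeriv hV (by simp) j)).sub ((hg.smooth i j).partialDeriv hV (by simp) l)

theorem IsRiemannianMetricOn.continuousOn_schouten (hV : IsOpen V)
    (hg : IsRiemannianMetricOn V g) (i j : Fin n) : ContinuousOn (fun x => schouten g x i j) V := by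
  have hc : ∀ k i j, ContinuousOn (christoffel g k i j) V :=
    fun k i j => (hg.contDiffOn_christoffel hV k i j).continuousOn
  have hdc : ∀ a k i j, ContinuousOn (partialDeriv a (christoffel g k i j)) V := fun a k i j =>
    ((hg.contDiffOn_christoffel hV k i j).partialDeriv (k := 0) hV (by simp) a).continuousOn
  have hR : ∀ i j, ContinuousOn (fun x => ricci g x i j) V := by
    intro i j
    simp only [ricci, Matrix.of_apply]
    refine (continuousOn_finsetSum _ fun k _ => (hdc _ _ _ _).sub (hdc _ _ _ _)).add
      (continuousOn_finsetSum _ fun k _ => continuousOn_finsetSum _ fun l _ =>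
        ((hc _ _ _).mul (hc _ _ _)).sub ((hc _ _ _).mul (hc _ _ _)))
  have hS : ContinuousOn (scalarCurvature g) V := by
    unfold scalarCurvature
    exact continuousOn_finsetSum _ fun k _ => continuousOn_finsetSum _ fun l _ =>
      (hg.contDiffOn_inv k l).continuousOn.mul (hR k l)
  simp only [schouten, Matrix.smul_apply, Matrix.sub_apply, smul_eq_mul]
  exact continuousOn_const.mul ((hR i j).sub ((hS.div_const _).mul (hg.smooth i j).continuousOn))

theorem IsRiemannianMetricOn.christoffel_symm (hV : IsOpen V) (hg : IsRiemannianMetricOn V g)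
    {x : Fin n → ℝ} (hx : x ∈ V) (k i j : Fin n) : christoffel g k i j x = christoffel g k j i x := by
  unfold christoffel
  congr 1
  refine Finset.sum_congr rfl fun l _ => ?_
  rw [partialDeriv_congr (F := fun y => g y i j) (G := fun y => g y j i)]
  · ring
  · filter_upwards [hV.mem_nhds hx] with y hy using hg.symm hy i j

theorem IsRiemannianMetricOn.inv_symm (hg : IsRiemannianMetricOn V g) {x : Fin n → ℝ}
    (hx : x ∈ V) (i j : Fin n) : (g x)⁻¹ i j = (g x)⁻¹ j i := by
  simpa using ((hg.posDef x hx).inv.isHermitian.apply j i)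

theorem IsRiemannianMetricOn.sum_mul_inv (hg : IsRiemannianMetricOn V g) {x : Fin n → ℝ}
    (hx : x ∈ V) (i j : Fin n) : ∑ k, g x i k * (g x)⁻¹ k j = if i = j then 1 else 0 := by
  rw [← Matrix.mul_apply, Matrix.mul_nonsing_inv _ (isUnit_iff_ne_zero.2 (hg.det_ne_zero hx)),
    Matrix.one_apply]

theorem IsRiemannianMetricOn.sum_inv_mul (hg : IsRiemannianMetricOn V g) {x : Fin n → ℝ}
    (hx : x ∈ V) (i j : Fin n) : ∑ k, (g x)⁻¹ i k * g x k j = if i = j then 1 else 0 := by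
  rw [← Matrix.mul_apply, Matrix.nonsing_inv_mul _ (isUnit_iff_ne_zero.2 (hg.det_ne_zero hx)),
    Matrix.one_apply]

theorem IsRiemannianMetricOn.sum_mul_sum_inv (hg : IsRiemannianMetricOn V g) {x : Fin n → ℝ}
    (hx : x ∈ V) (w : Fin n → ℝ) (i : Fin n) :
    ∑ k, g x i k * ∑ l, (g x)⁻¹ k l * w l = w i := by
  simp_rw [Finset.mul_sum]
  rw [Finset.sum_comm]
  simp_rw [← mul_assoc, ← Finset.sum_mul, hg.sum_mul_inv hx]
  simp

theorem IsRiemannianMetricOn.sum_mul_christoffel (hg : IsRiemannianMetricOn V g)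
    {x : Fin n → ℝ} (hx : x ∈ V) (a i j : Fin n) :
    ∑ l, g x j l * christoffel g l a i x
      = (1 / 2) * (partialDeriv a (fun y => g y i j) x + partialDeriv i (fun y => g y a j) x
        - partialDeriv j (fun y => g y a i) x) := by
  rw [← hg.sum_mul_sum_inv hx (fun j => (1 / 2) * (partialDeriv a (fun y => g y i j) x
    + partialDeriv i (fun y => g y a j) x - partialDeriv j (fun y => g y a i) x)) j]
  refine Finset.sum_congr rfl fun l _ => ?_
  unfold christoffel
  rw [Finset.mul_sum]
  congr 1
  exact Finset.sum_congr rfl fun k _ => by ring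

/-- This is ∇g = 0: in the sum of the two lowered Christoffel symbols every derivative except ∂_a
g_{ij} cancels. -/
theorem IsRiemannianMetricOn.partialDeriv_metric (hV : IsOpen V) (hg : IsRiemannianMetricOn V g)
    {x : Fin n → ℝ} (hx : x ∈ V) (a i j : Fin n) :
    partialDeriv a (fun y => g y i j) x
      = ∑ l, (christoffel g l a i x * g x l j + christoffel g l a j x * g x i l) := by
  have hs : ∀ a i j, partialDeriv a (fun y => g y i j) x = partialDeriv a (fun y => g y j i) x :=
    fun a i j => partialDeriv_congr (by
      filter_upwards [hV.mem_nhds hx] with y hy using hg.symm hy i j) a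
  have h1 := hg.sum_mul_christoffel hx a i j
  have h2 := hg.sum_mul_christoffel hx a j i
  rw [Finset.sum_add_distrib]
  have e1 : ∑ l, christoffel g l a i x * g x l j = ∑ l, g x j l * christoffel g l a i x :=
    Finset.sum_congr rfl fun l _ => by rw [hg.symm hx l j]; ring
  have e2 : ∑ l, christoffel g l a j x * g x i l = ∑ l, g x i l * christoffel g l a j x :=
    Finset.sum_congr rfl fun l _ => by ring
  rw [e1, e2, h1, h2, hs a j i]
  ring

end Smooth

/-! ### Conformal change of the Schouten tensor -/

/-- The components `w^k = g^{kl} ∂_l w` of the gradient. -/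
noncomputable def gradComp {n : ℕ} (g : (Fin n → ℝ) → Matrix (Fin n) (Fin n) ℝ)
    (w : (Fin n → ℝ) → ℝ) (k : Fin n) (x : Fin n → ℝ) : ℝ :=
  ∑ l, (g x)⁻¹ k l * partialDeriv l w x

/-- The covariant Hessian `∇_i ∇_j w`. -/
noncomputable def covHessian {n : ℕ} (g : (Fin n → ℝ) → Matrix (Fin n) (Fin n) ℝ)
    (w : (Fin n → ℝ) → ℝ) (x : Fin n → ℝ) : Matrix (Fin n) (Fin n) ℝ :=
  Matrix.of fun i j => partialDeriv i (partialDeriv j w) x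
    - ∑ l, christoffel g l i j x * partialDeriv l w x

section Conformal

variable {n : ℕ} {V : Set (Fin n → ℝ)} {g : (Fin n → ℝ) → Matrix (Fin n) (Fin n) ℝ}
  {w : (Fin n → ℝ) → ℝ} {x : Fin n → ℝ}

theorem conformalMetric_inv (w : (Fin n → ℝ) → ℝ) (x : Fin n → ℝ) :
    (conformalMetric w g x)⁻¹ = Real.exp (-(2 * w x)) • (g x)⁻¹ := by
  unfold conformalMetric
  have h : IsUnit (Real.exp (2 * w x)) := isUnit_iff_ne_zero.2 (Real.exp_pos _).ne'
  by_cases hd : IsUnit (g x).det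
  · have := Matrix.inv_smul' (g x) h.unit hd
    rw [Real.exp_neg]
    simpa [Units.smul_def] using this
  · rw [Matrix.nonsing_inv_apply_not_isUnit _ hd, Matrix.nonsing_inv_apply_not_isUnit, smul_zero]
    rw [Matrix.det_smul]
    intro hh
    exact hd (isUnit_of_mul_isUnit_right hh)

theorem partialDeriv_conformalMetric (hw : DifferentiableAt ℝ w x) {i j : Fin n}
    (hg : DifferentiableAt ℝ (fun y => g y i j) x) (a : Fin n) :
    partialDeriv a (fun y => conformalMetric w g y i j) x
      = Real.exp (2 * w x) * (2 * partialDeriv a w x * g x i j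
        + partialDeriv a (fun y => g y i j) x) := by
  have h1 : HasDerivAt (fun t : ℝ => Real.exp (2 * t)) (Real.exp (2 * w x) * (2 * 1)) (w x) :=
    ((hasDerivAt_id (w x)).const_mul 2).exp
  have h2 := partialDeriv_comp h1 hw a
  have h3 : DifferentiableAt ℝ (fun y => Real.exp (2 * w y)) x :=
    (hw.const_mul 2).exp
  have := partialDeriv_mul h3 hg a
  simp only [conformalMetric, Matrix.smul_apply, smul_eq_mul]
  rw [this, h2]; ring

theorem IsRiemannianMetricOn.differentiableAt (hV : IsOpen V) (hg : IsRiemannianMetricOn V g)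
    (hx : x ∈ V) (i j : Fin n) : DifferentiableAt ℝ (fun y => g y i j) x :=
  ((hg.smooth i j).contDiffAt (hV.mem_nhds hx)).differentiableAt (by simp)

/-- Each derivative of e^{2w}g gains a term 2 ∂w · g, while e^{-2w} from the inverse cancels e^{2w};
contracting g⁻¹ with g leaves the two Kronecker deltas and the gradient term. -/
theorem christoffel_conformal (hV : IsOpen V) (hg : IsRiemannianMetricOn V g)
    (hw : DifferentiableAt ℝ w x) (hx : x ∈ V) (k i j : Fin n) :
    christoffel (conformalMetric w g) k i j x = christoffel g k i j x
      + conformalDiff (fun i j => g x i j) (fun l => partialDeriv l w x) (fun l => gradComp g w l x) k i j := by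
  have hgd := hg.differentiableAt hV hx
  unfold christoffel
  rw [conformalMetric_inv]
  simp only [partialDeriv_conformalMetric hw (hgd _ _), Matrix.smul_apply, smul_eq_mul]
  have hexp : Real.exp (-(2 * w x)) * Real.exp (2 * w x) = 1 := by
    rw [← Real.exp_add]; simp
  have e1 : ∀ l, Real.exp (-(2 * w x)) * (g x)⁻¹ k l *
      (Real.exp (2 * w x) * (2 * partialDeriv i w x * g x j l + partialDeriv i (fun y => g y j l) x)
        + Real.exp (2 * w x) * (2 * partialDeriv j w x * g x i l
          + partialDeriv j (fun y => g y i l) x)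
        - Real.exp (2 * w x) * (2 * partialDeriv l w x * g x i j
          + partialDeriv l (fun y => g y i j) x))
      = (g x)⁻¹ k l * (partialDeriv i (fun y => g y j l) x + partialDeriv j (fun y => g y i l) x
      - partialDeriv l (fun y => g y i j) x) +
        2 * (partialDeriv i w x * ((g x)⁻¹ k l * g x l j) +
          partialDeriv j w x * ((g x)⁻¹ k l * g x l i) - g x i j * ((g x)⁻¹ k l *
          partialDeriv l w x)) := by
    intro l
    rw [hg.symm hx j l, hg.symm hx i l]
    linear_combination ((g x)⁻¹ k l * (2 * partialDeriv i w x * g x l j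
      + partialDeriv i (fun y => g y j l) x + 2 * partialDeriv j w x * g x l i
      + partialDeriv j (fun y => g y i l) x - 2 * partialDeriv l w x * g x i j
      - partialDeriv l (fun y => g y i j) x)) * hexp
  simp_rw [e1]
  rw [Finset.sum_add_distrib, ← Finset.mul_sum, Finset.sum_sub_distrib, Finset.sum_add_distrib,
    ← Finset.mul_sum, ← Finset.mul_sum, ← Finset.mul_sum, hg.sum_inv_mul hx, hg.sum_inv_mul hx]
  simp only [conformalDiff, gradComp]
  split_ifs <;> ring

theorem differentiableAt_partialDeriv (hw : ContDiffAt ℝ 2 w x) (i : Fin n) :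
    DifferentiableAt ℝ (partialDeriv i w) x :=
  ((hw.fderiv_right (m := 1) (by norm_num)).differentiableAt (by norm_num)).clm_apply
    (differentiableAt_const _)

theorem differentiableAt_gradComp (hV : IsOpen V) (hg : IsRiemannianMetricOn V g)
    (hw : ContDiffAt ℝ 2 w x) (hx : x ∈ V) (k : Fin n) :
    DifferentiableAt ℝ (gradComp g w k) x := by
  unfold gradComp
  refine DifferentiableAt.fun_sum fun l _ => ?_
  exact (((hg.contDiffOn_inv k l).contDiffAt (hV.mem_nhds hx)).differentiableAt (by simp)).mul
    (differentiableAt_partialDeriv hw l)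

theorem partialDeriv_conformalDiff (hV : IsOpen V) (hg : IsRiemannianMetricOn V g)
    (hw : ContDiffAt ℝ 2 w x) (hx : x ∈ V) (a k i j : Fin n) :
    partialDeriv a (fun y => conformalDiff (fun i j => g y i j) (fun l => partialDeriv l w y)
        (fun l => gradComp g w l y) k i j) x
      = conformalDiffDeriv (fun i j => g x i j) (fun l => gradComp g w l x)
        (fun i j => partialDeriv i (partialDeriv j w) x)
        (fun a i j => partialDeriv a (fun y => g y i j) x)
        (fun a k => partialDeriv a (gradComp g w k) x) a k i j := by
  have hp := differentiableAt_partialDeriv hw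
  have hgr := differentiableAt_gradComp hV hg hw hx
  have hgd := hg.differentiableAt hV hx
  have hite : ∀ (p : Prop) [Decidable p] (i : Fin n),
      DifferentiableAt ℝ (fun y => if p then partialDeriv i w y else 0) x := by
    intro p _ i
    by_cases h : p
    · simp only [h, if_true]; exact hp i
    · simp only [h, if_false]; exact differentiableAt_const _
  simp only [conformalDiff, conformalDiffDeriv]
  rw [partialDeriv_sub ((hite _ _).fun_add (hite _ _)) ((hgd _ _).fun_mul (hgr _)),
    partialDeriv_add (hite _ _) (hite _ _), partialDeriv_mul (hgd _ _) (hgr _),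
    partialDeriv_ite, partialDeriv_ite]

theorem partialDeriv_christoffel_conformal (hV : IsOpen V) (hg : IsRiemannianMetricOn V g)
    (hw : ContDiffAt ℝ 2 w x) (hx : x ∈ V) (a k i j : Fin n) :
    partialDeriv a (christoffel (conformalMetric w g) k i j) x
      = partialDeriv a (christoffel g k i j) x
        + conformalDiffDeriv (fun i j => g x i j) (fun l => gradComp g w l x)
        (fun i j => partialDeriv i (partialDeriv j w) x)
        (fun a i j => partialDeriv a (fun y => g y i j) x)
        (fun a k => partialDeriv a (gradComp g w k) x) a k i j := by
  rw [← partialDeriv_conformalDiff hV hg hw hx, ← partialDeriv_add]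
  · refine partialDeriv_congr ?_ a
    filter_upwards [hV.mem_nhds hx, hw.eventually (by simp)] with y hy hwy
    exact christoffel_conformal hV hg (hwy.differentiableAt (by norm_num)) hy k i j
  · exact ((hg.contDiffOn_christoffel hV k i j).contDiffAt (hV.mem_nhds hx)).differentiableAt
      (by simp)
  · have hp := differentiableAt_partialDeriv hw
    have hite : ∀ (p : Prop) [Decidable p] (i : Fin n),
        DifferentiableAt ℝ (fun y => if p then partialDeriv i w y else 0) x := by
      intro p _ i
      by_cases h : p
      · simp only [h, if_true]; exact hp i
      · simp only [h, if_false]; exact differentiableAt_const _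
    exact ((hite _ _).add (hite _ _)).sub
      ((hg.differentiableAt hV hx _ _).mul (differentiableAt_gradComp hV hg hw hx _))

/-- The squared length of the gradient. -/
noncomputable def gradSq (g : (Fin n → ℝ) → Matrix (Fin n) (Fin n) ℝ)
    (w : (Fin n → ℝ) → ℝ) (x : Fin n → ℝ) : ℝ :=
  ∑ l, partialDeriv l w x * gradComp g w l x

/-- The Laplacian, as the trace of the covariant Hessian. -/
noncomputable def covLaplacian (g : (Fin n → ℝ) → Matrix (Fin n) (Fin n) ℝ)
    (w : (Fin n → ℝ) → ℝ) (x : Fin n → ℝ) : ℝ :=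
  ∑ i, ∑ j, (g x)⁻¹ i j * covHessian g w x i j

/-- Obtained by differentiating g_{ik}w^k = ∂_i w; it is the hypothesis `hdW` of the algebraic
identity. -/
theorem sum_partialDeriv_mul_gradComp (hV : IsOpen V) (hg : IsRiemannianMetricOn V g)
    (hw : ContDiffAt ℝ 2 w x) (hx : x ∈ V) (j i : Fin n) :
    ∑ k, (partialDeriv j (fun y => g y i k) x * gradComp g w k x
      + g x i k * partialDeriv j (gradComp g w k) x) = partialDeriv j (partialDeriv i w) x := by
  have hgr := differentiableAt_gradComp hV hg hw hx
  have hgd := hg.differentiableAt hV hx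
  have h : partialDeriv j (fun y => ∑ k, g y i k * gradComp g w k y) x
      = partialDeriv j (partialDeriv i w) x := by
    refine partialDeriv_congr ?_ j
    filter_upwards [hV.mem_nhds hx] with y hy
    exact hg.sum_mul_sum_inv hy (fun l => partialDeriv l w y) i
  rw [← h, partialDeriv_sum (fun k _ => (hgd i k).fun_mul (hgr k))]
  exact Finset.sum_congr rfl fun k _ => (partialDeriv_mul (hgd i k) (hgr k) j).symm

theorem ricci_conformal (hV : IsOpen V) (hg : IsRiemannianMetricOn V g)
    (hw : ContDiffAt ℝ 2 w x) (hx : x ∈ V) (i j : Fin n) :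
    ricci (conformalMetric w g) x i j = ricci g x i j
      - ((n : ℝ) - 2) * (covHessian g w x i j - partialDeriv i w x * partialDeriv j w x)
      - (covLaplacian g w x + ((n : ℝ) - 2) * gradSq g w x) * g x i j := by
  have hd : DifferentiableAt ℝ w x := hw.differentiableAt (by norm_num)
  have hW : ∀ i, ∑ l, g x i l * gradComp g w l x = partialDeriv i w x := fun i =>
    hg.sum_mul_sum_inv hx (fun l => partialDeriv l w x) i
  have hdg := hg.partialDeriv_metric hV hx
  have hdW := sum_partialDeriv_mul_gradComp hV hg hw hx
  have Gs := hg.christoffel_symm hV hx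
  have key := ricci_conformal_algebra (g := fun i j => g x i j) (w := fun l => partialDeriv l w x)
    (W := fun l => gradComp g w l x) (H := fun i j => partialDeriv i (partialDeriv j w) x)
    (dg := fun a i j => partialDeriv a (fun y => g y i j) x)
    (dW := fun a k => partialDeriv a (gradComp g w k) x)
    (G := fun k i j => christoffel g k i j x) hW (fun i j => hg.symm hx i j)
    (fun i j => partialDeriv_comm hw i j) Gs hdg hdW
    (fun a k i j => partialDeriv a (christoffel g k i j) x) i j
  have htr := trace_hessian_eq_div (g := fun i j => g x i j) (w := fun l => partialDeriv l w x)
    (W := fun l => gradComp g w l x) (H := fun i j => partialDeriv i (partialDeriv j w) x)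
    (dg := fun a i j => partialDeriv a (fun y => g y i j) x)
    (dW := fun a k => partialDeriv a (gradComp g w k) x)
    (G := fun k i j => christoffel g k i j x) (ginv := fun i j => (g x)⁻¹ i j) hW
    (fun i j => hg.sum_inv_mul hx i j) hdg hdW
  simp only [ricci, Matrix.of_apply, partialDeriv_christoffel_conformal hV hg hw hx,
    christoffel_conformal hV hg hd hx]
  rw [key]
  simp only [covLaplacian, covHessian, Matrix.of_apply, gradSq]
  rw [htr]

/-- `A_{g_w} = A_g - ∇²w + dw ⊗ dw - ½ |dw|² g`. -/
theorem schouten_conformal (hn : 3 ≤ n) (hV : IsOpen V) (hg : IsRiemannianMetricOn V g)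
    (hw : ContDiffAt ℝ 2 w x) (hx : x ∈ V) (i j : Fin n) :
    schouten (conformalMetric w g) x i j = schouten g x i j - covHessian g w x i j
      + partialDeriv i w x * partialDeriv j w x - 1 / 2 * gradSq g w x * g x i j := by
  -- Tracing the Ricci law with g^{ij}g_{ij} = n: the Laplacian gets -(n-2) - n = -2(n-1), and |dw|²
  -- gets (n-2) - n(n-2) = -(n-1)(n-2).
  have hsc : Real.exp (2 * w x) * scalarCurvature (conformalMetric w g) x = scalarCurvature g x
      - 2 * ((n : ℝ) - 1) * covLaplacian g w x
      - ((n : ℝ) - 1) * ((n : ℝ) - 2) * gradSq g w x := by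
    unfold scalarCurvature
    rw [conformalMetric_inv, Finset.mul_sum]
    simp_rw [Finset.mul_sum]
    have hexp : Real.exp (2 * w x) * Real.exp (-(2 * w x)) = 1 := by
      rw [← Real.exp_add]; simp
    have e1 : ∀ i j, Real.exp (2 * w x) * ((Real.exp (-(2 * w x)) • (g x)⁻¹) i j *
        ricci (conformalMetric w g) x i j) = (g x)⁻¹ i j * ricci g x i j
        - ((n : ℝ) - 2) * ((g x)⁻¹ i j * covHessian g w x i j)
        + ((n : ℝ) - 2) * (partialDeriv i w x * ((g x)⁻¹ i j * partialDeriv j w x))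
        - (covLaplacian g w x + ((n : ℝ) - 2) * gradSq g w x) * ((g x)⁻¹ i j * g x j i) := by
      intro i j
      rw [ricci_conformal hV hg hw hx, Matrix.smul_apply, smul_eq_mul, hg.symm hx j i]
      linear_combination ((g x)⁻¹ i j * (ricci g x i j
        - ((n : ℝ) - 2) * (covHessian g w x i j - partialDeriv i w x * partialDeriv j w x)
        - (covLaplacian g w x + ((n : ℝ) - 2) * gradSq g w x) * g x i j)) * hexp
    simp_rw [e1, Finset.sum_sub_distrib, Finset.sum_add_distrib, Finset.sum_sub_distrib,
      ← Finset.mul_sum, hg.sum_inv_mul hx]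
    have e2 : ∑ i, partialDeriv i w x * ∑ j, (g x)⁻¹ i j * partialDeriv j w x = gradSq g w x := rfl
    have e3 : ∑ i, ∑ j, (g x)⁻¹ i j * covHessian g w x i j = covLaplacian g w x := rfl
    rw [e2, e3]
    simp only [if_true, Finset.sum_const, Finset.card_univ, Fintype.card_fin, nsmul_eq_mul,
      mul_one]
    ring
  have h2 : (n : ℝ) - 2 ≠ 0 := by
    have : (3 : ℝ) ≤ n := by exact_mod_cast hn
    linarith
  have h1 : (n : ℝ) - 1 ≠ 0 := by
    have : (3 : ℝ) ≤ n := by exact_mod_cast hn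
    linarith
  simp only [schouten, Matrix.smul_apply, Matrix.sub_apply, smul_eq_mul,
    ricci_conformal hV hg hw hx]
  have e : scalarCurvature (conformalMetric w g) x / (2 * ((n : ℝ) - 1)) *
      conformalMetric w g x i j = (scalarCurvature g x
      - 2 * ((n : ℝ) - 1) * covLaplacian g w x
      - ((n : ℝ) - 1) * ((n : ℝ) - 2) * gradSq g w x) / (2 * ((n : ℝ) - 1)) * g x i j := by
    rw [← hsc]
    simp only [conformalMetric, Matrix.smul_apply, smul_eq_mul]
    ring
  rw [e]
  field_simp
  ring

/-- `-g_w⁻¹ A_{g_w}` in terms of `g`. -/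
theorem negSchoutenEndo_conformal (hn : 3 ≤ n) (hV : IsOpen V) (hg : IsRiemannianMetricOn V g)
    (hw : ContDiffAt ℝ 2 w x) (hx : x ∈ V) :
    negSchoutenEndo (conformalMetric w g) x = (g x)⁻¹ * (Real.exp (-(2 * w x)) •
      Matrix.of fun i j => covHessian g w x i j - partialDeriv i w x * partialDeriv j w x
        + 1 / 2 * gradSq g w x * g x i j - schouten g x i j) := by
  unfold negSchoutenEndo
  rw [conformalMetric_inv, Matrix.smul_mul, Matrix.mul_smul, ← smul_neg, ← Matrix.mul_neg]
  congr 2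
  ext i j
  rw [Matrix.neg_apply, schouten_conformal hn hV hg hw hx, Matrix.of_apply]
  ring

end Conformal

/-! ### Superposition operators on spaces of continuous functions -/

section Superposition

variable {K : Type*} [TopologicalSpace K] [CompactSpace K]
  {P Q : Type*} [NormedAddCommGroup P] [NormedSpace ℝ P] [NormedAddCommGroup Q] [NormedSpace ℝ Q]

/-- Pointwise application of a continuous family of continuous linear maps. -/
noncomputable def pointwiseApply : C(K, P →L[ℝ] Q) →L[ℝ] C(K, P) →L[ℝ] C(K, Q) :=
  LinearMap.mkContinuous₂
    (LinearMap.mk₂ ℝ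
      (fun (M : C(K, P →L[ℝ] Q)) (h : C(K, P)) => (⟨fun t => M t (h t), by fun_prop⟩ : C(K, Q)))
      (fun _ _ _ => by ext; simp) (fun _ _ _ => by ext; simp)
      (fun _ _ _ => by ext; simp) (fun _ _ _ => by ext; simp)) 1
    (fun M h => by
      rw [ContinuousMap.norm_le _ (by positivity)]
      intro t
      rw [one_mul]
      exact ((M t).le_opNorm _).trans
        (mul_le_mul (M.norm_coe_le_norm t) (h.norm_coe_le_norm t) (norm_nonneg _) (norm_nonneg M)))

@[simp]
theorem pointwiseApply_apply (M : C(K, P →L[ℝ] Q)) (h : C(K, P)) (t : K) :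
    pointwiseApply M h t = M t (h t) := rfl

/-- The superposition operator `u ↦ G ∘ u`. -/
def superposition (G : P → Q) (hG : Continuous G) (u : C(K, P)) : C(K, Q) :=
  (⟨G, hG⟩ : C(P, Q)).comp u

omit [CompactSpace K] [NormedSpace ℝ P] [NormedSpace ℝ Q] in
@[simp]
theorem superposition_apply (G : P → Q) (hG : Continuous G) (u : C(K, P)) (t : K) :
    superposition G hG u t = G (u t) := rfl

omit [CompactSpace K] [NormedSpace ℝ P] [NormedSpace ℝ Q] in
theorem continuous_superposition (G : P → Q) (hG : Continuous G) :
    Continuous (superposition (K := K) G hG) :=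
  ContinuousMap.continuous_postcomp _

/-- Pointwise this is the mean value inequality for G near u(t). The radius δ can be taken
independent of t because u has compact range, on which the continuity of DG is uniform. -/
theorem hasFDerivAt_superposition {G : P → Q} (hG : ContDiff ℝ 1 G) (u : C(K, P)) :
    HasFDerivAt (superposition G hG.continuous)
      (pointwiseApply (superposition (fderiv ℝ G) (hG.continuous_fderiv one_ne_zero) u)) u := by
  rw [hasFDerivAt_iff_isLittleO_nhds_zero, Asymptotics.isLittleO_iff]
  intro ε hε
  have hc : Continuous (fderiv ℝ G) := hG.continuous_fderiv one_ne_zero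
  have hK : IsCompact (range u) := isCompact_range u.continuous
  have hU := hK.uniformContinuousAt_of_continuousAt (fderiv ℝ G)
    (fun a _ => hc.continuousAt) (Metric.dist_mem_uniformity hε)
  obtain ⟨δ, hδ, hδU⟩ := Metric.mem_uniformity_dist.1 hU
  filter_upwards [Metric.ball_mem_nhds (0 : C(K, P)) hδ] with h hh
  rw [ContinuousMap.norm_le _ (by positivity)]
  intro t
  have ht : ‖h t‖ ≤ ‖h‖ := h.norm_coe_le_norm t
  have hlt : ‖h t‖ < δ := ht.trans_lt (by simpa using hh)
  have key := Convex.norm_image_sub_le_of_norm_fderiv_le' (𝕜 := ℝ) (f := G)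
    (φ := fderiv ℝ G (u t)) (C := ε) (s := Metric.ball (u t) δ) (x := u t) (y := u t + h t)
    (fun x _ => hG.differentiable one_ne_zero x) ?_ (convex_ball _ _) (Metric.mem_ball_self hδ)
    (by simpa using hlt)
  · simp only [add_sub_cancel_left] at key
    exact key.trans (mul_le_mul_of_nonneg_left ht hε.le)
  · intro x hx
    have := @hδU (u t) x (by rw [dist_comm]; exact hx) (mem_range_self t)
    rw [← dist_eq_norm, dist_comm]
    exact le_of_lt this

theorem contDiff_superposition {G : P → Q} (hG : ContDiff ℝ 1 G) :
    ContDiff ℝ 1 (superposition (K := K) G hG.continuous) := by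
  rw [contDiff_one_iff_hasFDerivAt]
  exact ⟨_, pointwiseApply.continuous.comp (continuous_superposition _ _),
    fun u => hasFDerivAt_superposition hG u⟩

end Superposition

/-! ### Integration as a bounded operator on C([0,1]). -/

section Primitive

variable {P : Type*} [NormedAddCommGroup P] [NormedSpace ℝ P] [CompleteSpace P]

/-- The primitive `t ↦ ∫₀ᵗ u`, as a function on `ℝ` (with `u` extended by constants). -/
noncomputable def primitiveFun (u : C(unitInterval, P)) (t : ℝ) : P :=
  ∫ s in (0 : ℝ)..t, u (Set.projIcc 0 1 zero_le_one s)

omit [NormedSpace ℝ P] [CompleteSpace P] in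
theorem continuous_comp_projIcc (u : C(unitInterval, P)) :
    Continuous fun s => u (Set.projIcc 0 1 zero_le_one s) :=
  u.continuous.comp continuous_projIcc

theorem hasDerivAt_primitiveFun (u : C(unitInterval, P)) (t : ℝ) :
    HasDerivAt (primitiveFun u) (u (Set.projIcc 0 1 zero_le_one t)) t :=
  (continuous_comp_projIcc u).integral_hasStrictDerivAt 0 t |>.hasDerivAt

omit [CompleteSpace P] in
@[simp]
theorem primitiveFun_zero (u : C(unitInterval, P)) : primitiveFun u 0 = 0 := by
  simp [primitiveFun]

/-- The primitive `t ↦ ∫₀ᵗ u` as an operator on `C([0,1])`. -/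
noncomputable def primitive : C(unitInterval, P) →L[ℝ] C(unitInterval, P) :=
  LinearMap.mkContinuous
    { toFun := fun u => ⟨fun t => primitiveFun u t, by
        have : Continuous (primitiveFun u) :=
          continuous_iff_continuousAt.2 fun t => (hasDerivAt_primitiveFun u t).continuousAt
        exact this.comp continuous_subtype_val⟩
      map_add' := fun u v => by
        ext t
        simp only [primitiveFun, ContinuousMap.add_apply, ContinuousMap.coe_mk]
        exact intervalIntegral.integral_add ((continuous_comp_projIcc u).intervalIntegrable _ _)
          ((continuous_comp_projIcc v).intervalIntegrable _ _)
      map_smul' := fun c u => by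
        ext t
        simp only [primitiveFun, ContinuousMap.smul_apply, ContinuousMap.coe_mk, RingHom.id_apply]
        exact intervalIntegral.integral_smul _ _ } 1
    (fun u => by
      rw [ContinuousMap.norm_le _ (by positivity)]
      intro t
      have h := intervalIntegral.norm_integral_le_of_norm_le_const (a := 0) (b := (t : ℝ))
        (f := fun s => u (Set.projIcc 0 1 zero_le_one s)) (C := ‖u‖)
        (fun s _ => u.norm_coe_le_norm _)
      refine h.trans ?_
      rw [sub_zero, abs_of_nonneg t.2.1, one_mul]
      exact mul_le_of_le_one_right (norm_nonneg _) t.2.2)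

@[simp]
theorem primitive_apply (u : C(unitInterval, P)) (t : unitInterval) :
    primitive u t = primitiveFun u t := rfl

end Primitive

/-! ### The two point boundary value problem -/

/-- Constant functions. -/
def constPath {P : Type*} [NormedAddCommGroup P] [NormedSpace ℝ P] :
    P →L[ℝ] C(unitInterval, P) where
  toFun := ContinuousMap.const _
  map_add' _ _ := rfl
  map_smul' _ _ := rfl
  cont := ContinuousMap.continuous_const'

@[simp]
theorem constPath_apply {P : Type*} [NormedAddCommGroup P] [NormedSpace ℝ P] (a : P)
    (t : unitInterval) : constPath a t = a := rfl

section Shooting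

variable {E : Type*} [NormedAddCommGroup E] [NormedSpace ℝ E]

/-- The boundary operator `(x, p) ↦ (0, x(1) - p(0))`. -/
noncomputable def boundaryOp : C(unitInterval, E × E) →L[ℝ] E × E :=
  (ContinuousLinearMap.inr ℝ E E).comp
    ((ContinuousLinearMap.fst ℝ E E).comp (ContinuousMap.evalCLM ℝ (1 : unitInterval))
      - (ContinuousLinearMap.snd ℝ E E).comp (ContinuousMap.evalCLM ℝ (0 : unitInterval)))

@[simp]
theorem boundaryOp_apply (u : C(unitInterval, E × E)) :
    boundaryOp u = (0, (u 1).1 - (u 0).2) := rfl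

variable [CompleteSpace E] {G : E × E → E × E}

/-- The map whose value is `const (0, y)` exactly if `u' = G(u)`, `x(0) = 0`, `x(1) = y`. -/
noncomputable def shootingMap (G : E × E → E × E) (hG : Continuous G)
    (u : C(unitInterval, E × E)) : C(unitInterval, E × E) :=
  u - primitive (superposition G hG u) + constPath (boundaryOp u)

/-- The primitive vanishes at t = 0, so evaluating there reads off both boundary conditions. Folding
them into a constant term turns the boundary value problem into one equation for a self-map of a
single Banach space, the setting of the inverse function theorem. -/
theorem shootingMap_eq_const_iff (hG : Continuous G) (u : C(unitInterval, E × E)) (y : E) :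
    shootingMap G hG u = constPath (0, y) ↔
      u = primitive (superposition G hG u) + constPath (0, (u 0).2) ∧ (u 1).1 = y := by
  constructor
  · intro h
    have h0 : shootingMap G hG u 0 = (0, y) := by rw [h]; rfl
    have h1 : (u 1).1 = y := by
      have := congrArg Prod.snd h0
      simpa [shootingMap] using this
    refine ⟨?_, h1⟩
    ext1 t
    have ht : shootingMap G hG u t = (0, y) := by rw [h]; rfl
    simp only [shootingMap, ContinuousMap.add_apply, ContinuousMap.sub_apply, constPath_apply,
      boundaryOp_apply, h1] at ht ⊢
    have : u t = (0, y) - (0, y - (u 0).2) + primitive (superposition G hG u) t := by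
      rw [← ht]; abel
    rw [this, add_comm]
    congr 1
    ext <;> simp
  · rintro ⟨h, h1⟩
    ext1 t
    have : u t = primitive (superposition G hG u) t + (0, (u 0).2) := by
      conv_lhs => rw [h]
      rfl
    simp only [shootingMap, ContinuousMap.add_apply, ContinuousMap.sub_apply, constPath_apply,
      boundaryOp_apply, h1]
    rw [this]
    ext <;> simp

theorem contDiff_shootingMap (hG : ContDiff ℝ 1 G) :
    ContDiff ℝ 1 (shootingMap G hG.continuous) := by
  have h1 : ContDiff ℝ 1 (fun u : C(unitInterval, E × E) =>
      primitive (superposition G hG.continuous u)) :=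
    ContDiff.comp (g := primitive) (f := superposition G hG.continuous)
      (primitive (P := E × E)).contDiff (contDiff_superposition hG)
  have h2 : ContDiff ℝ 1 (fun u : C(unitInterval, E × E) => constPath (boundaryOp u)) :=
    ContDiff.comp (g := constPath) (f := boundaryOp) (constPath (P := E × E)).contDiff (boundaryOp (E := E)).contDiff
  exact (contDiff_id.sub h1).add h2

theorem hasFDerivAt_shootingMap (hG : ContDiff ℝ 1 G) (u : C(unitInterval, E × E)) :
    HasFDerivAt (shootingMap G hG.continuous) (ContinuousLinearMap.id ℝ _ - primitive.comp
      (pointwiseApply (superposition (fderiv ℝ G) (hG.continuous_fderiv one_ne_zero) u))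
      + constPath.comp boundaryOp) u := by
  have h1 : HasFDerivAt (fun u : C(unitInterval, E × E) =>
      primitive (superposition G hG.continuous u)) (primitive.comp
      (pointwiseApply (superposition (fderiv ℝ G) (hG.continuous_fderiv one_ne_zero) u))) u :=
    HasFDerivAt.comp (g := primitive) (f := superposition G hG.continuous) u
      (primitive (P := E × E)).hasFDerivAt (hasFDerivAt_superposition hG u)
  have h2 : HasFDerivAt (fun u : C(unitInterval, E × E) => constPath (boundaryOp u))
      (constPath.comp boundaryOp) u :=
    HasFDerivAt.comp (g := constPath) (f := boundaryOp) u (constPath (P := E × E)).hasFDerivAt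
      (boundaryOp (E := E)).hasFDerivAt
  exact HasFDerivAt.fun_add (HasFDerivAt.fun_sub (hasFDerivAt_id u) h1) h2

theorem primitiveFun_const (c : E) (t : ℝ) : primitiveFun (constPath c) t = t • c := by
  simp [primitiveFun]

theorem primitiveFun_clm {F : Type*} [NormedAddCommGroup F] [NormedSpace ℝ F] [CompleteSpace F]
    (L : E →L[ℝ] F) (v : C(unitInterval, E)) (t : ℝ) :
    primitiveFun (L.compLeftContinuous ℝ unitInterval v) t = L (primitiveFun v t) := by
  unfold primitiveFun
  exact L.intervalIntegral_comp_comm ((continuous_comp_projIcc v).intervalIntegrable _ _)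

variable (h₀ : E ≃L[ℝ] E)

/-- The linear flow generator `(a, b) ↦ (h₀ b, 0)`. -/
noncomputable def freeGenerator : E × E →L[ℝ] E × E :=
  (ContinuousLinearMap.inl ℝ E E).comp ((h₀ : E →L[ℝ] E).comp (ContinuousLinearMap.snd ℝ E E))

/-- The derivative of the shooting map at the constant solution. -/
noncomputable def freeShooting : C(unitInterval, E × E) →L[ℝ] C(unitInterval, E × E) :=
  ContinuousLinearMap.id ℝ _
    - primitive.comp ((freeGenerator h₀).compLeftContinuous ℝ unitInterval)
    + constPath.comp boundaryOp

theorem freeShooting_apply (v : C(unitInterval, E × E)) (t : unitInterval) :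
    freeShooting h₀ v t = ((v t).1 - h₀ (primitiveFun
      ((ContinuousLinearMap.snd ℝ E E).compLeftContinuous ℝ unitInterval v) t),
      (v t).2 + ((v 1).1 - (v 0).2)) := by
  have h1 := primitiveFun_clm (freeGenerator h₀) v (t : ℝ)
  have h2 := primitiveFun_clm (ContinuousLinearMap.snd ℝ E E) v (t : ℝ)
  simp only [freeShooting, add_apply, sub_apply,
    ContinuousLinearMap.comp_apply, ContinuousMap.add_apply, ContinuousMap.sub_apply,
    primitive_apply, ContinuousLinearMap.id_apply, constPath_apply, boundaryOp_apply]
  rw [h1, h2]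
  ext <;> simp [freeGenerator]

/-- At the zero solution the linearised flow is force free: momentum is constant and position is
linear in t. -/
theorem freeShooting_eq_const {v : C(unitInterval, E × E)} {η : E}
    (hv : freeShooting h₀ v = constPath (0, η)) (t : unitInterval) :
    v t = ((t : ℝ) • η, h₀.symm η) := by
  have ht : ∀ t, freeShooting h₀ v t = (0, η) := fun t => by rw [hv]; rfl
  simp only [freeShooting_apply, Prod.mk.injEq] at ht
  have h1 : (v 1).1 = η := by
    have := (ht 0).2
    rwa [add_sub_cancel] at this
  have h2 : ∀ t, (v t).2 = (v 0).2 := fun t => by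
    have := (ht t).2
    rw [h1] at this
    have h3 : (v t).2 - (v 0).2 = 0 := by
      rw [← sub_eq_zero] at this
      rw [← this]; abel
    exact sub_eq_zero.1 h3
  have h3 : (ContinuousLinearMap.snd ℝ E E).compLeftContinuous ℝ unitInterval v
      = constPath (v 0).2 := by
    ext1 t; exact h2 t
  have h4 : ∀ t : unitInterval, (v t).1 = (t : ℝ) • h₀ (v 0).2 := fun t => by
    have := (ht t).1
    rw [h3, primitiveFun_const, map_smul] at this
    exact sub_eq_zero.1 this
  have h5 : h₀ (v 0).2 = η := by
    have := h4 1
    rw [h1] at this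
    simpa using this.symm
  refine Prod.ext ?_ ?_
  · rw [h4, h5]
  · rw [h2, ← h5, h₀.symm_apply_apply]

theorem bijective_freeShooting : Function.Bijective (freeShooting h₀) := by
  constructor
  · rw [injective_iff_map_eq_zero]
    intro v hv
    have h := freeShooting_eq_const h₀ (v := v) (η := 0) (by rw [hv]; ext1 t; rfl)
    ext1 t
    rw [h t]
    simp
  · intro b
    set b₂ := (ContinuousLinearMap.snd ℝ E E).compLeftContinuous ℝ unitInterval b with hb₂
    -- A preimage of b must have momentum b₂ + c and position b₁ + h₀∫(b₂ + c). The boundary term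
    -- requires x(1) - p(0) = -c, that is h₀(∫₀¹b₂ + c) = b₂(0) - b₁(1), which determines c.
    set c : E := h₀.symm ((b 0).2 - (b 1).1) - primitiveFun b₂ 1 with hc
    set v : C(unitInterval, E × E) := b + constPath (0, c) +
      (ContinuousLinearMap.inl ℝ E E).compLeftContinuous ℝ unitInterval
        (primitive ((h₀ : E →L[ℝ] E).compLeftContinuous ℝ unitInterval (b₂ + constPath c))) with hv
    have hprim : ∀ t : ℝ, primitiveFun ((h₀ : E →L[ℝ] E).compLeftContinuous ℝ unitInterval
        (b₂ + constPath c)) t = h₀ (primitiveFun b₂ t + t • c) := by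
      intro t
      have e : primitiveFun (b₂ + constPath c) t
          = primitiveFun b₂ t + primitiveFun (constPath c) t := by
        unfold primitiveFun
        exact intervalIntegral.integral_add ((continuous_comp_projIcc b₂).intervalIntegrable _ _)
          ((continuous_comp_projIcc (constPath c)).intervalIntegrable _ _)
      rw [primitiveFun_clm, e, primitiveFun_const]
      rfl
    have hvt : ∀ t : unitInterval, v t
        = ((b t).1 + h₀ (primitiveFun b₂ t + (t : ℝ) • c), (b t).2 + c) := by
      intro t
      have : v t = b t + (0, c) + (primitiveFun ((h₀ : E →L[ℝ] E).compLeftContinuous ℝ unitInterval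
        (b₂ + constPath c)) t, 0) := rfl
      rw [this, hprim]
      ext <;> simp
    have hv₂ : (ContinuousLinearMap.snd ℝ E E).compLeftContinuous ℝ unitInterval v
        = b₂ + constPath c := by
      ext1 t
      have : ((ContinuousLinearMap.snd ℝ E E).compLeftContinuous ℝ unitInterval v) t = (v t).2 := rfl
      rw [this, hvt]; rfl
    have hprim₂ : ∀ t : ℝ, primitiveFun (b₂ + constPath c) t = primitiveFun b₂ t + t • c := by
      intro t
      apply h₀.injective
      rw [← hprim]
      exact (primitiveFun_clm (h₀ : E →L[ℝ] E) _ t).symm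
    refine ⟨v, ?_⟩
    ext1 t
    rw [freeShooting_apply, hv₂, hprim₂, hvt, hvt, hvt]
    refine Prod.ext ?_ ?_
    · simp
    · simp only [Icc.coe_one, one_smul]
      rw [hc, add_sub_cancel, h₀.apply_symm_apply]
      abel

/-- Solutions of the two point boundary value problem `u' = G(u)`, `x(0) = 0`, `x(1) = y` for
small `y`, depending differentiably on `y`. -/
theorem exists_shooting_solution (hG : ContDiff ℝ 1 G) (hG0 : G 0 = 0)
    (hG' : fderiv ℝ G 0 = freeGenerator h₀) :
    ∃ U : E → C(unitInterval, E × E), ContDiffAt ℝ 1 U 0 ∧ U 0 = 0 ∧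
      (∀ᶠ y in 𝓝 (0 : E), shootingMap G hG.continuous (U y) = constPath (0, y)) ∧
      (∀ η, (fderiv ℝ U 0 η 1).2 = h₀.symm η) := by
  have hΦ := contDiff_shootingMap hG
  have hderiv : HasFDerivAt (shootingMap G hG.continuous) (freeShooting h₀) 0 := by
    have h := hasFDerivAt_shootingMap hG (0 : C(unitInterval, E × E))
    convert h using 1
    unfold freeShooting
    congr 3
    ext1 v
    ext1 t
    rw [pointwiseApply_apply, superposition_apply, ContinuousMap.zero_apply, hG']
    rfl
  have hΦ0 : shootingMap G hG.continuous 0 = 0 := by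
    have : superposition G hG.continuous (0 : C(unitInterval, E × E)) = 0 := by
      ext1 t; simp [hG0]
    have h00 : constPath ((0, 0) : E × E) = 0 := by ext1 t; rfl
    simp [shootingMap, this, h00]
  set L : C(unitInterval, E × E) ≃L[ℝ] C(unitInterval, E × E) :=
    ContinuousLinearEquiv.ofBijective (freeShooting h₀)
      (LinearMap.ker_eq_bot.2 (bijective_freeShooting h₀).1)
      (LinearMap.range_eq_top.2 (bijective_freeShooting h₀).2) with hL
  have hLc : (L : C(unitInterval, E × E) →L[ℝ] C(unitInterval, E × E)) = freeShooting h₀ := by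
    ext1 v; rfl
  rw [← hLc] at hderiv
  have hΦa : ContDiffAt ℝ 1 (shootingMap G hG.continuous) 0 := hΦ.contDiffAt
  set S := hΦa.localInverse hderiv one_ne_zero with hS
  have hS1 : ContDiffAt ℝ 1 S 0 := by
    have := hΦa.to_localInverse hderiv one_ne_zero
    rwa [hΦ0] at this
  have hS0 : S 0 = 0 := by
    have := hΦa.localInverse_apply_image hderiv one_ne_zero
    rwa [hΦ0] at this
  have hSr : ∀ᶠ b in 𝓝 (0 : C(unitInterval, E × E)), shootingMap G hG.continuous (S b) = b := by
    have := (hΦa.hasStrictFDerivAt' hderiv one_ne_zero).eventually_right_inverse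
    rwa [hΦ0] at this
  -- The local inverse is needed only on the constant right-hand sides (0, y).
  set ι : E →L[ℝ] C(unitInterval, E × E) := constPath.comp (ContinuousLinearMap.inr ℝ E E) with hι
  have hι0 : ι 0 = 0 := map_zero ι
  have hU1 : ContDiffAt ℝ 1 (S ∘ ι) 0 := by
    apply ContDiffAt.comp
    · rwa [hι0]
    · exact ι.contDiff.contDiffAt
  have hev : ∀ᶠ y in 𝓝 (0 : E), shootingMap G hG.continuous ((S ∘ ι) y) = constPath (0, y) := by
    have ht : Tendsto ι (𝓝 0) (𝓝 0) := by
      have := ι.continuous.tendsto 0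
      rwa [hι0] at this
    exact ht.eventually hSr
  refine ⟨S ∘ ι, hU1, by simp [hS0], hev, fun η => ?_⟩
  have hUd := (hU1.differentiableAt one_ne_zero).hasFDerivAt
  -- Differentiating the equation solved by U at y = 0 shows that DU(0)η solves the linearised
  -- problem with data (0, η), whose solution is explicit.
  have hcomp : HasFDerivAt (shootingMap G hG.continuous ∘ (S ∘ ι))
      ((freeShooting h₀).comp (fderiv ℝ (S ∘ ι) 0)) 0 := by
    apply HasFDerivAt.comp
    · simp only [Function.comp_apply, hι0, hS0]
      rwa [← hLc]
    · exact hUd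
  have hcomp2 : HasFDerivAt (shootingMap G hG.continuous ∘ (S ∘ ι)) ι 0 :=
    ι.hasFDerivAt.congr_of_eventuallyEq hev
  have heq := hcomp.unique hcomp2
  have h1 : freeShooting h₀ (fderiv ℝ (S ∘ ι) 0 η) = constPath (0, η) := by
    have := congrArg (fun A : E →L[ℝ] C(unitInterval, E × E) => A η) heq
    simpa [hι] using this
  rw [freeShooting_eq_const h₀ h1]

end Shooting

/-! ### The Hamiltonian flow and the first variation formula -/

section Hamiltonian

/-- Extending w by constants outside [0,1] makes the integral curve C¹ on all of ℝ, so derivatives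
at the endpoints are two-sided. -/
theorem exists_curve_of_eq_primitive {P : Type*} [NormedAddCommGroup P] [NormedSpace ℝ P]
    [CompleteSpace P] {v w : C(unitInterval, P)} {a : P} (hv : v = primitive w + constPath a) :
    ∃ z : ℝ → P, ContDiff ℝ 1 z ∧ (∀ t : unitInterval, z t = v t) ∧
      ∀ t : unitInterval, HasDerivAt z (w t) t := by
  have hd : ∀ t : ℝ, HasDerivAt (fun t => primitiveFun w t + a)
      (w (Set.projIcc 0 1 zero_le_one t)) t := fun t =>
    (hasDerivAt_primitiveFun w t).add_const a
  refine ⟨fun t => primitiveFun w t + a, ?_, fun t => ?_, fun t => ?_⟩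
  · rw [contDiff_one_iff_deriv]
    refine ⟨fun t => (hd t).differentiableAt, ?_⟩
    have : deriv (fun t => primitiveFun w t + a) = fun t => w (Set.projIcc 0 1 zero_le_one t) :=
      funext fun t => (hd t).deriv
    rw [this]
    exact continuous_comp_projIcc w
  · rw [hv]; rfl
  · have := hd t
    rwa [Set.projIcc_val] at this

theorem eq_of_hasDerivAt_zero_unitInterval {f : ℝ → ℝ}
    (hf : ∀ t : unitInterval, HasDerivAt f 0 t) (t : unitInterval) : f t = f 0 := by
  refine constant_of_has_deriv_right_zero (a := 0) (b := 1) ?_ ?_ t t.2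
  · exact fun s hs => (hf ⟨s, hs⟩).continuousAt.continuousWithinAt
  · exact fun s hs => (hf ⟨s, hs.1, hs.2.le⟩).hasDerivWithinAt

variable {n : ℕ} {H : (Fin n → ℝ) × (Fin n → ℝ) → ℝ}
  {G : (Fin n → ℝ) × (Fin n → ℝ) → (Fin n → ℝ) × (Fin n → ℝ)}

theorem HasDerivAt.dotProduct' {a b : ℝ → Fin n → ℝ} {a' b' : Fin n → ℝ} {t : ℝ}
    (ha : HasDerivAt a a' t) (hb : HasDerivAt b b' t) :
    HasDerivAt (fun s => a s ⬝ᵥ b s) (a' ⬝ᵥ b t + a t ⬝ᵥ b') t := by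
  simp only [dotProduct, ← Finset.sum_add_distrib]
  exact HasDerivAt.fun_sum fun i _ => (hasDerivAt_pi.1 ha i).mul (hasDerivAt_pi.1 hb i)

/-- Conservation of energy. -/
theorem hamiltonian_const (hH : Differentiable ℝ H) (hG : Continuous G)
    (hGH : ∀ z δ, fderiv ℝ H z δ = -((G z).2 ⬝ᵥ δ.1) + (G z).1 ⬝ᵥ δ.2)
    {u : C(unitInterval, (Fin n → ℝ) × (Fin n → ℝ))} {a : (Fin n → ℝ) × (Fin n → ℝ)}
    (hu : u = primitive (superposition G hG u) + constPath a) (t : unitInterval) :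
    H (u t) = H (u 0) := by
  obtain ⟨z, -, hz, hz'⟩ := exists_curve_of_eq_primitive hu
  have hd : ∀ t : unitInterval, HasDerivAt (fun s => H (z s)) 0 t := by
    intro t
    have h := (hH (z t)).hasFDerivAt.comp_hasDerivAt (t : ℝ) (hz' t)
    have hval : fderiv ℝ H (z t) (superposition G hG u t) = 0 := by
      rw [hGH, superposition_apply, hz, dotProduct_comm]
      ring
    rw [hval] at h
    exact h
  have := eq_of_hasDerivAt_zero_unitInterval hd t
  have h0 : z 0 = u 0 := hz 0
  rwa [hz, h0] at this

/-- The first variation formula: `p(1) · δx(1)` is the variation of the energy. -/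
theorem first_variation (hH : Differentiable ℝ H) (hG : ContDiff ℝ 1 G)
    (hGH : ∀ z δ, fderiv ℝ H z δ = -((G z).2 ⬝ᵥ δ.1) + (G z).1 ⬝ᵥ δ.2)
    (hE : ∀ z, z.2 ⬝ᵥ (G z).1 = 2 * H z)
    {u v : C(unitInterval, (Fin n → ℝ) × (Fin n → ℝ))} {a : (Fin n → ℝ) × (Fin n → ℝ)}
    {b : Fin n → ℝ} {c : ℝ}
    (hu : u = primitive (superposition G hG.continuous u) + constPath a)
    (hv : v = primitive (pointwiseApply
      (superposition (fderiv ℝ G) (hG.continuous_fderiv one_ne_zero) u) v) + constPath (0, b))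
    (hc : ∀ t, fderiv ℝ H (u t) (v t) = c) :
    (u 1).2 ⬝ᵥ (v 1).1 = c := by
  obtain ⟨z, -, hz, hz'⟩ := exists_curve_of_eq_primitive hu
  obtain ⟨y, -, hy, hy'⟩ := exists_curve_of_eq_primitive hv
  -- Differentiate p · ∂_pH = 2H in the direction δ and substitute the expression of dH through G.
  have hEuler : ∀ z δ, z.2 ⬝ᵥ (fderiv ℝ G z δ).1
      = -2 * ((G z).2 ⬝ᵥ δ.1) + (G z).1 ⬝ᵥ δ.2 := by
    intro z δ
    have hline : HasDerivAt (fun s : ℝ => z + s • δ) δ 0 := by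
      simpa using ((hasDerivAt_id (0 : ℝ)).smul_const δ).const_add z
    have hGz : HasFDerivAt G (fderiv ℝ G z) (z + (0 : ℝ) • δ) := by
      rw [zero_smul, add_zero]; exact (hG.differentiable one_ne_zero z).hasFDerivAt
    have hHz : HasFDerivAt H (fderiv ℝ H z) (z + (0 : ℝ) • δ) := by
      rw [zero_smul, add_zero]; exact (hH z).hasFDerivAt
    have h1 := hGz.comp_hasDerivAt (0 : ℝ) hline
    have h2 := hHz.comp_hasDerivAt (0 : ℝ) hline
    have h3 := HasDerivAt.dotProduct' hline.snd h1.fst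
    have h4 : HasDerivAt (fun s : ℝ => (z + s • δ).2 ⬝ᵥ (G (z + s • δ)).1)
        (2 * fderiv ℝ H z δ) 0 := by
      refine (h2.const_mul 2).congr_of_eventuallyEq (Eventually.of_forall fun s => ?_)
      exact hE _
    have h5 := h3.unique h4
    rw [hGH] at h5
    simp only [Function.comp_apply, zero_smul, add_zero] at h5
    rw [dotProduct_comm δ.2] at h5
    linarith
  -- With z = (x, p) and variation y = (δx, δp), the Euler identity gives (p · δx)' = -G₂ · δx + G₁
  -- · δp = dH(δx, δp) = c. Since δx(0) = 0, integrating over [0,1] gives the formula.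
  have hd : ∀ t : unitInterval,
      HasDerivAt (fun s => (z s).2 ⬝ᵥ (y s).1 - s * c) 0 t := by
    intro t
    have h1 := (HasDerivAt.dotProduct' (hz' t).snd (hy' t).fst).sub
      ((hasDerivAt_id (t : ℝ)).mul_const c)
    have hval : (superposition G hG.continuous u t).2 ⬝ᵥ (y t).1 + (z t).2 ⬝ᵥ (pointwiseApply
        (superposition (fderiv ℝ G) (hG.continuous_fderiv one_ne_zero) u) v t).1 - 1 * c = 0 := by
      rw [pointwiseApply_apply, superposition_apply, superposition_apply, hz, hy, hEuler, ← hc t,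
        hGH]
      ring
    rw [hval] at h1
    exact h1
  have := eq_of_hasDerivAt_zero_unitInterval hd 1
  have hz1 : z 1 = u 1 := hz 1
  have hy1 : y 1 = v 1 := hy 1
  have hy0 : y 0 = (0, b) := by
    have h0 : y 0 = v 0 := hy 0
    rw [h0, hv]
    simp
  simp only [Icc.coe_one, hz1, hy1, hy0, dotProduct_zero] at this
  linarith

/-- The generating function of the radial Hamiltonian flow: twice the energy `φ` of the solution
from `0` to `y`, with `dφ = 2 p`. -/
theorem exists_generating_function (hH : Differentiable ℝ H) (hG : ContDiff ℝ 1 G)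
    (hGH : ∀ z δ, fderiv ℝ H z δ = -((G z).2 ⬝ᵥ δ.1) + (G z).1 ⬝ᵥ δ.2)
    (hE : ∀ z, z.2 ⬝ᵥ (G z).1 = 2 * H z) (hG0 : G 0 = 0)
    (h₀ : (Fin n → ℝ) ≃L[ℝ] (Fin n → ℝ)) (hG' : fderiv ℝ G 0 = freeGenerator h₀) :
    ∃ (p : (Fin n → ℝ) → Fin n → ℝ) (φ : (Fin n → ℝ) → ℝ), p 0 = 0 ∧ ContDiffAt ℝ 1 p 0 ∧
      (∀ η, fderiv ℝ p 0 η = h₀.symm η) ∧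
      (∀ᶠ y in 𝓝 (0 : Fin n → ℝ), DifferentiableAt ℝ φ y ∧
        (∀ η, fderiv ℝ φ y η = 2 * (p y ⬝ᵥ η)) ∧ φ y = 2 * H (y, p y)) ∧
      ∀ ρ : ℝ, 0 < ρ → ∀ᶠ y in 𝓝 (0 : Fin n → ℝ), ∃ γ q : ℝ → Fin n → ℝ, ContDiff ℝ 1 γ ∧
        γ 0 = 0 ∧ γ 1 = y ∧ ∀ t ∈ Icc (0 : ℝ) 1, ‖γ t‖ < ρ ∧
          HasDerivAt γ (G (γ t, q t)).1 t ∧ 2 * H (γ t, q t) = φ y := by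
  obtain ⟨U, hU, hU0, hUs, hU'⟩ := exists_shooting_solution h₀ hG hG0 hG'
  set ev : unitInterval → C(unitInterval, (Fin n → ℝ) × (Fin n → ℝ)) →L[ℝ]
    (Fin n → ℝ) × (Fin n → ℝ) := fun t => ContinuousMap.evalCLM ℝ t with hev
  have hfst : ∀ᶠ y in 𝓝 (0 : Fin n → ℝ), (U y 1).1 = y := by
    filter_upwards [hUs] with y hy
    exact ((shootingMap_eq_const_iff _ _ _).1 hy).2
  refine ⟨fun y => (U y 1).2, fun y => 2 * H (U y 1), by simp [hU0], ?_, ?_, ?_, ?_⟩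
  · exact ((ContinuousLinearMap.snd ℝ _ _).comp (ev 1)).contDiff.contDiffAt.comp (0 : Fin n → ℝ) hU
  · intro η
    have h := (((ContinuousLinearMap.snd ℝ _ _).comp (ev 1)).hasFDerivAt
      (x := U 0)).comp (0 : Fin n → ℝ) (hU.differentiableAt one_ne_zero).hasFDerivAt
    have h2 : fderiv ℝ (fun y => (U y 1).2) 0
        = ((ContinuousLinearMap.snd ℝ _ _).comp (ev 1)).comp (fderiv ℝ U 0) := h.fderiv
    rw [h2, ← hU']
    rfl
  · filter_upwards [hU.eventually (by simp), hUs.eventually_nhds, hfst] with y hUy hsy hy1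
    have hUd := (hUy.differentiableAt one_ne_zero).hasFDerivAt
    have hdt : ∀ t, HasFDerivAt (fun y => H (U y t))
        ((fderiv ℝ H (U y t)).comp ((ev t).comp (fderiv ℝ U y))) y := fun t =>
      HasFDerivAt.comp (g := H) (f := fun y => U y t) y (hH (U y t)).hasFDerivAt
        ((ev t).hasFDerivAt.comp y hUd)
    have hφ := (hdt 1).const_mul 2
    refine ⟨hφ.differentiableAt, fun η => ?_, ?_⟩
    · rw [hφ.fderiv]
      have hsol : ∀ᶠ y' in 𝓝 y, U y' = primitive (superposition G hG.continuous (U y'))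
          + constPath (0, (U y' 0).2) ∧ (U y' 1).1 = y' := by
        filter_upwards [hsy] with y' hy'
        exact (shootingMap_eq_const_iff _ _ _).1 hy'
      set v := fderiv ℝ U y η with hv
      have hΦ : shootingMap G hG.continuous ∘ U =ᶠ[𝓝 y]
          (constPath.comp (ContinuousLinearMap.inr ℝ (Fin n → ℝ) (Fin n → ℝ))) := hsy
      have hder := ((hasFDerivAt_shootingMap hG (U y)).comp y hUd).unique
        ((constPath.comp (ContinuousLinearMap.inr ℝ (Fin n → ℝ)
          (Fin n → ℝ))).hasFDerivAt.congr_of_eventuallyEq hΦ)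
      have hder' := congrArg (fun A : (Fin n → ℝ) →L[ℝ] _ => A η) hder
      simp only [ContinuousLinearMap.comp_apply, add_apply, sub_apply,
        ContinuousLinearMap.id_apply, ContinuousLinearMap.inr_apply, ← hv] at hder'
      have hv1 : (v 1).1 = η := by
        have hf : HasFDerivAt (fun y' => (U y' 1).1)
            (((ContinuousLinearMap.fst ℝ _ _).comp (ev 1)).comp (fderiv ℝ U y)) y :=
          (((ContinuousLinearMap.fst ℝ _ _).comp (ev 1)).hasFDerivAt (x := U y)).comp y hUd
        have hid : HasFDerivAt (fun y' => (U y' 1).1) (ContinuousLinearMap.id ℝ _) y :=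
          (hasFDerivAt_id y).congr_of_eventuallyEq (hsol.mono fun y' h => h.2)
        exact congrArg (fun A : (Fin n → ℝ) →L[ℝ] (Fin n → ℝ) => A η) (hf.unique hid)
      -- The variational equation along the trajectory, obtained by differentiating the shooting
      -- equation in y.
      have hveq : v = primitive (pointwiseApply
          (superposition (fderiv ℝ G) (hG.continuous_fderiv one_ne_zero) (U y)) v)
          + constPath (0, (v 0).2) := by
        rw [boundaryOp_apply, hv1] at hder'
        have e : constPath ((0 : Fin n → ℝ), η - (v 0).2)
            = constPath (0, η) - constPath ((0 : Fin n → ℝ), (v 0).2) := by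
          ext1 t; simp
        rw [e] at hder'
        rw [← sub_eq_zero] at hder' ⊢
        rw [← hder']
        abel
      -- For each nearby endpoint the energy does not depend on t, so neither does its derivative
      -- with respect to the endpoint.
      have hcons : ∀ t, fderiv ℝ H (U y t) (v t) = fderiv ℝ H (U y 1) (v 1) := by
        intro t
        have h : (fun y' => H (U y' t)) =ᶠ[𝓝 y] fun y' => H (U y' 1) := by
          filter_upwards [hsol] with y' hy'
          rw [hamiltonian_const hH hG.continuous hGH hy'.1 t,
            hamiltonian_const hH hG.continuous hGH hy'.1 1]
        have := (hdt t).unique ((hdt 1).congr_of_eventuallyEq h)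
        exact congrArg (fun A : (Fin n → ℝ) →L[ℝ] ℝ => A η) this
      have key := first_variation hH hG hGH hE hsol.self_of_nhds.1 hveq hcons
      rw [hv1] at key
      change (2 : ℝ) • (fderiv ℝ H (U y 1) (v 1)) = _
      rw [← key]
      simp
    · conv_lhs => rw [show U y 1 = ((U y 1).1, (U y 1).2) from rfl, hy1]
  · intro ρ hρ
    have hsmall : ∀ᶠ y in 𝓝 (0 : Fin n → ℝ), ‖U y‖ < ρ := by
      have := hU.continuousAt.norm
      apply this.eventually_lt_const
      simpa [hU0] using hρ
    filter_upwards [hsmall, hUs] with y hyρ hys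
    have hsol := (shootingMap_eq_const_iff _ _ _).1 hys
    obtain ⟨z, hz1, hz, hz'⟩ := exists_curve_of_eq_primitive hsol.1
    refine ⟨fun t => (z t).1, fun t => (z t).2, hz1.fst, ?_, ?_, fun t ht => ⟨?_, ?_, ?_⟩⟩
    · have h0 : z 0 = U y 0 := hz 0
      simp only [h0]
      rw [hsol.1]
      simp
    · have h1 : z 1 = U y 1 := hz 1
      simp only [h1, hsol.2]
    · have := hz ⟨t, ht⟩
      simp only at this
      change ‖(z t).1‖ < ρ
      rw [this]
      exact ((norm_fst_le _).trans ((U y).norm_coe_le_norm _)).trans_lt hyρ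
    · have h := (hz' ⟨t, ht⟩).fst
      rw [superposition_apply, ← hz] at h
      exact h
    · have := hz ⟨t, ht⟩
      simp only at this
      simp only [Prod.mk.eta]
      rw [this, hamiltonian_const hH hG.continuous hGH hsol.1 ⟨t, ht⟩,
        hamiltonian_const hH hG.continuous hGH hsol.1 1]

end Hamiltonian

/-! ### The kinetic energy Hamiltonian of a cometric -/

section Kinetic

variable {n : ℕ} (h : (Fin n → ℝ) → Matrix (Fin n) (Fin n) ℝ)

/-- The Hamiltonian `½ h^{ij}(x) p_i p_j`. -/
noncomputable def kinetic (z : (Fin n → ℝ) × (Fin n → ℝ)) : ℝ :=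
  1 / 2 * ∑ i, ∑ j, h z.1 i j * z.2 i * z.2 j

/-- The Hamiltonian vector field of `kinetic h`. -/
noncomputable def kineticField (z : (Fin n → ℝ) × (Fin n → ℝ)) : (Fin n → ℝ) × (Fin n → ℝ) :=
  (fun i => ∑ j, h z.1 i j * z.2 j,
    fun k => -(1 / 2) * ∑ i, ∑ j, partialDeriv k (fun x => h x i j) z.1 * z.2 i * z.2 j)

variable {h} (hs : ∀ i j, ContDiff ℝ ∞ (fun x => h x i j)) (hsymm : ∀ x i j, h x i j = h x j i)

theorem contDiff_partialDeriv {F : (Fin n → ℝ) → ℝ} (hF : ContDiff ℝ ∞ F) (i : Fin n) :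
    ContDiff ℝ ∞ (partialDeriv i F) :=
  (hF.fderiv_right (m := ∞) (by simp)).clm_apply contDiff_const

include hs in
theorem contDiff_kinetic : ContDiff ℝ ∞ (kinetic h) := by
  unfold kinetic
  refine contDiff_const.mul (ContDiff.sum fun i _ => ContDiff.sum fun j _ => ?_)
  have h1 : ContDiff ℝ ∞ fun z : (Fin n → ℝ) × (Fin n → ℝ) => h z.1 i j := (hs i j).comp contDiff_fst
  have h2 : ∀ i, ContDiff ℝ ∞ fun z : (Fin n → ℝ) × (Fin n → ℝ) => z.2 i :=
    contDiff_pi.1 contDiff_snd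
  exact (h1.mul (h2 i)).mul (h2 j)

include hs in
theorem contDiff_kineticField : ContDiff ℝ ∞ (kineticField h) := by
  have h2 : ∀ i, ContDiff ℝ ∞ fun z : (Fin n → ℝ) × (Fin n → ℝ) => z.2 i :=
    contDiff_pi.1 contDiff_snd
  refine ContDiff.prodMk (contDiff_pi.2 fun i => ContDiff.sum fun j _ => ?_)
    (contDiff_pi.2 fun k => contDiff_const.mul
      (ContDiff.sum fun i _ => ContDiff.sum fun j _ => ?_))
  · exact ((hs i j).comp contDiff_fst).mul (h2 j)
  · exact (((contDiff_partialDeriv (hs i j) k).comp contDiff_fst).mul (h2 i)).mul (h2 j)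

include hs in
theorem hasDerivAt_comp_line (i j : Fin n) (x a : Fin n → ℝ) :
    HasDerivAt (fun s : ℝ => h (x + s • a) i j)
      (∑ k, a k * partialDeriv k (fun x => h x i j) x) 0 := by
  have hline : HasDerivAt (fun s : ℝ => x + s • a) a 0 := by
    simpa using ((hasDerivAt_id (0 : ℝ)).smul_const a).const_add x
  have hd : HasFDerivAt (fun x => h x i j) (fderiv ℝ (fun x => h x i j) x) (x + (0 : ℝ) • a) := by
    rw [zero_smul, add_zero]
    exact ((hs i j).differentiable (by simp) x).hasFDerivAt
  rw [← fderiv_apply_eq_sum_partialDeriv]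
  exact hd.comp_hasDerivAt (0 : ℝ) hline

theorem hasDerivAt_affine (p b : ℝ) : HasDerivAt (fun s : ℝ => p + s * b) b 0 := by
  simpa using ((hasDerivAt_id (0 : ℝ)).mul_const b).const_add p

include hs hsymm in
theorem fderiv_kinetic (z δ : (Fin n → ℝ) × (Fin n → ℝ)) :
    fderiv ℝ (kinetic h) z δ
      = -((kineticField h z).2 ⬝ᵥ δ.1) + (kineticField h z).1 ⬝ᵥ δ.2 := by
  have hline : HasDerivAt (fun s : ℝ => z + s • δ) δ 0 := by
    simpa using ((hasDerivAt_id (0 : ℝ)).smul_const δ).const_add z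
  have hd : HasFDerivAt (kinetic h) (fderiv ℝ (kinetic h) z) (z + (0 : ℝ) • δ) := by
    rw [zero_smul, add_zero]
    exact ((contDiff_kinetic hs).differentiable (by simp) z).hasFDerivAt
  have h1 := hd.comp_hasDerivAt (0 : ℝ) hline
  have h2 : HasDerivAt (fun s : ℝ => kinetic h (z + s • δ)) (1 / 2 * ∑ i, ∑ j,
      (((∑ k, δ.1 k * partialDeriv k (fun x => h x i j) z.1) * (z.2 i + 0 * δ.2 i)
        + h (z.1 + (0 : ℝ) • δ.1) i j * δ.2 i) * (z.2 j + 0 * δ.2 j)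
        + h (z.1 + (0 : ℝ) • δ.1) i j * (z.2 i + 0 * δ.2 i) * δ.2 j)) 0 := by
    unfold kinetic
    refine HasDerivAt.const_mul _ (HasDerivAt.fun_sum fun i _ => HasDerivAt.fun_sum fun j _ => ?_)
    exact ((hasDerivAt_comp_line hs i j z.1 δ.1).mul (hasDerivAt_affine (z.2 i) (δ.2 i))).mul
      (hasDerivAt_affine (z.2 j) (δ.2 j))
  rw [h1.unique h2]
  simp only [zero_smul, add_zero, zero_mul, kineticField, dotProduct]
  have e1 : ∑ k, -(1 / 2) * (∑ i, ∑ j, partialDeriv k (fun x => h x i j) z.1 * z.2 i * z.2 j)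
      * δ.1 k = -(1 / 2) * ∑ i, ∑ j,
        (∑ k, δ.1 k * partialDeriv k (fun x => h x i j) z.1) * z.2 i * z.2 j := by
    simp_rw [Finset.mul_sum, Finset.sum_mul, Finset.mul_sum]
    rw [Finset.sum_comm]
    refine Finset.sum_congr rfl fun i _ => ?_
    rw [Finset.sum_comm]
    exact Finset.sum_congr rfl fun j _ => Finset.sum_congr rfl fun k _ => by ring
  have e2 : ∑ i, ∑ j, h z.1 i j * z.2 i * δ.2 j = ∑ i, (∑ j, h z.1 i j * z.2 j) * δ.2 i := by
    simp_rw [Finset.sum_mul]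
    rw [Finset.sum_comm]
    exact Finset.sum_congr rfl fun j _ => Finset.sum_congr rfl fun k _ => by rw [hsymm]
  have e3 : ∑ i, ∑ j, h z.1 i j * δ.2 i * z.2 j = ∑ i, (∑ j, h z.1 i j * z.2 j) * δ.2 i := by
    simp_rw [Finset.sum_mul]
    exact Finset.sum_congr rfl fun j _ => Finset.sum_congr rfl fun k _ => by ring
  rw [e1, ← e2]
  simp_rw [add_mul, Finset.sum_add_distrib]
  rw [e3, ← e2]
  ring

theorem dotProduct_kineticField (z : (Fin n → ℝ) × (Fin n → ℝ)) :
    z.2 ⬝ᵥ (kineticField h z).1 = 2 * kinetic h z := by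
  simp only [kineticField, kinetic, dotProduct, Finset.mul_sum]
  exact Finset.sum_congr rfl fun j _ => Finset.sum_congr rfl fun k _ => by ring

include hs in
-- The position component is linear in p and the momentum component quadratic in p, so at the origin
-- of phase space only h(0)δp survives.
theorem fderiv_kineticField_zero (h₀ : (Fin n → ℝ) ≃L[ℝ] (Fin n → ℝ))
    (hh₀ : ∀ b, h₀ b = (h 0).mulVec b) : fderiv ℝ (kineticField h) 0 = freeGenerator h₀ := by
  refine ContinuousLinearMap.ext fun δ => ?_
  have hline : HasDerivAt (fun s : ℝ => 0 + s • δ) δ 0 := by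
    simpa using ((hasDerivAt_id (0 : ℝ)).smul_const δ).const_add 0
  have hd : HasFDerivAt (kineticField h) (fderiv ℝ (kineticField h) 0) (0 + (0 : ℝ) • δ) := by
    rw [zero_smul, add_zero]
    exact ((contDiff_kineticField hs).differentiable (by simp) 0).hasFDerivAt
  have h1 := hd.comp_hasDerivAt (0 : ℝ) hline
  have h2 : HasDerivAt (fun s : ℝ => kineticField h (0 + s • δ)) ((h 0).mulVec δ.2, 0) 0 := by
    refine HasDerivAt.prodMk (hasDerivAt_pi.2 fun i => ?_) (hasDerivAt_pi.2 fun k => ?_)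
    · have := HasDerivAt.fun_sum (u := Finset.univ) fun j _ =>
        (hasDerivAt_comp_line hs i j 0 δ.1).mul (hasDerivAt_affine 0 (δ.2 j))
      simp only [zero_smul, zero_mul, add_zero, mul_zero, zero_add] at this
      refine (this.congr_of_eventuallyEq (Eventually.of_forall fun s => ?_))
      simp
    · have hk : ∀ i j, HasDerivAt (fun s : ℝ =>
          partialDeriv k (fun x => h x i j) (0 + s • δ.1) * (0 + s * δ.2 i) * (0 + s * δ.2 j))
          0 0 := by
        intro i j
        have hc : DifferentiableAt ℝ (fun s : ℝ =>
            partialDeriv k (fun x => h x i j) (0 + s • δ.1)) 0 := by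
          have := (contDiff_partialDeriv (hs i j) k).differentiable (by simp)
          fun_prop
        exact ((hc.hasDerivAt.mul (hasDerivAt_affine 0 (δ.2 i))).mul
          (hasDerivAt_affine 0 (δ.2 j))).congr_deriv (by simp)
      have := (HasDerivAt.fun_sum (u := Finset.univ) fun i _ =>
        HasDerivAt.fun_sum (u := Finset.univ) fun j _ => hk i j).const_mul (-(1 / 2 : ℝ))
      simp only [Finset.sum_const_zero, mul_zero] at this
      refine (this.congr_of_eventuallyEq (Eventually.of_forall fun s => ?_))
      simp
  rw [h1.unique h2]
  simp only [freeGenerator, ContinuousLinearMap.comp_apply]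
  ext i
  · simp [hh₀]
  · simp

end Kinetic

/-! ### The squared distance function -/

section Radial

variable {n : ℕ} {Ω : Set (Fin n → ℝ)} {g : (Fin n → ℝ) → Matrix (Fin n) (Fin n) ℝ}

/-- A smooth cometric on `ℝⁿ` which agrees with `g⁻¹` near the origin. -/
theorem exists_global_cometric (hΩ : IsOpen Ω) (h0 : (0 : Fin n → ℝ) ∈ Ω)
    (hg : IsRiemannianMetricOn Ω g) :
    ∃ (h : (Fin n → ℝ) → Matrix (Fin n) (Fin n) ℝ) (ρ : ℝ), 0 < ρ ∧ Metric.ball 0 ρ ⊆ Ω ∧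
      (∀ i j, ContDiff ℝ ∞ (fun x => h x i j)) ∧ (∀ x i j, h x i j = h x j i) ∧
      ∀ x ∈ Metric.ball (0 : Fin n → ℝ) ρ, h x = (g x)⁻¹ := by
  obtain ⟨R, hR, hRΩ⟩ := Metric.nhds_basis_closedBall.mem_iff.1 (hΩ.mem_nhds h0)
  let χ : ContDiffBump (0 : Fin n → ℝ) := ⟨R / 2, R, by positivity, by linarith⟩
  have hχ0 : ∀ x, x ∉ Ω → χ x = 0 := fun x hx => χ.zero_of_le_dist (by
    by_contra! hlt
    exact hx (hRΩ (le_of_lt hlt)))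
  refine ⟨fun x => χ x • (g x)⁻¹, R / 2, by positivity, ?_, fun i j => ?_, fun x i j => ?_, ?_⟩
  · exact (Metric.ball_subset_closedBall.trans
      (Metric.closedBall_subset_closedBall (by linarith))).trans hRΩ
  · rw [contDiff_iff_contDiffAt]
    intro x
    by_cases hx : x ∈ Ω
    · simp only [Matrix.smul_apply, smul_eq_mul]
      exact χ.contDiff.contDiffAt.mul ((hg.contDiffOn_inv i j).contDiffAt (hΩ.mem_nhds hx))
    · have hx' : x ∈ (Metric.closedBall (0 : Fin n → ℝ) R)ᶜ := fun hh => hx (hRΩ hh)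
      refine (contDiffAt_const (c := (0 : ℝ))).congr_of_eventuallyEq ?_
      filter_upwards [Metric.isClosed_closedBall.isOpen_compl.mem_nhds hx'] with y hy
      have : χ y = 0 := χ.zero_of_le_dist (by
        have : ¬ dist y 0 ≤ R := hy
        exact le_of_lt (not_le.1 this))
      simp [this]
  · by_cases hx : x ∈ Ω
    · simp [hg.inv_symm hx i j]
    · simp [hχ0 x hx]
  · intro x hx
    have : χ x = 1 := χ.one_of_mem_closedBall (Metric.ball_subset_closedBall hx)
    simp [this]

/-- φ is the generating function of the kinetic Hamiltonian of the extended cometric. The extension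
may degenerate far away; this is harmless, because for small y the trajectories stay where it equals
g⁻¹. -/
theorem exists_radial_function (hΩ : IsOpen Ω) (h0 : (0 : Fin n → ℝ) ∈ Ω)
    (hg : IsRiemannianMetricOn Ω g) :
    ∃ (δ : ℝ) (φ : (Fin n → ℝ) → ℝ), 0 < δ ∧ Metric.ball 0 δ ⊆ Ω ∧
      ContDiffOn ℝ 2 φ (Metric.ball 0 δ) ∧ φ 0 = 0 ∧
      (∀ y ∈ Metric.ball (0 : Fin n → ℝ) δ, y ≠ 0 → 0 < φ y) ∧
      (∀ y ∈ Metric.ball (0 : Fin n → ℝ) δ, gradSq g φ y = 4 * φ y) ∧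
      (∀ i, partialDeriv i φ 0 = 0) ∧
      (∀ i j, partialDeriv i (partialDeriv j φ) 0 = 2 * g 0 i j) ∧
      ∀ y ∈ Metric.ball (0 : Fin n → ℝ) δ, ∃ γ : ℝ → Fin n → ℝ, ContDiff ℝ 1 γ ∧
        γ 0 = 0 ∧ γ 1 = y ∧ ∀ t ∈ Icc (0 : ℝ) 1, γ t ∈ Ω ∧
          ∑ i, ∑ j, g (γ t) i j * deriv γ t i * deriv γ t j = φ y := by
  obtain ⟨h, ρ, hρ, hρΩ, hs, hsymm, hh⟩ := exists_global_cometric hΩ h0 hg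
  have hdet : ∀ x ∈ Ω, IsUnit (g x).det := fun x hx => isUnit_iff_ne_zero.2 (hg.det_ne_zero hx)
  have hM1 : (g 0)⁻¹ * g 0 = 1 := Matrix.nonsing_inv_mul _ (hdet 0 h0)
  have hM2 : g 0 * (g 0)⁻¹ = 1 := Matrix.mul_nonsing_inv _ (hdet 0 h0)
  set h₀ : (Fin n → ℝ) ≃L[ℝ] (Fin n → ℝ) :=
    (Matrix.toLin'OfInv hM2 hM1).toContinuousLinearEquiv with hh₀
  have hh0 : h 0 = (g 0)⁻¹ := hh 0 (Metric.mem_ball_self hρ)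
  have happ : ∀ b, h₀ b = (h 0).mulVec b := fun b => by rw [hh0]; rfl
  have happ' : ∀ b, h₀.symm b = (g 0).mulVec b := fun b => rfl
  have hG := contDiff_kineticField hs
  have hG0 : kineticField h 0 = 0 := by ext <;> simp [kineticField]
  obtain ⟨p, φ, hp0, hp1, hp', hφ, hpath⟩ := exists_generating_function (H := kinetic h)
    (G := kineticField h) ((contDiff_kinetic hs).differentiable (by simp)) (hG.of_le (by simp))
    (fderiv_kinetic hs hsymm) dotProduct_kineticField hG0 h₀
    (fderiv_kineticField_zero hs h₀ happ)
  have hpd := (hp1.differentiableAt one_ne_zero).hasFDerivAt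
  -- dp(0) = g(0) is invertible, so p has an isolated zero at the origin; this is the source of φ >
  -- 0 away from 0.
  have hpne : ∀ᶠ y in 𝓝 (0 : Fin n → ℝ), y ≠ 0 → p y ≠ 0 := by
    have hL : fderiv ℝ p 0 = (h₀.symm : (Fin n → ℝ) →L[ℝ] (Fin n → ℝ)) := by ext1 η; exact hp' η
    have := (hpd.eventually_ne (c := p 0)
      ⟨_, by rw [hL]; exact h₀.symm.antilipschitz⟩)
    rw [eventually_nhdsWithin_iff] at this
    filter_upwards [this] with y hy hy0
    rw [← hp0]; exact hy hy0
  have hev := (((hp1.eventually (by simp)).and hφ).and (hpne.and (hpath ρ hρ)))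
  obtain ⟨δ', hδ', hball⟩ := Metric.eventually_nhds_iff_ball.1 hev
  set δ := min δ' ρ with hδdef
  have hδ : 0 < δ := lt_min hδ' hρ
  have hb1 : ∀ y ∈ Metric.ball (0 : Fin n → ℝ) δ, y ∈ Metric.ball (0 : Fin n → ℝ) δ' :=
    fun y hy => Metric.ball_subset_ball (min_le_left _ _) hy
  have hb2 : ∀ y ∈ Metric.ball (0 : Fin n → ℝ) δ, y ∈ Metric.ball (0 : Fin n → ℝ) ρ :=
    fun y hy => Metric.ball_subset_ball (min_le_right _ _) hy
  have hpart : ∀ y ∈ Metric.ball (0 : Fin n → ℝ) δ, ∀ i, partialDeriv i φ y = 2 * p y i := by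
    intro y hy i
    unfold partialDeriv
    rw [(hball y (hb1 y hy)).1.2.2.1]
    simp
  have hφH : ∀ y ∈ Metric.ball (0 : Fin n → ℝ) δ,
      φ y = ∑ i, ∑ j, (g y)⁻¹ i j * p y i * p y j := by
    intro y hy
    rw [(hball y (hb1 y hy)).1.2.2.2]
    simp only [kinetic, hh y (hb2 y hy)]
    ring
  have h00 : (0 : Fin n → ℝ) ∈ Metric.ball (0 : Fin n → ℝ) δ := Metric.mem_ball_self hδ
  refine ⟨δ, φ, hδ, fun y hy => hρΩ (hb2 y hy), ?_, ?_, ?_, ?_, ?_, ?_, ?_⟩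
  -- dφ = 2p with p of class C¹, hence φ is C².
  · have hone : (2 : WithTop ℕ∞) = 1 + 1 := by norm_num
    rw [hone, contDiffOn_succ_iff_fderiv_of_isOpen Metric.isOpen_ball]
    refine ⟨fun y hy => (hball y (hb1 y hy)).1.2.1.differentiableWithinAt, by simp, ?_⟩
    have hpc : ∀ i, ContDiffOn ℝ 1 (fun y => p y i) (Metric.ball 0 δ) := fun i =>
      contDiffOn_pi.1 (fun y hy => ((hball y (hb1 y hy)).1.1).contDiffWithinAt) i
    have hcd : ContDiffOn ℝ 1 (fun y => ∑ i, (2 * p y i) •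
        (ContinuousLinearMap.proj i : (Fin n → ℝ) →L[ℝ] ℝ)) (Metric.ball 0 δ) :=
      ContDiffOn.sum fun i _ => (contDiffOn_const.mul (hpc i)).smul contDiffOn_const
    refine hcd.congr fun y hy => ?_
    ext1 η
    rw [(hball y (hb1 y hy)).1.2.2.1]
    simp only [sum_apply, dotProduct, Finset.mul_sum]
    exact Finset.sum_congr rfl fun i _ => by simp; ring
  · rw [hφH 0 h00, hp0]; simp
  · intro y hy hy0
    have hpos := (hg.posDef y (hρΩ (hb2 y hy))).inv.dotProduct_mulVec_pos
      ((hball y (hb1 y hy)).2.1 hy0)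
    rw [hφH y hy]
    refine hpos.trans_eq ?_
    simp only [dotProduct, Matrix.mulVec, Finset.mul_sum]
    exact Finset.sum_congr rfl fun i _ => Finset.sum_congr rfl fun j _ => by
      simp only [Pi.star_apply, star_trivial]; ring
  · intro y hy
    simp only [gradSq, gradComp, hpart y hy, hφH y hy, Finset.mul_sum]
    exact Finset.sum_congr rfl fun i _ => Finset.sum_congr rfl fun j _ => by ring
  · intro i
    rw [hpart 0 h00, hp0]; simp
  · intro i j
    have h1 : partialDeriv i (partialDeriv j φ) 0 = partialDeriv i (fun y => 2 * p y j) 0 := by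
      refine partialDeriv_congr ?_ i
      filter_upwards [Metric.ball_mem_nhds (0 : Fin n → ℝ) hδ] with y hy using hpart y hy j
    have h2 : HasFDerivAt (fun y => 2 * p y j) ((2 : ℝ) •
        ((ContinuousLinearMap.proj j : (Fin n → ℝ) →L[ℝ] ℝ).comp (fderiv ℝ p 0))) 0 :=
      (((ContinuousLinearMap.proj j : (Fin n → ℝ) →L[ℝ] ℝ).hasFDerivAt).comp
        (0 : Fin n → ℝ) hpd).const_mul 2
    rw [h1]
    unfold partialDeriv
    rw [h2.fderiv]
    simp only [smul_apply, ContinuousLinearMap.comp_apply, hp', happ']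
    simp [hg.symm h0 i j]
  · intro y hy
    obtain ⟨γ, q, hγ, hγ0, hγ1, hγt⟩ := (hball y (hb1 y hy)).2.2
    refine ⟨γ, hγ, hγ0, hγ1, fun t ht => ?_⟩
    obtain ⟨hn, hd, hH⟩ := hγt t ht
    have hm : γ t ∈ Metric.ball (0 : Fin n → ℝ) ρ := by simpa using hn
    refine ⟨hρΩ hm, ?_⟩
    -- Hamilton's equation γ' = g⁻¹q gives g(γ',γ') = g⁻¹(q,q) = 2H, which is conserved and equals
    -- φ(y).
    have hdm : deriv γ t = (g (γ t))⁻¹.mulVec (q t) := by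
      rw [hd.deriv, ← hh _ hm]; rfl
    have hq : (g (γ t)).mulVec (deriv γ t) = q t := by
      rw [hdm, Matrix.mulVec_mulVec, Matrix.mul_nonsing_inv _ (hdet _ (hρΩ hm)), Matrix.one_mulVec]
    have e1 : ∑ i, ∑ j, g (γ t) i j * deriv γ t i * deriv γ t j
        = deriv γ t ⬝ᵥ (g (γ t)).mulVec (deriv γ t) := by
      simp only [dotProduct, Matrix.mulVec, Finset.mul_sum]
      exact Finset.sum_congr rfl fun i _ => Finset.sum_congr rfl fun j _ => by ring
    rw [e1, hq, ← hH, hdm, ← hh _ hm]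
    rw [← dotProduct_kineticField (h := h) (γ t, q t), dotProduct_comm]
    rfl

end Radial

/-! ### Calibrations and the Riemannian distance -/

section Calibration

variable {n : ℕ} {Ω : Set (Fin n → ℝ)} {g : (Fin n → ℝ) → Matrix (Fin n) (Fin n) ℝ}

theorem sum_sum_eq_dotProduct_mulVec (A : Matrix (Fin n) (Fin n) ℝ) (v : Fin n → ℝ) :
    ∑ i, ∑ j, A i j * v i * v j = v ⬝ᵥ A.mulVec v := by
  simp only [dotProduct, Matrix.mulVec, Finset.mul_sum]
  exact Finset.sum_congr rfl fun i _ => Finset.sum_congr rfl fun j _ => by ring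

/-- A function which is `1`-Lipschitz infinitesimally bounds the distance from below. -/
theorem ofReal_sub_le_riemDist (hg : IsRiemannianMetricOn Ω g) {F : (Fin n → ℝ) → ℝ}
    (hF : ∀ x ∈ Ω, DifferentiableAt ℝ F x)
    (hF' : ∀ x ∈ Ω, ∀ v, fderiv ℝ F x v ≤ Real.sqrt (v ⬝ᵥ (g x).mulVec v)) (x y : Fin n → ℝ) :
    ENNReal.ofReal (F y - F x) ≤ riemDist Ω g x y := by
  unfold riemDist
  refine le_iInf₂ fun γ hγ => ?_
  have hγ : IsPathIn Ω x y γ := hγ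
  set sp : ℝ → ℝ := fun t => Real.sqrt (∑ i, ∑ j,
    g (γ t) i j * derivWithin γ (Icc 0 1) t i * derivWithin γ (Icc 0 1) t j) with hsp
  have hu : UniqueDiffOn ℝ (Icc (0 : ℝ) 1) := uniqueDiffOn_Icc_zero_one
  have hγc : ContinuousOn γ (Icc 0 1) := hγ.contDiffOn.continuousOn
  have hγd : ContinuousOn (derivWithin γ (Icc 0 1)) (Icc 0 1) :=
    hγ.contDiffOn.continuousOn_derivWithin hu le_rfl
  have hspc : ContinuousOn sp (Icc 0 1) := by
    refine Real.continuous_sqrt.comp_continuousOn ?_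
    refine continuousOn_finsetSum _ fun i _ => continuousOn_finsetSum _ fun j _ => ?_
    have h1 : ContinuousOn (fun t => g (γ t) i j) (Icc 0 1) :=
      (hg.smooth i j).continuousOn.comp hγc hγ.mapsTo
    exact (h1.mul (continuousOn_pi.1 hγd i)).mul (continuousOn_pi.1 hγd j)
  -- Extending the speed continuously to ℝ lets the length be treated as an interval integral with a
  -- genuine derivative everywhere.
  set s : ℝ → ℝ := fun t => sp (Set.projIcc 0 1 zero_le_one t) with hs
  have hsc : Continuous s :=
    (continuousOn_iff_continuous_domRestrict.1 hspc).comp continuous_projIcc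
  have hsI : ∀ t ∈ Icc (0 : ℝ) 1, s t = sp t := fun t ht => by
    simp only [hs, Set.projIcc_of_mem zero_le_one ht]
  have hlen : pathLength g γ = ENNReal.ofReal (∫ t in (0 : ℝ)..1, s t) := by
    unfold pathLength
    rw [intervalIntegral.integral_of_le zero_le_one, ← integral_Icc_eq_integral_Ioc,
      ofReal_integral_eq_lintegral_ofReal]
    · refine setLIntegral_congr_fun measurableSet_Icc fun t ht => ?_
      simp only [hsI t ht, hsp]
    · exact hsc.continuousOn.integrableOn_Icc
    · exact Eventually.of_forall fun t => Real.sqrt_nonneg _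
  rw [hlen]
  apply ENNReal.ofReal_le_ofReal
  have hγdw : ∀ t ∈ Icc (0 : ℝ) 1, HasDerivWithinAt γ (derivWithin γ (Icc 0 1) t) (Icc 0 1) t :=
    fun t ht => (hγ.contDiffOn.differentiableOn one_ne_zero t ht).hasDerivWithinAt
  have hFγ : ∀ t ∈ Icc (0 : ℝ) 1, HasDerivWithinAt (fun t => F (γ t) - F x)
      (fderiv ℝ F (γ t) (derivWithin γ (Icc 0 1) t)) (Icc 0 1) t := fun t ht =>
    (((hF _ (hγ.mapsTo ht)).hasFDerivAt).comp_hasDerivWithinAt t (hγdw t ht)).sub_const _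
  have key := image_le_of_deriv_right_le_deriv_boundary (a := 0) (b := 1)
    (f := fun t => F (γ t) - F x) (f' := fun t => fderiv ℝ F (γ t) (derivWithin γ (Icc 0 1) t))
    (B := fun t => ∫ r in (0 : ℝ)..t, s r) (B' := s)
    (fun t ht => (hFγ t ht).continuousWithinAt)
    (fun t ht => (hFγ t (Ico_subset_Icc_self ht)).mono_of_mem_nhdsWithin
      (Icc_mem_nhdsGE_of_mem ht))
    (by simp [hγ.source])
    (fun t _ => (hsc.integral_hasStrictDerivAt 0 t).hasDerivAt.continuousAt.continuousWithinAt)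
    (fun t _ => (hsc.integral_hasStrictDerivAt 0 t).hasDerivAt.hasDerivWithinAt)
    (fun t ht => by
      rw [hsI t (Ico_subset_Icc_self ht), hsp]
      simp only [sum_sum_eq_dotProduct_mulVec]
      exact hF' _ (hγ.mapsTo (Ico_subset_Icc_self ht)) _)
    (right_mem_Icc.2 zero_le_one)
  simpa [hγ.target] using key

/-- A path of constant speed bounds the distance from above. -/
theorem riemDist_le_of_const_speed {x y : Fin n → ℝ} {γ : ℝ → Fin n → ℝ} {c : ℝ}
    (hγ : ContDiff ℝ 1 γ) (h0 : γ 0 = x) (h1 : γ 1 = y)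
    (hγt : ∀ t ∈ Icc (0 : ℝ) 1, γ t ∈ Ω ∧
      ∑ i, ∑ j, g (γ t) i j * deriv γ t i * deriv γ t j = c) :
    riemDist Ω g x y ≤ ENNReal.ofReal (Real.sqrt c) := by
  have hp : IsPathIn Ω x y γ := ⟨hγ.contDiffOn, fun t ht => (hγt t ht).1, h0, h1⟩
  refine (iInf₂_le γ hp).trans ?_
  unfold pathLength
  have : ∀ t ∈ Icc (0 : ℝ) 1, ENNReal.ofReal (Real.sqrt (∑ i, ∑ j,
      g (γ t) i j * derivWithin γ (Icc 0 1) t i * derivWithin γ (Icc 0 1) t j))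
      = ENNReal.ofReal (Real.sqrt c) := by
    intro t ht
    rw [(hγ.differentiable one_ne_zero t).derivWithin (uniqueDiffOn_Icc_zero_one t ht),
      (hγt t ht).2]
  rw [setLIntegral_congr_fun measurableSet_Icc this]
  simp

/-- A `C¹` function equal to the identity below `a` and constant above `2a`. -/
noncomputable def cutoffId (a t : ℝ) : ℝ := ∫ s in (0 : ℝ)..t, max 0 (min 1 (2 - s / a))

theorem hasDerivAt_cutoffId (a t : ℝ) :
    HasDerivAt (cutoffId a) (max 0 (min 1 (2 - t / a))) t := by
  have hc : Continuous fun s : ℝ => max 0 (min 1 (2 - s / a)) := by fun_prop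
  exact (hc.integral_hasStrictDerivAt 0 t).hasDerivAt

theorem cutoffId_of_le {a t : ℝ} (ha : 0 < a) (ht0 : 0 ≤ t) (ht : t ≤ a) : cutoffId a t = t := by
  have : cutoffId a t = ∫ s in (0 : ℝ)..t, (1 : ℝ) := by
    refine intervalIntegral.integral_congr fun s hs => ?_
    rw [uIcc_of_le ht0] at hs
    have : s / a ≤ 1 := (div_le_one ha).2 (hs.2.trans ht)
    rw [min_eq_left (by linarith), max_eq_right zero_le_one]
  rw [this]; simp

theorem cutoffId_of_ge {a t : ℝ} (ha : 0 < a) (ht : 2 * a ≤ t) :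
    cutoffId a t = cutoffId a (2 * a) := by
  have hc : Continuous fun s : ℝ => max 0 (min 1 (2 - s / a)) := by fun_prop
  have : cutoffId a t - cutoffId a (2 * a) = 0 := by
    unfold cutoffId
    rw [intervalIntegral.integral_interval_sub_left (hc.intervalIntegrable _ _)
      (hc.intervalIntegrable _ _)]
    have : ∫ s in (2 * a)..t, max 0 (min 1 (2 - s / a)) = ∫ s in (2 * a)..t, (0 : ℝ) := by
      refine intervalIntegral.integral_congr fun s hs => ?_
      rw [uIcc_of_le ht] at hs
      have : 2 ≤ s / a := (le_div_iff₀ ha).2 hs.1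
      rw [min_eq_right (by linarith), max_eq_left (by linarith)]
    rw [this]; simp
  linarith

theorem monotone_cutoffId (a : ℝ) : Monotone (cutoffId a) :=
  monotone_of_deriv_nonneg (fun t => (hasDerivAt_cutoffId a t).differentiableAt) fun t => by
    rw [(hasDerivAt_cutoffId a t).deriv]; exact le_max_left _ _

theorem fderiv_sq_le (hg : IsRiemannianMetricOn Ω g) {F : (Fin n → ℝ) → ℝ} {x : Fin n → ℝ}
    (hx : x ∈ Ω) (v : Fin n → ℝ) :
    fderiv ℝ F x v ^ 2 ≤ gradSq g F x * (v ⬝ᵥ (g x).mulVec v) := by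
  have h := (hg.posDef x hx).dotProduct_sq_le (fun i => partialDeriv i F x) v
  rw [fderiv_apply_eq_sum_partialDeriv]
  rw [dotProduct_comm] at h
  exact h

/-- Local description of the distance from the origin through a solution `φ` of the eikonal
equation `|dφ|² = 4 φ`. -/
theorem riemDist_of_eikonal (hg : IsRiemannianMetricOn Ω g) {δ r : ℝ}
    {φ : (Fin n → ℝ) → ℝ} (hδΩ : Metric.ball 0 δ ⊆ Ω)
    (hφ2 : ContDiffOn ℝ 2 φ (Metric.ball 0 δ)) (hφ0 : φ 0 = 0)
    (hφpos : ∀ y ∈ Metric.ball (0 : Fin n → ℝ) δ, y ≠ 0 → 0 < φ y)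
    (hgrad : ∀ y ∈ Metric.ball (0 : Fin n → ℝ) δ, gradSq g φ y = 4 * φ y)
    (hpath : ∀ y ∈ Metric.ball (0 : Fin n → ℝ) δ, ∃ γ : ℝ → Fin n → ℝ, ContDiff ℝ 1 γ ∧
        γ 0 = 0 ∧ γ 1 = y ∧ ∀ t ∈ Icc (0 : ℝ) 1, γ t ∈ Ω ∧
          ∑ i, ∑ j, g (γ t) i j * deriv γ t i * deriv γ t j = φ y)
    (hr : 0 < r) (hrδ : r < δ) :
    ∃ a : ℝ, 0 < a ∧
      (∀ y ∈ Metric.ball (0 : Fin n → ℝ) r, φ y < a ^ 2 →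
        riemDist Ω g 0 y = ENNReal.ofReal (Real.sqrt (φ y))) ∧
      (∀ x ∈ Ω, riemDist Ω g 0 x < ENNReal.ofReal a →
        x ∈ Metric.ball (0 : Fin n → ℝ) r ∧ φ x < a ^ 2) ∧
      (∀ x ∈ Metric.ball (0 : Fin n → ℝ) r, ∀ y ∈ Metric.ball (0 : Fin n → ℝ) r,
        φ x < a ^ 2 → φ y < a ^ 2 →
        ENNReal.ofReal (Real.sqrt (φ y) - Real.sqrt (φ x)) ≤ riemDist Ω g x y) := by
  classical
  have hbr : Metric.ball (0 : Fin n → ℝ) r ⊆ Metric.ball 0 δ := Metric.ball_subset_ball hrδ.le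
  have hφnn : ∀ y ∈ Metric.ball (0 : Fin n → ℝ) δ, 0 ≤ φ y := by
    intro y hy
    by_cases h : y = 0
    · rw [h, hφ0]
    · exact (hφpos y hy h).le
  have hφd : ∀ y ∈ Metric.ball (0 : Fin n → ℝ) δ, DifferentiableAt ℝ φ y := fun y hy =>
    (hφ2.contDiffAt (Metric.isOpen_ball.mem_nhds hy)).differentiableAt (by norm_num)
  -- lower bound for `φ` on an annulus
  set K : Set (Fin n → ℝ) := Metric.closedBall 0 r \ Metric.ball 0 (r / 2) with hK
  have hKc : IsCompact K := (isCompact_closedBall 0 r).diff Metric.isOpen_ball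
  have hKδ : K ⊆ Metric.ball 0 δ := fun y hy => Metric.closedBall_subset_ball hrδ hy.1
  obtain ⟨m, hm0, hm⟩ := hKc.exists_forall_le' (hφ2.continuousOn.mono hKδ) (a := 0)
    (fun y hy => hφpos y (hKδ hy) (fun h0 => by
      apply hy.2
      rw [h0]
      exact Metric.mem_ball_self (by positivity)))
  -- Chosen so that √φ ≥ 2a on the annulus K: there the cutoff is already constant and can be glued
  -- to a constant outside the ball.
  set a := Real.sqrt m / 2 with ha
  have ha0 : 0 < a := by positivity
  have ham : (2 * a) ^ 2 = m := by
    rw [ha, mul_div_cancel₀ _ (two_ne_zero), Real.sq_sqrt hm0.le]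
  -- the calibrating functions
  set F : ℝ → (Fin n → ℝ) → ℝ := fun s x =>
    if x ∈ Metric.ball (0 : Fin n → ℝ) r then cutoffId a (Real.sqrt (φ x + s ^ 2))
    else cutoffId a (2 * a) with hF
  -- Taking s > 0 keeps the square root differentiable at the origin. The bound follows from |dφ|² =
  -- 4φ ≤ 4(φ + s²), since the cutoff has slope in [0,1].
  have hFin : ∀ s, ∀ x ∈ Metric.ball (0 : Fin n → ℝ) r, 0 < s →
      DifferentiableAt ℝ (F s) x ∧
      ∀ v, fderiv ℝ (F s) x v ≤ Real.sqrt (v ⬝ᵥ (g x).mulVec v) := by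
    intro s x hx hs
    have hxδ := hbr hx
    have hpos : 0 < φ x + s ^ 2 := add_pos_of_nonneg_of_pos (hφnn x hxδ) (by positivity)
    have heq : F s =ᶠ[𝓝 x] fun x => cutoffId a (Real.sqrt (φ x + s ^ 2)) := by
      filter_upwards [Metric.isOpen_ball.mem_nhds hx] with y hy
      simp only [hF, if_pos hy]
    have hd1 : HasFDerivAt (fun x => φ x + s ^ 2) (fderiv ℝ φ x) x :=
      (hφd x hxδ).hasFDerivAt.add_const _
    have hd2 := (hasDerivAt_cutoffId a (Real.sqrt (φ x + s ^ 2))).comp_hasFDerivAt x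
      ((hd1.sqrt hpos.ne'))
    have hd3 := hd2.congr_of_eventuallyEq heq
    refine ⟨hd3.differentiableAt, fun v => ?_⟩
    rw [hd3.fderiv]
    set k := max 0 (min 1 (2 - Real.sqrt (φ x + s ^ 2) / a)) with hk
    have hk0 : 0 ≤ k := le_max_left _ _
    have hk1 : k ≤ 1 := max_le zero_le_one (min_le_left _ _)
    simp only [smul_apply, smul_eq_mul]
    have hv0 : 0 ≤ v ⬝ᵥ (g x).mulVec v := by
      simpa using (hg.posDef x (hδΩ hxδ)).posSemidef.dotProduct_mulVec_nonneg v
    have hCS := fderiv_sq_le hg (F := φ) (hδΩ hxδ) v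
    rw [hgrad x hxδ] at hCS
    set D := fderiv ℝ φ x v with hD
    set q := v ⬝ᵥ (g x).mulVec v with hq
    set S := Real.sqrt (φ x + s ^ 2) with hS
    have hSpos : 0 < S := Real.sqrt_pos.2 hpos
    have hS2 : S ^ 2 = φ x + s ^ 2 := Real.sq_sqrt hpos.le
    have hbound : |D| ≤ 2 * S * Real.sqrt q := by
      apply abs_le_of_sq_le_sq
      · rw [mul_pow, Real.sq_sqrt hv0, mul_pow, hS2]
        nlinarith [sq_nonneg s, mul_nonneg (sq_nonneg s) hv0]
      · positivity
    have h1 : 1 / (2 * S) * D ≤ Real.sqrt q := by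
      rw [div_mul_eq_mul_div, one_mul, div_le_iff₀ (by positivity)]
      calc D ≤ |D| := le_abs_self D
        _ ≤ _ := hbound
        _ = _ := by ring
    calc k * (1 / (2 * S) * D) ≤ k * Real.sqrt q := mul_le_mul_of_nonneg_left h1 hk0
      _ ≤ 1 * Real.sqrt q := mul_le_mul_of_nonneg_right hk1 (Real.sqrt_nonneg _)
      _ = _ := one_mul _
  -- The bound must hold on all of Ω, not only in the ball, because competing paths may leave the
  -- ball.
  have hFall : ∀ s, 0 < s → ∀ x ∈ Ω, DifferentiableAt ℝ (F s) x ∧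
      ∀ v, fderiv ℝ (F s) x v ≤ Real.sqrt (v ⬝ᵥ (g x).mulVec v) := by
    intro s hs x hx
    by_cases hxr : x ∈ Metric.ball (0 : Fin n → ℝ) r
    · exact hFin s x hxr hs
    · have hxo : x ∈ (Metric.closedBall (0 : Fin n → ℝ) (r / 2))ᶜ := fun h =>
        hxr (Metric.closedBall_subset_ball (by linarith) h)
      have heq : F s =ᶠ[𝓝 x] fun _ => cutoffId a (2 * a) := by
        filter_upwards [Metric.isClosed_closedBall.isOpen_compl.mem_nhds hxo] with y hy
        by_cases hyr : y ∈ Metric.ball (0 : Fin n → ℝ) r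
        · simp only [hF, if_pos hyr]
          refine cutoffId_of_ge ha0 (Real.le_sqrt_of_sq_le ?_)
          rw [ham]
          have := hm y ⟨Metric.ball_subset_closedBall hyr,
            fun h => hy (Metric.ball_subset_closedBall h)⟩
          nlinarith [sq_nonneg s]
        · simp only [hF, if_neg hyr]
      have hd := (hasFDerivAt_const (𝕜 := ℝ) (cutoffId a (2 * a)) x).congr_of_eventuallyEq heq
      refine ⟨hd.differentiableAt, fun v => ?_⟩
      rw [hd.fderiv]
      exact Real.sqrt_nonneg _
  have hcal : ∀ s, 0 < s → ∀ x y, ENNReal.ofReal (F s y - F s x) ≤ riemDist Ω g x y :=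
    fun s hs x y => ofReal_sub_le_riemDist hg (fun z hz => (hFall s hs z hz).1)
      (fun z hz => (hFall s hs z hz).2) x y
  -- pass to the limit `s → 0`
  have hlimF : ∀ x, Tendsto (fun s => F s x) (𝓝[>] 0) (𝓝 (F 0 x)) := by
    intro x
    have hc : Continuous fun s => F s x := by
      by_cases hx : x ∈ Metric.ball (0 : Fin n → ℝ) r
      · simp only [hF, if_pos hx]
        have : Continuous (cutoffId a) :=
          continuous_iff_continuousAt.2 fun t => (hasDerivAt_cutoffId a t).continuousAt
        fun_prop
      · simp only [hF, if_neg hx]; exact continuous_const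
    exact (hc.tendsto 0).mono_left nhdsWithin_le_nhds
  have hcal0 : ∀ x y, ENNReal.ofReal (F 0 y - F 0 x) ≤ riemDist Ω g x y := by
    intro x y
    refine le_of_tendsto (ENNReal.continuous_ofReal.continuousAt.tendsto.comp
      ((hlimF y).sub (hlimF x))) ?_
    filter_upwards [self_mem_nhdsWithin] with s hs using hcal s hs x y
  have hF0 : ∀ y ∈ Metric.ball (0 : Fin n → ℝ) r, φ y < a ^ 2 → F 0 y = Real.sqrt (φ y) := by
    intro y hy hya
    simp only [hF, if_pos hy]
    have h1 : Real.sqrt (φ y) ≤ a := (Real.sqrt_le_left ha0.le).2 hya.le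
    rw [zero_pow two_ne_zero, add_zero]
    exact cutoffId_of_le ha0 (Real.sqrt_nonneg _) h1
  have h0r : (0 : Fin n → ℝ) ∈ Metric.ball (0 : Fin n → ℝ) r := Metric.mem_ball_self hr
  have hF00 : F 0 0 = 0 := by
    rw [hF0 0 h0r (by rw [hφ0]; positivity), hφ0, Real.sqrt_zero]
  have hcut : ∀ t, a ≤ t → a ≤ cutoffId a t := fun t ht => by
    have := monotone_cutoffId a ht
    rwa [cutoffId_of_le ha0 ha0.le le_rfl] at this
  refine ⟨a, ha0, fun y hy hya => le_antisymm ?_ ?_, fun x hx hlt => ?_, fun x hx y hy hxa hya => ?_⟩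
  · obtain ⟨γ, hγ, hγ0, hγ1, hγt⟩ := hpath y (hbr hy)
    exact riemDist_le_of_const_speed hγ hγ0 hγ1 hγt
  · have := hcal0 0 y
    rwa [hF00, sub_zero, hF0 y hy hya] at this
  · have h := (hcal0 0 x).trans_lt hlt
    rw [hF00, sub_zero, ENNReal.ofReal_lt_ofReal_iff ha0] at h
    -- Outside the ball `F 0` equals `cutoffId a (2 * a)`, which is at least a, against `F 0 x < a`.
    have hxr : x ∈ Metric.ball (0 : Fin n → ℝ) r := by
      by_contra hxr
      simp only [hF, if_neg hxr] at h
      exact absurd (hcut (2 * a) (by linarith)) (not_le.2 h)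
    refine ⟨hxr, ?_⟩
    by_contra! hxa
    simp only [hF, if_pos hxr] at h
    rw [zero_pow two_ne_zero, add_zero] at h
    exact absurd (hcut _ (Real.le_sqrt_of_sq_le hxa)) (not_le.2 h)
  · have := hcal0 x y
    rwa [hF0 x hx hxa, hF0 y hy hya] at this

end Calibration

/-! ### Symmetry of the Ricci tensor -/

section RicciSymm

variable {n : ℕ} {V : Set (Fin n → ℝ)} {g : (Fin n → ℝ) → Matrix (Fin n) (Fin n) ℝ}
  {x : Fin n → ℝ}

/-- Two of the three derivative terms cancel by symmetry of g⁻¹. What remains is ½ tr(g⁻¹∂_i g), the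
derivative of log √det g. -/
theorem IsRiemannianMetricOn.sum_christoffel (hg : IsRiemannianMetricOn V g) (hx : x ∈ V)
    (i : Fin n) : ∑ k, christoffel g k i k x
      = 1 / 2 * ∑ k, ∑ l, (g x)⁻¹ k l * partialDeriv i (fun y => g y k l) x := by
  unfold christoffel
  rw [← Finset.mul_sum]
  congr 1
  have : ∑ k, ∑ l, (g x)⁻¹ k l * partialDeriv k (fun y => g y i l) x
      = ∑ k, ∑ l, (g x)⁻¹ k l * partialDeriv l (fun y => g y i k) x := by
    rw [Finset.sum_comm]
    exact Finset.sum_congr rfl fun k _ => Finset.sum_congr rfl fun l _ => by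
      rw [hg.inv_symm hx l k]
  simp_rw [mul_sub, mul_add, Finset.sum_sub_distrib, Finset.sum_add_distrib]
  rw [this]
  ring

theorem IsRiemannianMetricOn.partialDeriv_inv (hV : IsOpen V) (hg : IsRiemannianMetricOn V g)
    (hx : x ∈ V) (j : Fin n) :
    (Matrix.of fun k l => partialDeriv j (fun y => (g y)⁻¹ k l) x)
      = -((g x)⁻¹ * (Matrix.of fun k l => partialDeriv j (fun y => g y k l) x) * (g x)⁻¹) := by
  have hgd := hg.differentiableAt hV hx
  have hid : ∀ k l, DifferentiableAt ℝ (fun y => (g y)⁻¹ k l) x := fun k l =>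
    ((hg.contDiffOn_inv k l).contDiffAt (hV.mem_nhds hx)).differentiableAt (by simp)
  have hu : IsUnit (g x).det := isUnit_iff_ne_zero.2 (hg.det_ne_zero hx)
  set D := Matrix.of fun k l => partialDeriv j (fun y => (g y)⁻¹ k l) x with hD
  set A := Matrix.of fun k l => partialDeriv j (fun y => g y k l) x with hA
  have h : A * (g x)⁻¹ + g x * D = 0 := by
    ext a b
    rw [Matrix.add_apply, Matrix.mul_apply, Matrix.mul_apply, ← Finset.sum_add_distrib,
      Matrix.zero_apply]
    have h1 : partialDeriv j (fun y => ∑ k, g y a k * (g y)⁻¹ k b) x = 0 := by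
      rw [partialDeriv_congr (G := fun _ => if a = b then (1 : ℝ) else 0)]
      · simp [partialDeriv]
      · filter_upwards [hV.mem_nhds hx] with y hy using hg.sum_mul_inv hy a b
    rw [partialDeriv_sum (fun k _ => (hgd a k).fun_mul (hid k b))] at h1
    rw [← h1]
    exact Finset.sum_congr rfl fun k _ => (partialDeriv_mul (hgd a k) (hid k b) j).symm
  have h2 : (g x)⁻¹ * (A * (g x)⁻¹ + g x * D) = 0 := by rw [h, Matrix.mul_zero]
  rw [Matrix.mul_add, ← Matrix.mul_assoc, ← Matrix.mul_assoc, Matrix.nonsing_inv_mul _ hu,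
    Matrix.one_mul] at h2
  exact (neg_eq_of_add_eq_zero_right h2).symm

/-- Both sides are the mixed second derivative of log √det g. Explicitly, the derivative of ½
tr(g⁻¹∂_i g) is symmetric in i, j by cyclicity of the trace and commuting partial derivatives. -/
theorem IsRiemannianMetricOn.partialDeriv_sum_christoffel_symm (hV : IsOpen V)
    (hg : IsRiemannianMetricOn V g) (hx : x ∈ V) (i j : Fin n) :
    ∑ k, partialDeriv j (christoffel g k i k) x = ∑ k, partialDeriv i (christoffel g k j k) x := by
  have hid : ∀ k l, DifferentiableAt ℝ (fun y => (g y)⁻¹ k l) x := fun k l =>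
    ((hg.contDiffOn_inv k l).contDiffAt (hV.mem_nhds hx)).differentiableAt (by simp)
  have hC : ∀ k l, ContDiffAt ℝ 2 (fun y => g y k l) x := fun k l =>
    ((hg.smooth k l).contDiffAt (hV.mem_nhds hx)).of_le (WithTop.coe_le_coe.2 (le_top : (2 : ℕ∞) ≤ ⊤))
  have hpd : ∀ i k l, DifferentiableAt ℝ (partialDeriv i (fun y => g y k l)) x := fun i k l =>
    differentiableAt_partialDeriv (hC k l) i
  have hΓd : ∀ k i j, DifferentiableAt ℝ (christoffel g k i j) x := fun k i j =>
    ((hg.contDiffOn_christoffel hV k i j).contDiffAt (hV.mem_nhds hx)).differentiableAt (by simp)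
  set A : Fin n → Matrix (Fin n) (Fin n) ℝ := fun i =>
    Matrix.of fun k l => partialDeriv i (fun y => g y k l) x with hA
  have key : ∀ i j, ∑ k, partialDeriv j (christoffel g k i k) x
      = 1 / 2 * (-((g x)⁻¹ * A j * (g x)⁻¹ * A i).trace
        + ∑ k, ∑ l, (g x)⁻¹ k l * partialDeriv j (partialDeriv i (fun y => g y k l)) x) := by
    intro i j
    rw [← partialDeriv_sum (fun k _ => hΓd k i k)]
    rw [partialDeriv_congr (G := fun y => ∑ k, ∑ l, (g y)⁻¹ k l *
      ((1 / 2) * partialDeriv i (fun y => g y k l) y))]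
    · have hd : ∀ k l, DifferentiableAt ℝ (fun y => (g y)⁻¹ k l *
          ((1 / 2) * partialDeriv i (fun y => g y k l) y)) x := fun k l =>
        (hid k l).fun_mul ((hpd i k l).const_mul _)
      rw [partialDeriv_sum (fun k _ => DifferentiableAt.fun_sum fun l _ => hd k l)]
      simp_rw [partialDeriv_sum (fun l _ => hd _ l)]
      have hm : ∀ k l, partialDeriv j (fun y => (g y)⁻¹ k l *
          ((1 / 2) * partialDeriv i (fun y => g y k l) y)) x
          = 1 / 2 * (partialDeriv j (fun y => (g y)⁻¹ k l) x * A i l k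
            + (g x)⁻¹ k l * partialDeriv j (partialDeriv i (fun y => g y k l)) x) := by
        intro k l
        rw [partialDeriv_mul (hid k l) ((hpd i k l).const_mul _)]
        have h1 : partialDeriv j (fun y => (1 / 2) * partialDeriv i (fun y => g y k l) y) x
            = (1 / 2) * partialDeriv j (partialDeriv i (fun y => g y k l)) x := by
          have := partialDeriv_mul (differentiableAt_const (1 / 2 : ℝ)) (hpd i k l) j
          rw [this]
          simp [partialDeriv]
        have h2 : A i l k = partialDeriv i (fun y => g y k l) x := by
          simp only [hA, Matrix.of_apply]
          refine partialDeriv_congr ?_ i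
          filter_upwards [hV.mem_nhds hx] with y hy using hg.symm hy l k
        rw [h1, h2]; ring
      simp_rw [hm, ← Finset.mul_sum, Finset.sum_add_distrib]
      congr 2
      have : ((Matrix.of fun k l => partialDeriv j (fun y => (g y)⁻¹ k l) x) * A i).trace
          = ∑ k, ∑ l, partialDeriv j (fun y => (g y)⁻¹ k l) x * A i l k := by
        simp only [Matrix.trace, Matrix.diag_apply, Matrix.mul_apply, Matrix.of_apply]
      rw [← this, hg.partialDeriv_inv hV hx, Matrix.neg_mul, Matrix.trace_neg]
    · filter_upwards [hV.mem_nhds hx] with y hy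
      rw [hg.sum_christoffel hy, Finset.mul_sum]
      simp_rw [Finset.mul_sum]
      exact Finset.sum_congr rfl fun k _ => Finset.sum_congr rfl fun l _ => by ring
  rw [key i j, key j i]
  congr 2
  · rw [Matrix.mul_assoc, Matrix.trace_mul_comm]
    simp only [Matrix.mul_assoc]
  · exact Finset.sum_congr rfl fun k _ => Finset.sum_congr rfl fun l _ => by
      rw [partialDeriv_comm (hC k l)]

/-- The only term whose symmetry is not immediate from that of the Christoffel symbols is
∂_jΓ^k_{ik}. Symmetry is needed so that the spectral theorem applies to the conformal Schouten
tensor. -/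
theorem IsRiemannianMetricOn.ricci_symm (hV : IsOpen V) (hg : IsRiemannianMetricOn V g)
    (hx : x ∈ V) (i j : Fin n) : ricci g x i j = ricci g x j i := by
  have hsy : ∀ k i j, christoffel g k i j =ᶠ[𝓝 x] christoffel g k j i := fun k i j => by
    filter_upwards [hV.mem_nhds hx] with y hy using hg.christoffel_symm hV hy k i j
  simp only [ricci, Matrix.of_apply, Finset.sum_sub_distrib]
  rw [hg.partialDeriv_sum_christoffel_symm hV hx i j]
  congr 1
  · congr 1
    exact Finset.sum_congr rfl fun k _ => partialDeriv_congr (hsy k i j) k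
  · congr 1
    · exact Finset.sum_congr rfl fun k _ => Finset.sum_congr rfl fun l _ => by
        rw [hg.christoffel_symm hV hx l i j]
    · rw [Finset.sum_comm]
      exact Finset.sum_congr rfl fun k _ => Finset.sum_congr rfl fun l _ => by ring

theorem IsRiemannianMetricOn.schouten_symm (hV : IsOpen V) (hg : IsRiemannianMetricOn V g)
    (hx : x ∈ V) (i j : Fin n) : schouten g x i j = schouten g x j i := by
  simp only [schouten, Matrix.smul_apply, Matrix.sub_apply, smul_eq_mul, hg.ricci_symm hV hx i j,
    hg.symm hx i j]

theorem IsRiemannianMetricOn.covHessian_symm (hV : IsOpen V) (hg : IsRiemannianMetricOn V g)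
    (hx : x ∈ V) {w : (Fin n → ℝ) → ℝ} (hw : ContDiffAt ℝ 2 w x) (i j : Fin n) :
    covHessian g w x i j = covHessian g w x j i := by
  simp only [covHessian, Matrix.of_apply, partialDeriv_comm hw i j]
  simp_rw [fun l => hg.christoffel_symm hV hx l i j]

end RicciSymm

/-! ### Quadratic forms near the origin -/

section QuadraticForms

variable {n : ℕ} {Ω : Set (Fin n → ℝ)} {g : (Fin n → ℝ) → Matrix (Fin n) (Fin n) ℝ}

open Matrix in
-- Cauchy-Schwarz against a basis vector gives v_i² ≤ g^{ii} g(v,v). The resulting constant is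
-- crude, but it depends continuously on B and g and vanishes with B.
theorem Matrix.PosDef.abs_dotProduct_mulVec_le {g : Matrix (Fin n) (Fin n) ℝ} (hg : g.PosDef)
    (B : Matrix (Fin n) (Fin n) ℝ) (v : Fin n → ℝ) :
    |v ⬝ᵥ B *ᵥ v| ≤ ((∑ i, ∑ j, |B i j|) * ∑ i, g⁻¹ i i) * (v ⬝ᵥ g *ᵥ v) := by
  have hq : 0 ≤ v ⬝ᵥ g *ᵥ v := by simpa using hg.posSemidef.dotProduct_mulVec_nonneg v
  have hdiag : ∀ i, 0 ≤ g⁻¹ i i := fun i => hg.inv.diag_pos.le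
  have hcoord : ∀ i, v i ^ 2 ≤ (∑ i, g⁻¹ i i) * (v ⬝ᵥ g *ᵥ v) := by
    intro i
    have h := hg.dotProduct_sq_le (Pi.single i 1) v
    have e1 : Pi.single i 1 ⬝ᵥ v = v i := by simp
    have e2 : Pi.single i (1 : ℝ) ⬝ᵥ g⁻¹ *ᵥ Pi.single i 1 = g⁻¹ i i := by simp
    rw [e1, e2] at h
    exact h.trans (mul_le_mul_of_nonneg_right
      (Finset.single_le_sum (fun i _ => hdiag i) (Finset.mem_univ i)) hq)
  have hprod : ∀ i j, |v i * v j| ≤ (∑ i, g⁻¹ i i) * (v ⬝ᵥ g *ᵥ v) := by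
    intro i j
    rw [abs_le]
    constructor <;> nlinarith [hcoord i, hcoord j, sq_nonneg (v i + v j), sq_nonneg (v i - v j)]
  rw [← sum_sum_eq_dotProduct_mulVec B v, mul_assoc, Finset.sum_mul]
  refine (Finset.abs_sum_le_sum_abs _ _).trans (Finset.sum_le_sum fun i _ => ?_)
  rw [Finset.sum_mul]
  refine (Finset.abs_sum_le_sum_abs _ _).trans (Finset.sum_le_sum fun j _ => ?_)
  rw [mul_assoc, abs_mul]
  exact mul_le_mul_of_nonneg_left (hprod i j) (abs_nonneg _)

open Matrix in
theorem eventually_abs_dotProduct_mulVec_le (hΩ : IsOpen Ω) (hg : IsRiemannianMetricOn Ω g)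
    {x₀ : Fin n → ℝ} (h0 : x₀ ∈ Ω) {B : (Fin n → ℝ) → Matrix (Fin n) (Fin n) ℝ}
    (hB : ∀ i j, ContinuousAt (fun x => B x i j) x₀) {η : ℝ}
    (hη : (∑ i, ∑ j, |B x₀ i j|) * ∑ i, (g x₀)⁻¹ i i < η) :
    ∀ᶠ x in 𝓝 x₀, ∀ v, |v ⬝ᵥ B x *ᵥ v| ≤ η * (v ⬝ᵥ g x *ᵥ v) := by
  have hc : ContinuousAt (fun x => (∑ i, ∑ j, |B x i j|) * ∑ i, (g x)⁻¹ i i) x₀ := by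
    refine ContinuousAt.mul ?_ ?_
    · exact tendsto_finsetSum _ fun i _ => tendsto_finsetSum _ fun j _ => (hB i j).abs
    · exact tendsto_finsetSum _ fun i _ =>
        ((hg.contDiffOn_inv i i).continuousOn.continuousAt (hΩ.mem_nhds h0))
  filter_upwards [hc.eventually_lt_const hη, hΩ.mem_nhds h0] with x hx hxΩ v
  have hq : 0 ≤ v ⬝ᵥ g x *ᵥ v := by
    simpa using (hg.posDef x hxΩ).posSemidef.dotProduct_mulVec_nonneg v
  exact ((hg.posDef x hxΩ).abs_dotProduct_mulVec_le (B x) v).trans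
    (mul_le_mul_of_nonneg_right hx.le hq)

end QuadraticForms

/-! ### The Hessian of a function of `φ` -/

section Composition

variable {n : ℕ} {g : (Fin n → ℝ) → Matrix (Fin n) (Fin n) ℝ} {φ w : (Fin n → ℝ) → ℝ}
  {x : Fin n → ℝ} {ψ ψ₁ : ℝ → ℝ} {ψ₂ : ℝ}

theorem partialDeriv_comp_eventually (hφ : ContDiffAt ℝ 2 φ x) (hw : w =ᶠ[𝓝 x] fun y => ψ (φ y))
    (hψ : ∀ᶠ t in 𝓝 (φ x), HasDerivAt ψ (ψ₁ t) t) (i : Fin n) :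
    partialDeriv i w =ᶠ[𝓝 x] fun y => ψ₁ (φ y) * partialDeriv i φ y := by
  filter_upwards [hw.eventuallyEq_nhds, hφ.continuousAt.eventually hψ, hφ.eventually (by simp)]
    with y hy hyψ hyφ
  rw [partialDeriv_congr hy, partialDeriv_comp hyψ (hyφ.differentiableAt (by norm_num))]

theorem covHessian_comp (hφ : ContDiffAt ℝ 2 φ x) (hw : w =ᶠ[𝓝 x] fun y => ψ (φ y))
    (hψ : ∀ᶠ t in 𝓝 (φ x), HasDerivAt ψ (ψ₁ t) t) (hψ₁ : HasDerivAt ψ₁ ψ₂ (φ x)) (i j : Fin n) :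
    covHessian g w x i j = ψ₂ * (partialDeriv i φ x * partialDeriv j φ x)
      + ψ₁ (φ x) * covHessian g φ x i j := by
  have h1 := fun i => partialDeriv_comp_eventually hφ hw hψ i
  have hd := hφ.differentiableAt (by norm_num : (2 : WithTop ℕ∞) ≠ 0)
  simp only [covHessian, Matrix.of_apply]
  rw [partialDeriv_congr (h1 j), partialDeriv_mul (F := fun y => ψ₁ (φ y))
    (hψ₁.differentiableAt.comp x hd) (differentiableAt_partialDeriv hφ j),
    partialDeriv_comp hψ₁ hd]
  simp_rw [fun l => (h1 l).self_of_nhds]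
  have : ∑ l, christoffel g l i j x * (ψ₁ (φ x) * partialDeriv l φ x)
      = ψ₁ (φ x) * ∑ l, christoffel g l i j x * partialDeriv l φ x := by
    rw [Finset.mul_sum]; exact Finset.sum_congr rfl fun l _ => by ring
  rw [this]; ring

theorem gradSq_comp (hφ : ContDiffAt ℝ 2 φ x) (hw : w =ᶠ[𝓝 x] fun y => ψ (φ y))
    (hψ : ∀ᶠ t in 𝓝 (φ x), HasDerivAt ψ (ψ₁ t) t) :
    gradSq g w x = ψ₁ (φ x) ^ 2 * gradSq g φ x := by
  have h1 := fun i => (partialDeriv_comp_eventually hφ hw hψ i).self_of_nhds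
  simp only [gradSq, gradComp, h1, Finset.mul_sum]
  exact Finset.sum_congr rfl fun i _ => Finset.sum_congr rfl fun l _ => by ring

end Composition

/-! ### The radial logarithmic profile -/

theorem hasDerivAt_logProfile {κ m rp Δ t : ℝ} (hΔ : 0 < Δ) (ht : 0 < t) (htr : Real.sqrt t < rp) :
    HasDerivAt (fun t => κ * Real.log ((rp - Real.sqrt t) / Δ) + m)
      (-κ / (2 * (Real.sqrt t * (rp - Real.sqrt t)))) t := by
  have hr : 0 < Real.sqrt t := Real.sqrt_pos.2 ht
  have hs : 0 < rp - Real.sqrt t := by linarith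
  have h1 : HasDerivAt (fun t => (rp - Real.sqrt t) / Δ) (-(1 / (2 * Real.sqrt t)) / Δ) t :=
    ((Real.hasDerivAt_sqrt ht.ne').const_sub rp).div_const Δ
  have h2 := ((h1.log (div_pos hs hΔ).ne').const_mul κ).add_const m
  refine h2.congr_deriv ?_
  field_simp

theorem hasDerivAt_logProfile_deriv {κ rp t : ℝ} (ht : 0 < t) (htr : Real.sqrt t < rp) :
    HasDerivAt (fun t => -κ / (2 * (Real.sqrt t * (rp - Real.sqrt t))))
      (κ * (rp - Real.sqrt t - Real.sqrt t) /
        (4 * Real.sqrt t ^ 3 * (rp - Real.sqrt t) ^ 2)) t := by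
  have hr : 0 < Real.sqrt t := Real.sqrt_pos.2 ht
  have hs : 0 < rp - Real.sqrt t := by linarith
  have hq := Real.hasDerivAt_sqrt ht.ne'
  have h1 := (hq.mul (hq.const_sub rp)).const_mul 2
  have h2 := h1.inv (by simp only [Pi.mul_apply]; positivity)
  have h3 := h2.const_mul (-κ)
  refine (h3.congr_deriv ?_).congr_of_eventuallyEq (Eventually.of_forall fun s => ?_)
  · simp only [Pi.mul_apply]
    field_simp
    ring
  · simp [div_eq_mul_inv]

theorem contDiffAt_logProfile {κ m rp Δ t : ℝ} (hΔ : 0 < Δ) (ht : 0 < t)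
    (htr : Real.sqrt t < rp) :
    ContDiffAt ℝ 2 (fun t => κ * Real.log ((rp - Real.sqrt t) / Δ) + m) t := by
  have hs : 0 < (rp - Real.sqrt t) / Δ := div_pos (by linarith) hΔ
  have h1 : ContDiffAt ℝ 2 (fun t => (rp - Real.sqrt t) / Δ) t :=
    (contDiffAt_const.sub (Real.contDiffAt_sqrt ht.ne')).div_const Δ
  exact (contDiffAt_const.mul (h1.log hs.ne')).add contDiffAt_const

open Matrix in
theorem dotProduct_radialForm_mulVec {n : ℕ} (a v : Fin n → ℝ) (B g A : Matrix (Fin n) (Fin n) ℝ)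
    (c₁ c₂ c₃ : ℝ) :
    v ⬝ᵥ (Matrix.of fun i j => (c₂ * (a i * a j) + c₁ * B i j) - (c₁ * a i) * (c₁ * a j)
        + c₃ * g i j - A i j) *ᵥ v
      = (c₂ - c₁ ^ 2) * (a ⬝ᵥ v) ^ 2 + c₁ * (v ⬝ᵥ B *ᵥ v) + c₃ * (v ⬝ᵥ g *ᵥ v)
        - v ⬝ᵥ A *ᵥ v := by
  have e : (a ⬝ᵥ v) ^ 2 = ∑ i, ∑ j, a i * v i * (a j * v j) := by
    rw [pow_two, dotProduct, Finset.sum_mul_sum]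
  rw [e, ← sum_sum_eq_dotProduct_mulVec, ← sum_sum_eq_dotProduct_mulVec B,
    ← sum_sum_eq_dotProduct_mulVec g, ← sum_sum_eq_dotProduct_mulVec A]
  simp only [Finset.mul_sum, ← Finset.sum_add_distrib, ← Finset.sum_sub_distrib, Matrix.of_apply]
  exact Finset.sum_congr rfl fun i _ => Finset.sum_congr rfl fun j _ => by ring

/-- Dictionary: L = dr(v)², D = dφ(v), q = g(v,v), B = ∇²φ(v,v), A = A_g(v,v), and the fractions are
the first two derivatives of the profile as a function of t = r². The first derivative is negative,
so the upper bound on the Hessian is the one that matters. -/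
theorem radial_lower_bound {κ r s η K q L D B A : ℝ} (hκ : 0 ≤ κ) (hr : 0 < r) (hs : 0 < s)
    (hD : D ^ 2 = 4 * r ^ 2 * L) (hB : B ≤ 2 * (1 + η) * q) (hA : A ≤ K * q) :
    s⁻¹ ^ 2 * ((κ * (s / r) - κ - κ ^ 2) * L
        + (κ ^ 2 / 2 - κ * (1 + η) * (s / r) - K * s ^ 2) * q)
      ≤ (κ * (s - r) / (4 * r ^ 3 * s ^ 2) - (-κ / (2 * (r * s))) ^ 2) * D ^ 2
        + -κ / (2 * (r * s)) * B
        + 1 / 2 * ((-κ / (2 * (r * s))) ^ 2 * (4 * r ^ 2)) * q - A := by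
  have h1 : κ / (2 * (r * s)) * B ≤ κ / (2 * (r * s)) * (2 * (1 + η) * q) :=
    mul_le_mul_of_nonneg_left hB (by positivity)
  have e : (κ * (s - r) / (4 * r ^ 3 * s ^ 2) - (-κ / (2 * (r * s))) ^ 2) * (4 * r ^ 2 * L)
        + -κ / (2 * (r * s)) * (2 * (1 + η) * q)
        + 1 / 2 * ((-κ / (2 * (r * s))) ^ 2 * (4 * r ^ 2)) * q - K * q
      = s⁻¹ ^ 2 * ((κ * (s / r) - κ - κ ^ 2) * L
        + (κ ^ 2 / 2 - κ * (1 + η) * (s / r) - K * s ^ 2) * q) := by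
    field_simp
    ring
  rw [← e, hD]
  have e2 : -κ / (2 * (r * s)) * B = -(κ / (2 * (r * s)) * B) := by ring
  have e3 : -κ / (2 * (r * s)) * (2 * (1 + η) * q)
      = -(κ / (2 * (r * s)) * (2 * (1 + η) * q)) := by ring
  rw [e2, e3]
  linarith

open Matrix in
/-- The eigenvalue estimate at a point, for `w = κ ln ((r₊ - √φ) / Δ) + m`. -/
theorem exists_eigenvalueVector_radial {n : ℕ} (hn : 3 ≤ n) {Γ : Set (Fin n → ℝ)}
    (hΓ : IsAdmissibleCone Γ) {f : (Fin n → ℝ) → ℝ} (hf : IsAdmissibleFunction Γ f)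
    {μ : ℝ} (hμ : IsMuPlus Γ μ) (hμ1 : 1 < μ) {V : Set (Fin n → ℝ)} (hV : IsOpen V)
    {g : (Fin n → ℝ) → Matrix (Fin n) (Fin n) ℝ} (hg : IsRiemannianMetricOn V g)
    {x : Fin n → ℝ} (hx : x ∈ V) {φ w : (Fin n → ℝ) → ℝ} (hφ : ContDiffAt ℝ 2 φ x)
    (hφpos : 0 < φ x) (hgrad : gradSq g φ x = 4 * φ x) {κ m rp Δ η K T δ : ℝ} (hκ : 0 ≤ κ)
    (hΔ : 0 < Δ) (hrp : Real.sqrt (φ x) < rp)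
    (hw : w =ᶠ[𝓝 x] fun y => κ * Real.log ((rp - Real.sqrt (φ y)) / Δ) + m)
    (hH : ∀ v, |v ⬝ᵥ (covHessian g φ x - (2 : ℝ) • g x) *ᵥ v| ≤ 2 * η * (v ⬝ᵥ g x *ᵥ v))
    (hA : ∀ v, |v ⬝ᵥ schouten g x *ᵥ v| ≤ K * (v ⬝ᵥ g x *ᵥ v))
    (hTeq : T = κ ^ 2 / 2 - κ * (1 + η) * ((rp - Real.sqrt (φ x)) / Real.sqrt (φ x))
      - K * (rp - Real.sqrt (φ x)) ^ 2) (hT : 0 < T) (hδ : 0 < δ) (hδμ : δ ≤ μ + 1)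
    (hN : κ + κ ^ 2 - κ * ((rp - Real.sqrt (φ x)) / Real.sqrt (φ x)) - T ≤ (μ - δ) * T) :
    ∃ l : Fin n → ℝ, IsEigenvalueVector (negSchoutenEndo (conformalMetric w g) x) l ∧ l ∈ Γ ∧
      Real.exp (-(2 * w x)) * (rp - Real.sqrt (φ x))⁻¹ ^ 2 * T * f (firstThenOnes n (-μ + δ))
        ≤ f l := by
  set r := Real.sqrt (φ x) with hr
  have hr0 : 0 < r := Real.sqrt_pos.2 hφpos
  have hr2 : r ^ 2 = φ x := Real.sq_sqrt hφpos.le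
  have hs0 : 0 < rp - r := by linarith
  have hcψ : ContDiffAt ℝ 2 (fun y => κ * Real.log ((rp - Real.sqrt (φ y)) / Δ) + m) x :=
    (contDiffAt_logProfile (κ := κ) (m := m) hΔ hφpos hrp).comp x hφ
  have hwc : ContDiffAt ℝ 2 w x := hcψ.congr_of_eventuallyEq hw
  have hψ : ∀ᶠ t in 𝓝 (φ x), HasDerivAt (fun t => κ * Real.log ((rp - Real.sqrt t) / Δ) + m)
      (-κ / (2 * (Real.sqrt t * (rp - Real.sqrt t)))) t := by
    filter_upwards [lt_mem_nhds hφpos, Real.continuous_sqrt.continuousAt.eventually_lt_const hrp]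
      with t ht ht2 using hasDerivAt_logProfile hΔ ht ht2
  have hψ₁ := hasDerivAt_logProfile_deriv (κ := κ) hφpos hrp
  have hcov := covHessian_comp (g := g) hφ hw hψ hψ₁
  have hp := fun i => (partialDeriv_comp_eventually hφ hw hψ i).self_of_nhds
  have hgs := gradSq_comp (g := g) hφ hw hψ
  simp only [← hr] at hcov hp hgs
  rw [hgrad, ← hr2] at hgs
  rw [negSchoutenEndo_conformal hn hV hg hwc hx]
  have hM : (Matrix.of fun i j => covHessian g w x i j - partialDeriv i w x * partialDeriv j w x
      + 1 / 2 * gradSq g w x * g x i j - schouten g x i j).IsSymm := by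
    ext i j
    simp only [Matrix.transpose_apply, Matrix.of_apply, hg.covHessian_symm hV hx hwc i j,
      hg.symm hx i j, hg.schouten_symm hV hx i j]
    ring
  set M := (Matrix.of fun i j => covHessian g w x i j - partialDeriv i w x * partialDeriv j w x
      + 1 / 2 * gradSq g w x * g x i j - schouten g x i j) with hMdef
  set p : Fin n → ℝ := fun i => partialDeriv i φ x with hpdef
  set τ := Real.exp (-(2 * w x)) with hτ
  have hτ0 : 0 < τ := Real.exp_pos _
  have hℓv : ∀ v : Fin n → ℝ, p ⬝ᵥ v = 2 * r * (((2 * r)⁻¹ • p) ⬝ᵥ v) := by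
    intro v
    rw [smul_dotProduct, smul_eq_mul, ← mul_assoc, mul_inv_cancel₀ (by positivity), one_mul]
  -- ℓ = dφ/(2r) is dr, of unit length by the eikonal equation; the positive factor e^{-2w}s⁻² is
  -- absorbed into the tangential eigenvalue.
  refine exists_eigenvalueVector_mem_and_le hn hΓ hf hμ hμ1 (hg.posDef x hx) (hM.smul τ)
    (ℓ := (2 * r)⁻¹ • p) (T := τ * (rp - r)⁻¹ ^ 2 * T) (by positivity) hδ hδμ ?_ ?_
  · intro v
    have h := (hg.posDef x hx).dotProduct_sq_le p v
    have e : p ⬝ᵥ (g x)⁻¹ *ᵥ p = 4 * r ^ 2 := by rw [hr2, ← hgrad]; rfl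
    rw [e, hℓv, mul_pow] at h
    have h4 : 0 < 4 * r ^ 2 := by positivity
    refine le_of_mul_le_mul_left ?_ h4
    calc _ = (2 * r) ^ 2 * (((2 * r)⁻¹ • p) ⬝ᵥ v) ^ 2 := by ring
      _ ≤ _ := h
  · intro v
    have hMeq : M = Matrix.of fun i j =>
          (κ * (rp - r - r) / (4 * r ^ 3 * (rp - r) ^ 2) * (p i * p j)
          + -κ / (2 * (r * (rp - r))) * covHessian g φ x i j)
          - (-κ / (2 * (r * (rp - r))) * p i) * (-κ / (2 * (r * (rp - r))) * p j)
          + (1 / 2 * ((-κ / (2 * (r * (rp - r)))) ^ 2 * (4 * r ^ 2))) * g x i j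
          - schouten g x i j := by
      ext i j
      rw [hMdef, Matrix.of_apply, Matrix.of_apply, hcov, hp, hp, hgs]
    have hMv := (congrArg (fun N => v ⬝ᵥ N *ᵥ v) hMeq).trans
      (dotProduct_radialForm_mulVec _ _ _ _ _ _ _ _)
    set q := v ⬝ᵥ g x *ᵥ v with hq
    set L := (((2 * r)⁻¹ • p) ⬝ᵥ v) ^ 2 with hL
    have hq0 : 0 ≤ q := by simpa using (hg.posDef x hx).posSemidef.dotProduct_mulVec_nonneg v
    have hD : (p ⬝ᵥ v) ^ 2 = 4 * r ^ 2 * L := by rw [hℓv, hL]; ring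
    have hB : v ⬝ᵥ covHessian g φ x *ᵥ v ≤ 2 * (1 + η) * q := by
      have h := (abs_le.1 (hH v)).2
      rw [Matrix.sub_mulVec, dotProduct_sub, Matrix.smul_mulVec, dotProduct_smul,
        smul_eq_mul] at h
      linarith
    have hAv := (abs_le.1 (hA v)).2
    have key := radial_lower_bound (κ := κ) hκ hr0 hs0 hD hB hAv
    rw [← hMv, ← hTeq] at key
    have hlow : (rp - r)⁻¹ ^ 2 * (T * (q - L) - (μ - δ) * T * L) ≤ v ⬝ᵥ M *ᵥ v := by
      refine le_trans (mul_le_mul_of_nonneg_left ?_ (by positivity)) key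
      have hL0 : 0 ≤ L := sq_nonneg _
      nlinarith [mul_le_mul_of_nonneg_right hN hL0]
    rw [Matrix.smul_mulVec, dotProduct_smul, smul_eq_mul]
    calc _ = τ * ((rp - r)⁻¹ ^ 2 * (T * (q - L) - (μ - δ) * T * L)) := by ring
      _ ≤ _ := mul_le_mul_of_nonneg_left hlow hτ0.le

/-! ### Choice of the constants -/

/-- After multiplication by β the claim has a margin κ² - βκ = κε. Its costs are (β+2)κθ ≤ κε/2 for
the width of the annulus, 2(β+1)e ≤ κε/4 for the errors, and (ε/(2κ))T ≤ κε/4 for the retained δ =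
ε/(2βκ), which together use exactly the margin. -/
theorem radial_coefficient_bounds {μ β ε κ η K θ s e T : ℝ} (hμ : μ * β = β + 2) (hβ : 0 < β)
    (hε : 0 < ε) (hκ : κ = β + ε) (hη : 0 ≤ η) (hK : 0 ≤ K) (hθ0 : 0 ≤ θ)
    (hθ : θ * (2 * (β + 2)) ≤ ε) (he : κ * η * θ + K * s ^ 2 ≤ e)
    (he₁ : e * (8 * (β + 1)) ≤ κ * ε) (he₂ : e ≤ κ * β / 4)
    (hT : T = κ ^ 2 / 2 - κ * (1 + η) * θ - K * s ^ 2) :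
    κ * β / 4 ≤ T ∧ κ + κ ^ 2 - κ * θ - T ≤ (μ - ε / (2 * β * κ)) * T := by
  have hκ0 : 0 < κ := by rw [hκ]; positivity
  have hTge : κ ^ 2 / 2 - κ * θ - e ≤ T := by rw [hT]; linarith
  have hTle : T ≤ κ ^ 2 / 2 := by
    have h1 : 0 ≤ κ * (1 + η) * θ := by positivity
    have h2 : 0 ≤ K * s ^ 2 := by positivity
    linarith
  have hθ4 : θ ≤ ε / 4 := by nlinarith [mul_nonneg hθ0 hβ.le]
  have hκθ : κ * θ ≤ κ * (ε / 4) := mul_le_mul_of_nonneg_left hθ4 hκ0.le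
  have hκ2 : κ ^ 2 = κ * β + κ * ε := by rw [pow_two]; nth_rw 2 [hκ]; ring
  have hε' := mul_pos hκ0 hε
  refine ⟨by nlinarith, ?_⟩
  refine le_of_mul_le_mul_left ?_ hβ
  have e1 : β * ((μ - ε / (2 * β * κ)) * T) = (β + 2) * T - ε / (2 * κ) * T := by
    rw [← hμ]; field_simp
  have h2 : ε / (2 * κ) * T ≤ κ * ε / 4 := by
    calc _ ≤ ε / (2 * κ) * (κ ^ 2 / 2) := mul_le_mul_of_nonneg_left hTle (by positivity)
      _ = _ := by field_simp; ring
  have h3 := mul_le_mul_of_nonneg_left hTge (by positivity : 0 ≤ 2 * (β + 1))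
  have h4 := mul_le_mul_of_nonneg_left hθ hκ0.le
  rw [e1]
  nlinarith

/-- Compares the shift δ = ε/(2βκ) with C⁻¹ε using a C that does not see ε. If δ is larger,
monotonicity and TC ≥ (β²/4)C ≥ 1 suffice. If δ is smaller, concavity loses the factor C/(2βκ), but
T ≥ κβ/4 compensates for κ: the product T·C·C/(2βκ) is at least C²/8 ≥ 1, which is where C ≥ 3 is
used. -/
theorem firstThenOnes_quotient_le {n : ℕ} {Γ : Set (Fin n → ℝ)} (hΓ : IsAdmissibleCone Γ)
    {f : (Fin n → ℝ) → ℝ} (hf : IsAdmissibleFunction Γ f) {μ : ℝ} (hμ : IsMuPlus Γ μ)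
    (hμ1 : 1 < μ) {β ε κ C T : ℝ} (hβ : 0 < β) (hε : 0 < ε) (hκβ : β ≤ κ) (hC3 : 3 ≤ C)
    (hCβ : 4 / β ^ 2 ≤ C) (hT : κ * β / 4 ≤ T) :
    f (firstThenOnes n (-μ + C⁻¹ * ε)) / C
      ≤ T * f (firstThenOnes n (-μ + ε / (2 * β * κ))) := by
  have hC0 : 0 < C := by linarith
  have hκ0 : 0 < κ := by linarith
  have hε1 : 0 < C⁻¹ * ε := by positivity
  have hδ : 0 < ε / (2 * β * κ) := by positivity
  have hF := hf.pos _ (firstThenOnes_mem hΓ hμ hμ1 hε1)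
  have hT0 : 0 < T := lt_of_lt_of_le (by positivity) hT
  rw [div_le_iff₀ hC0]
  rcases le_total (C⁻¹ * ε) (ε / (2 * β * κ)) with h | h
  · have h1 := firstThenOnes_mono hΓ hf hμ hμ1 hε1 h
    have h2 : 1 ≤ T * C := by
      rw [div_le_iff₀ (by positivity)] at hCβ
      have : β ^ 2 / 4 ≤ T := by nlinarith
      nlinarith
    calc _ ≤ T * C * f (firstThenOnes n (-μ + C⁻¹ * ε)) := by nlinarith
      _ ≤ T * C * f (firstThenOnes n (-μ + ε / (2 * β * κ))) := by gcongr
      _ = _ := by ring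
  · have h1 := firstThenOnes_div_mul_le hΓ hf hμ hμ1 hδ h
    have e : ε / (2 * β * κ) / (C⁻¹ * ε) = C / (2 * β * κ) := by field_simp
    rw [e] at h1
    have h2 : 1 ≤ T * C * (C / (2 * β * κ)) := by
      calc (1 : ℝ) ≤ κ * β / 4 * C * (C / (2 * β * κ)) := by
            have : κ * β / 4 * C * (C / (2 * β * κ)) = C ^ 2 / 8 := by field_simp; ring
            rw [this]; nlinarith
        _ ≤ _ := by gcongr
    calc _ ≤ T * C * (C / (2 * β * κ)) * f (firstThenOnes n (-μ + C⁻¹ * ε)) := by nlinarith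
      _ = T * C * (C / (2 * β * κ) * f (firstThenOnes n (-μ + C⁻¹ * ε))) := by ring
      _ ≤ T * C * f (firstThenOnes n (-μ + ε / (2 * β * κ))) := by gcongr
      _ = _ := by ring

theorem conformal_scaling_le {w m s Δ F G C : ℝ} (hC : 0 < C) (hF : 0 ≤ F) (hs : 0 < s)
    (hsΔ : s ≤ Δ) (hw : w ≤ m) (hFG : F / C ≤ G) :
    F / (C * Real.exp (2 * m) * Δ ^ 2) ≤ Real.exp (-(2 * w)) * s⁻¹ ^ 2 * G := by
  have hΔ : 0 < Δ := hs.trans_le hsΔ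
  calc _ = Real.exp (-(2 * m)) * Δ⁻¹ ^ 2 * (F / C) := by
        rw [Real.exp_neg]
        field_simp
    _ ≤ Real.exp (-(2 * w)) * s⁻¹ ^ 2 * (F / C) := by gcongr
    _ ≤ _ := by gcongr

/-! ### Geodesic balls around the origin -/

open Matrix in
/-- A small geodesic ball carries a `C²` function `φ = r²` with almost Euclidean covariant
Hessian. -/
theorem exists_sq_riemDist {n : ℕ} {Ω : Set (Fin n → ℝ)} (hΩ : IsOpen Ω)
    (h0 : (0 : Fin n → ℝ) ∈ Ω) {g : (Fin n → ℝ) → Matrix (Fin n) (Fin n) ℝ}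
    (hg : IsRiemannianMetricOn Ω g) :
    ∃ K : ℝ, 0 ≤ K ∧ ∀ η : ℝ, 0 < η → ∃ (a : ℝ) (φ : (Fin n → ℝ) → ℝ) (U : Set (Fin n → ℝ)),
      0 < a ∧ IsOpen U ∧ U ⊆ Ω ∧ ContDiffOn ℝ 2 φ U ∧
      (∀ x ∈ Ω, riemDist Ω g 0 x < ENNReal.ofReal a → x ∈ U) ∧
      (∀ x ∈ U, riemDist Ω g 0 x = ENNReal.ofReal (Real.sqrt (φ x))) ∧
      (∀ x ∈ U, gradSq g φ x = 4 * φ x) ∧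
      (∀ x ∈ U, ∀ y ∈ U, ENNReal.ofReal (Real.sqrt (φ y) - Real.sqrt (φ x)) ≤ riemDist Ω g x y) ∧
      (∀ x ∈ U, ∀ v, |v ⬝ᵥ (covHessian g φ x - (2 : ℝ) • g x) *ᵥ v|
        ≤ 2 * η * (v ⬝ᵥ g x *ᵥ v)) ∧
      (∀ x ∈ U, ∀ v, |v ⬝ᵥ schouten g x *ᵥ v| ≤ K * (v ⬝ᵥ g x *ᵥ v)) := by
  obtain ⟨δ, φ, hδ, hδΩ, hφ2, hφ0, hφpos, hgrad, hp0, hH0, hpath⟩ :=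
    exists_radial_function hΩ h0 hg
  have hb0 : (0 : Fin n → ℝ) ∈ Metric.ball (0 : Fin n → ℝ) δ := Metric.mem_ball_self hδ
  -- The added 1 makes the bound strict at the origin, hence valid nearby. K is fixed before η; only
  -- the neighbourhood shrinks with η.
  set K := (∑ i, ∑ j, |schouten g 0 i j|) * ∑ i, (g 0)⁻¹ i i + 1 with hK
  have htr : 0 ≤ ∑ i, (g 0)⁻¹ i i :=
    Finset.sum_nonneg fun i _ => ((hg.posDef 0 h0).inv.diag_pos).le
  refine ⟨K, by positivity, fun η hη => ?_⟩
  -- dφ vanishes at the origin, so the Christoffel terms drop out and the covariant Hessian is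
  -- exactly 2g(0).
  have hcov0 : ∀ i j, (covHessian g φ 0 - (2 : ℝ) • g 0) i j = 0 := by
    intro i j
    simp [covHessian, hH0, hp0]
  have hcovc : ∀ i j, ContinuousAt (fun x => (covHessian g φ x - (2 : ℝ) • g x) i j) 0 := by
    intro i j
    have hn : Metric.ball (0 : Fin n → ℝ) δ ∈ 𝓝 0 := Metric.isOpen_ball.mem_nhds hb0
    have hd : ∀ j, ContDiffOn ℝ 1 (partialDeriv j φ) (Metric.ball 0 δ) := fun j =>
      hφ2.partialDeriv Metric.isOpen_ball (by norm_num) j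
    have hdd : ContDiffOn ℝ 0 (partialDeriv i (partialDeriv j φ)) (Metric.ball 0 δ) :=
      (hd j).partialDeriv Metric.isOpen_ball (by norm_num) i
    have h1 := hdd.continuousOn.continuousAt hn
    have h2 := fun j => (hd j).continuousOn.continuousAt hn
    have h3 := fun k => (hg.contDiffOn_christoffel hΩ k i j).continuousOn.continuousAt
      (hΩ.mem_nhds h0)
    have h4 := (hg.smooth i j).continuousOn.continuousAt (hΩ.mem_nhds h0)
    simp only [Matrix.sub_apply, Matrix.smul_apply, covHessian, Matrix.of_apply, smul_eq_mul]
    refine ContinuousAt.sub (ContinuousAt.sub h1 ?_) (continuousAt_const.mul h4)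
    exact tendsto_finsetSum _ fun l _ => (h3 l).mul (h2 l)
  have hev1 := eventually_abs_dotProduct_mulVec_le hΩ hg h0 hcovc (η := 2 * η)
    (by simp only [hcov0, abs_zero, Finset.sum_const_zero, zero_mul]; positivity)
  have hev2 := eventually_abs_dotProduct_mulVec_le hΩ hg h0 (B := fun x => schouten g x)
    (fun i j => (hg.continuousOn_schouten hΩ i j).continuousAt (hΩ.mem_nhds h0)) (η := K)
    (by rw [hK]; linarith)
  obtain ⟨r₀, hr₀, hball⟩ := Metric.eventually_nhds_iff_ball.1 (hev1.and hev2)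
  set r := min r₀ (δ / 2) with hr
  have hr0 : 0 < r := by positivity
  have hrδ : r < δ := lt_of_le_of_lt (min_le_right _ _) (by linarith)
  have hrb : Metric.ball (0 : Fin n → ℝ) r ⊆ Metric.ball 0 δ := Metric.ball_subset_ball hrδ.le
  obtain ⟨a, ha, hd1, hd2, hd3⟩ :=
    riemDist_of_eikonal hg hδΩ hφ2 hφ0 hφpos hgrad hpath hr0 hrδ
  refine ⟨a, φ, Metric.ball 0 r ∩ φ ⁻¹' Iio (a ^ 2), ha, ?_, ?_, ?_, ?_, ?_, ?_, ?_, ?_, ?_⟩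
  · exact (hφ2.continuousOn.mono hrb).isOpen_inter_preimage Metric.isOpen_ball isOpen_Iio
  · exact fun x hx => hδΩ (hrb hx.1)
  · exact hφ2.mono fun x hx => hrb hx.1
  · exact hd2
  · exact fun x hx => hd1 x hx.1 hx.2
  · exact fun x hx => hgrad x (hrb hx.1)
  · exact fun x hx y hy => hd3 x hx.1 y hy.1 hx.2 hy.2
  · exact fun x hx => (hball x (Metric.ball_subset_ball (min_le_left _ _) hx.1)).1
  · exact fun x hx => (hball x (Metric.ball_subset_ball (min_le_left _ _) hx.1)).2

/-! ### The main theorem: constants, eigenvalue bound and boundary behaviour. -/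

theorem proposition3p5 {n : ℕ} (hn : 3 ≤ n)
    (Γ : Set (Fin n → ℝ)) (hΓ : IsAdmissibleCone Γ)
    (f : (Fin n → ℝ) → ℝ) (hf : IsAdmissibleFunction Γ f)
    (μ : ℝ) (hμ : IsMuPlus Γ μ) (hμ_gt : 1 < μ)
    (β : ℝ) (hβ : β = 2 / (μ - 1))
    (Ω : Set (Fin n → ℝ)) (hΩ : IsOpen Ω) (h0 : (0 : Fin n → ℝ) ∈ Ω)
    (g₀ : (Fin n → ℝ) → Matrix (Fin n) (Fin n) ℝ) (hg₀ : IsRiemannianMetricOn Ω g₀) :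
    ∃ C : ℝ, 1 < C ∧ ∀ ε : ℝ, 0 < ε → ∃ R : ℝ, 0 < R ∧ R < 1 ∧
      ∀ m rminus rplus : ℝ, 0 < rminus → 1 < rplus / rminus →
        rplus / rminus < 1 + ε / (2 * (β + 2)) → rplus < R →
        let w := radialLog Ω g₀ (β + ε) m rminus rplus
        let c := f (firstThenOnes n (-μ + C⁻¹ * ε)) /
          (C * Real.exp (2 * m) * (rplus - rminus) ^ 2)
        let A := geodesicAnnulus Ω g₀ rminus rplus
        ContDiffOn ℝ 2 w A ∧
        0 < c ∧
        (∀ x ∈ A, ∃ l : Fin n → ℝ,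
          IsEigenvalueVector (negSchoutenEndo (conformalMetric w g₀) x) l ∧ l ∈ Γ ∧ c ≤ f l) ∧
        (∀ x ∈ geodesicSphere Ω g₀ rminus, w x = m) ∧
        Tendsto w
          (comap (fun x => riemDistToSet Ω g₀ x (geodesicSphere Ω g₀ rplus)) (𝓝 0) ⊓ 𝓟 A)
          atBot := by
  have hμ0 : 0 < μ - 1 := by linarith
  have hβ0 : 0 < β := by rw [hβ]; positivity
  have hμβ : μ * β = β + 2 := by rw [hβ]; field_simp; ring
  obtain ⟨K, hK, hloc⟩ := exists_sq_riemDist hΩ h0 hg₀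
  have hC4 : 0 < 4 / β ^ 2 := by positivity
  -- The two summands serve the two cases of `firstThenOnes_quotient_le`.
  obtain ⟨C, hC⟩ : ∃ C, C = 3 + 4 / β ^ 2 := ⟨_, rfl⟩
  have hC3 : 3 ≤ C := by linarith
  refine ⟨C, by linarith, fun ε hε => ?_⟩
  obtain ⟨κ, hκ⟩ : ∃ κ, κ = β + ε := ⟨_, rfl⟩
  have hκ0 : 0 < κ := by rw [hκ]; positivity
  obtain ⟨σ, hσ⟩ : ∃ σ, σ = ε / (2 * (β + 2)) := ⟨_, rfl⟩
  have hσ0 : 0 < σ := by rw [hσ]; positivity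
  -- Total error allowed: the first entry protects the radial inequality, the second the lower bound
  -- on T.
  obtain ⟨e, he⟩ : ∃ e, e = min (κ * ε / (8 * (β + 1))) (κ * β / 4) := ⟨_, rfl⟩
  have he0 : 0 < e := by rw [he]; positivity
  have he₁ : e * (8 * (β + 1)) ≤ κ * ε := by
    rw [← le_div_iff₀ (by positivity), he]; exact min_le_left _ _
  have he₂ : e ≤ κ * β / 4 := by rw [he]; exact min_le_right _ _
  -- Since θ ≤ σ, the Hessian error κηθ is at most e/2; the Schouten term gets the other half.
  obtain ⟨η, hη⟩ : ∃ η, η = e / (2 * κ * σ) := ⟨_, rfl⟩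
  have hη0 : 0 < η := by rw [hη]; positivity
  obtain ⟨a, φ, U, ha, hUo, hUΩ, hφ2, hdU, hdist, hgrad, hdist2, hHess, hSch⟩ := hloc η hη0
  -- The entries give R < 1, keep the annulus inside the good geodesic ball, and make K s² ≤ K r₊ ≤
  -- e/2 (as s ≤ 1).
  refine ⟨min (1 / 2) (min a (e / (2 * (K + 1)))), by positivity,
    lt_of_le_of_lt (min_le_left _ _) (by norm_num), ?_⟩
  intro m rm rp hrm hrat hrat2 hrpR w c A
  rw [one_lt_div hrm] at hrat
  have hrp0 : 0 < rp := hrm.trans hrat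
  have hrp1 : rp < 1 := hrpR.trans_le ((min_le_left _ _).trans (by norm_num))
  have hrpa : rp < a := hrpR.trans_le ((min_le_right _ _).trans (min_le_left _ _))
  have hrpe : rp < e / (2 * (K + 1)) :=
    hrpR.trans_le ((min_le_right _ _).trans (min_le_right _ _))
  obtain ⟨Δ, hΔ⟩ : ∃ Δ, Δ = rp - rm := ⟨_, rfl⟩
  have hΔ0 : 0 < Δ := by linarith
  have hΔσ : Δ ≤ σ * rm := by
    rw [← hσ, div_lt_iff₀ hrm] at hrat2
    linarith
  have hwU : ∀ x ∈ U, w x = κ * Real.log ((rp - Real.sqrt (φ x)) / Δ) + m := by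
    intro x hx
    simp only [w, radialLog, hdist x hx, ENNReal.toReal_ofReal (Real.sqrt_nonneg _), hκ, hΔ]
  have hAU : ∀ x ∈ A, x ∈ U ∧ rm < Real.sqrt (φ x) ∧ Real.sqrt (φ x) < rp := by
    rintro x ⟨hxΩ, h1, h2⟩
    have hxU := hdU x hxΩ (h2.trans ((ENNReal.ofReal_lt_ofReal_iff ha).2 hrpa))
    rw [hdist x hxU] at h1 h2
    exact ⟨hxU, (ENNReal.ofReal_lt_ofReal_iff_of_nonneg hrm.le).1 h1,
      (ENNReal.ofReal_lt_ofReal_iff hrp0).1 h2⟩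
  have hSU : ∀ ρ, 0 < ρ → ρ < a → ∀ x ∈ geodesicSphere Ω g₀ ρ, x ∈ U ∧ Real.sqrt (φ x) = ρ := by
    rintro ρ hρ hρa x ⟨hxΩ, hx⟩
    have hxU := hdU x hxΩ (hx ▸ (ENNReal.ofReal_lt_ofReal_iff ha).2 hρa)
    rw [hdist x hxU] at hx
    exact ⟨hxU, (ENNReal.ofReal_eq_ofReal_iff (Real.sqrt_nonneg _) hρ.le).1 hx⟩
  have hwev : ∀ x ∈ U, w =ᶠ[𝓝 x] fun y => κ * Real.log ((rp - Real.sqrt (φ y)) / Δ) + m :=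
    fun x hx => by filter_upwards [hUo.mem_nhds hx] with y hy using hwU y hy
  -- Ensures μ - δ ≥ -1, as the eigenvalue comparison requires; it holds because (μ+1)·2βκ = 4κ(β+1)
  -- and κ > ε.
  have hδμ : ε / (2 * β * κ) ≤ μ + 1 := by
    rw [div_le_iff₀ (by positivity)]
    have h1 : (2 * β + 2) * (2 * κ) = (μ + 1) * (2 * β * κ) := by linear_combination -2 * κ * hμβ
    have h2 := mul_pos hβ0 hκ0
    linarith
  have hF : 0 < f (firstThenOnes n (-μ + C⁻¹ * ε)) :=
    hf.pos _ (firstThenOnes_mem hΓ hμ hμ_gt (by have : 0 < C := by linarith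
                                                positivity))
  have hC0 : 0 < C := by linarith
  refine ⟨?_, ?_, ?_, ?_, ?_⟩
  · intro x hx
    obtain ⟨hxU, h1, h2⟩ := hAU x hx
    have hφx : 0 < φ x := Real.sqrt_pos.1 (hrm.trans h1)
    have hψ : ContDiffAt ℝ 2 (fun y => κ * Real.log ((rp - Real.sqrt (φ y)) / Δ) + m) x :=
      (contDiffAt_logProfile (κ := κ) (m := m) hΔ0 hφx h2).comp x
        (hφ2.contDiffAt (hUo.mem_nhds hxU))
    exact (hψ.congr_of_eventuallyEq (hwev x hxU)).contDiffWithinAt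
  · exact div_pos hF (by rw [← hΔ]; positivity)
  · intro x hx
    obtain ⟨hxU, h1, h2⟩ := hAU x hx
    have hr : 0 < Real.sqrt (φ x) := hrm.trans h1
    have hφx : 0 < φ x := Real.sqrt_pos.1 hr
    obtain ⟨s, hs⟩ : ∃ s, s = rp - Real.sqrt (φ x) := ⟨_, rfl⟩
    have hs0 : 0 < s := by linarith
    have hsΔ : s ≤ Δ := by linarith
    have hθ : s / Real.sqrt (φ x) ≤ σ := by
      rw [div_le_iff₀ hr]
      exact hsΔ.trans (hΔσ.trans (mul_le_mul_of_nonneg_left h1.le hσ0.le))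
    have hKs : K * s ^ 2 ≤ e / 2 := by
      rw [lt_div_iff₀ (by positivity)] at hrpe
      have hs1 : s ≤ 1 := by linarith
      have hs2 : s ^ 2 ≤ rp := by
        rw [pow_two]
        exact (mul_le_of_le_one_left hs0.le hs1).trans (by linarith)
      have := mul_le_mul_of_nonneg_left hs2 hK
      linarith
    have hes : κ * η * (s / Real.sqrt (φ x)) + K * s ^ 2 ≤ e := by
      have : κ * η * (s / Real.sqrt (φ x)) ≤ κ * η * σ := by gcongr
      have h' : κ * η * σ = e / 2 := by rw [hη]; field_simp
      linarith
    obtain ⟨T, hT⟩ : ∃ T, T = κ ^ 2 / 2 - κ * (1 + η) * (s / Real.sqrt (φ x)) - K * s ^ 2 :=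
      ⟨_, rfl⟩
    obtain ⟨hT1, hT2⟩ := radial_coefficient_bounds hμβ hβ0 hε hκ hη0.le hK
      (div_nonneg hs0.le hr.le)
      (by rw [hσ, le_div_iff₀ (by positivity)] at hθ; exact hθ) hes he₁ he₂ hT
    have hT0 := lt_of_lt_of_le (by positivity) hT1
    have hδ : 0 < ε / (2 * β * κ) := by positivity
    obtain ⟨l, hl, hlΓ, hfl⟩ := exists_eigenvalueVector_radial hn hΓ hf hμ hμ_gt hΩ hg₀
      (hUΩ hxU) (hφ2.contDiffAt (hUo.mem_nhds hxU)) hφx (hgrad x hxU) hκ0.le hΔ0 h2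
      (hwev x hxU) (hHess x hxU) (hSch x hxU) (by rw [← hs]; exact hT) hT0 hδ hδμ
      (by rw [← hs]; exact hT2)
    rw [← hs] at hfl
    refine ⟨l, hl, hlΓ, le_trans ?_ hfl⟩
    have hq := firstThenOnes_quotient_le hΓ hf hμ hμ_gt hβ0 hε (by linarith : β ≤ κ) hC3
      (by linarith) hT1
    -- On the annulus s ≤ Δ, so the logarithm is nonpositive; thus e^{-2w}s⁻² ≥ e^{-2m}Δ⁻², the
    -- scale in the claim.
    have hwm : w x ≤ m := by
      rw [hwU x hxU, ← hs]
      have : Real.log (s / Δ) ≤ 0 := Real.log_nonpos (by positivity) ((div_le_one hΔ0).2 hsΔ)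
      linarith [mul_nonpos_of_nonneg_of_nonpos hκ0.le this]
    have h := conformal_scaling_le hC0 hF.le hs0 hsΔ hwm hq
    rw [hΔ, ← mul_assoc] at h
    exact h
  · intro x hx
    obtain ⟨hxU, h1⟩ := hSU rm hrm (hrat.trans hrpa) x hx
    rw [hwU x hxU, h1, ← hΔ, div_self hΔ0.ne', Real.log_one, mul_zero, zero_add]
  · have hlim : Tendsto (fun x => (rp - Real.sqrt (φ x)) / Δ)
        (comap (fun x => riemDistToSet Ω g₀ x (geodesicSphere Ω g₀ rp)) (𝓝 0) ⊓ 𝓟 A)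
        (𝓝[>] 0) := by
      have hA : ∀ᶠ x in comap (fun x => riemDistToSet Ω g₀ x (geodesicSphere Ω g₀ rp)) (𝓝 0)
          ⊓ 𝓟 A, x ∈ A := mem_inf_of_right (mem_principal_self A)
      refine tendsto_nhdsWithin_iff.2 ⟨?_, ?_⟩
      · have h1 : Tendsto (fun x => rp - Real.sqrt (φ x))
            (comap (fun x => riemDistToSet Ω g₀ x (geodesicSphere Ω g₀ rp)) (𝓝 0) ⊓ 𝓟 A)
            (𝓝 0) := by
          rw [tendsto_order]
          refine ⟨fun b hb => ?_, fun b hb => ?_⟩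
          · filter_upwards [hA] with x hx
            linarith [(hAU x hx).2.2]
          -- Every y on the outer sphere satisfies d(x,y) ≥ √φ(y) - √φ(x) = r₊ - r(x), so the
          -- distance to the sphere dominates r₊ - r and forces it to 0.
          · have hd : ∀ᶠ x in comap (fun x => riemDistToSet Ω g₀ x (geodesicSphere Ω g₀ rp)) (𝓝 0)
                ⊓ 𝓟 A, riemDistToSet Ω g₀ x (geodesicSphere Ω g₀ rp) < ENNReal.ofReal b :=
              mem_inf_of_left (preimage_mem_comap (gt_mem_nhds (ENNReal.ofReal_pos.2 hb)))
            filter_upwards [hA, hd] with x hx hxd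
            obtain ⟨hxU, _, h2⟩ := hAU x hx
            refine (ENNReal.ofReal_lt_ofReal_iff hb).1 (lt_of_le_of_lt ?_ hxd)
            refine le_iInf₂ fun y hy => ?_
            obtain ⟨hyU, hy1⟩ := hSU rp hrp0 hrpa y hy
            rw [← hy1]
            exact hdist2 x hxU y hyU
        simpa using h1.div_const Δ
      · filter_upwards [hA] with x hx
        exact div_pos (by linarith [(hAU x hx).2.2]) hΔ0
    have hb := tendsto_atBot_add_const_right _ m
      ((Real.tendsto_log_nhdsGT_zero.comp hlim).const_mul_atBot hκ0)
    refine hb.congr' ?_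
    filter_upwards [mem_inf_of_right (mem_principal_self A)] with x hx
    exact (hwU x (hAU x hx).1).symm
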